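/- Let $(M,g)$ be a smooth 4-dimensional Lorentzian manifold (Hausdorff, second countable), $A=A_i\,dx^i$ a smooth 1-form, $F=dA$, let $\gamma^i_{jk}$, $r_{ij}$, $r$ be the Christoffel symbols, the Ricci tensor and the Ricci scalar of $g$, let $c,k>0$, and let $\alpha=\alpha^*$ be a real number with $\tfrac32\alpha^2=k/c^4$. For $(x,y)\in TM$ put $\|y\|=\sqrt{g_{ij}y^iy^j}$ (complex square root), $2B^i=-\alpha\|y\|F^i{}_jy^j$, $2G^i=\gamma^i_{jk}y^jy^k+2B^i$, let $\cdot_i$ denote $\partial/\partial y^i$, and put $B^i{}_j=B^i{}_{\cdot j}$, $N^i{}_j=G^i{}_{\cdot j}$, $\delta_i=\partial_{x^i}-N^j{}_i\partial_{y^j}$, $E^i{}_j=(\delta_kN^i{}_j-\delta_jN^i{}_k)y^k$. The affine connection $D(\alpha)$ on $TM$ has Ricci tensor $R_{jl}=-\tfrac12(E^i{}_i)_{\cdot jl}$ and Ricci scalar $R=g^{jl}R_{jl}$. For every Lorentzian metric $g$ choose a smooth positive definite tensor $v_{ij}(x)$ with $\det(v_{ij})=|\det(g_{ij})|$, let $\tilde\Delta(x)=\{y\in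 T_xM: v_{ij}y^iy^j\le\sqrt{2/\pi^2}\}$ (a ball of volume 1), $d\Omega=\sqrt{|\det g|\det v}\;d^4x\wedge d^4y$, and for compact $\Delta\subset M$ let $$S_{fg}(\alpha)=-\frac{c^3}{16\pi k}\int_{\Delta\times\tilde\Delta}R\,d\Omega .$$ Put $\tilde R_{ij}=r_{ij}-\tfrac12(B^l{}_hB^h{}_l)_{\cdot ij}$, $\tilde R=r+\tfrac{3\alpha^2}{2}F_{ij}F^{ij}$, $$\mathcal B=6\,\frac{B^lB_l}{\|y\|^2}+\frac12B^i{}_hB^h{}_i,\qquad \mathcal G_{ij}=\tilde R_{ij}-\tfrac12\tilde R\,g_{ij}+\mathcal B_{\cdot ij}\qquad (g_{ij}y^iy^j\neq0).$$ Then: 1. The $\mathcal G_{ij}$ are real, and are the components of a smooth symmetric horizontal tensor field $\mathcal G=\mathcal G_{ij}\,dx^i\otimes dx^j$ on $TM$ (off the null cones). 2. $\mathcal G$ contains the electromagnetic stress-energy: $\mathcal G_{ij}=r_{ij}-\tfrac12r\,g_{ij}-\frac{8\pi k}{c^4}T_{ij}$, where $T_{ij}=\frac1{4\pi}\left(-F_{il}F_j{}^l+\tfrac14g_{ij}F^{lm}F_{lm}\right)$.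 3. The vacuum Einstein–Maxwell equations obtained by varying $S_{fg}(\alpha^*)$ with respect to $g^{ij}$ (with $A$ fixed) are equivalent to $\mathcal G_{ij}=0$: for every compact $\Delta\subset M$, the first variation of $S_{fg}(\alpha^*)$ vanishes for all smooth variations of the metric that are supported in a compact subset of the interior of $\Delta$ if and only if $\mathcal G_{ij}=0$ over the interior of $\Delta$. Consequently it vanishes for all compact $\Delta$ if and only if $\mathcal G_{ij}=0$ everywhere. -/

import Mathlib

open scoped Manifold ContDiff

namespace EinsteinMaxwell

/-- The model space of local coordinates `(x⁰, x¹, x², x³)`, also used for fibre coordinates. -/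
abbrev Coord := Fin 4 → ℝ

/-! ### Local expressions on the base manifold

`g x` is the matrix `(g_ij(x))`, `A x` is the tuple `(A_i(x))`, in some coordinate system. -/

/-- Partial derivative `∂f/∂xⁱ`. -/
noncomputable def pd {V : Type*} [NormedAddCommGroup V] [NormedSpace ℝ V]
    (i : Fin 4) (f : Coord → V) (x : Coord) : V :=
  fderiv ℝ f x (Pi.single i 1)

/-- Christoffel symbols `γⁱ_jk` of the Levi-Civita connection. -/
noncomputable def christoffel (g : Coord → Matrix (Fin 4) (Fin 4) ℝ) (x : Coord)
    (i j k : Fin 4) : ℝ :=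
  (1 / 2) * ∑ h, (g x)⁻¹ i h *
    (pd j (fun z => g z h k) x + pd k (fun z => g z h j) x - pd h (fun z => g z j k) x)

/-- Ricci tensor `r_jl` of the Levi-Civita connection. -/
noncomputable def ricci (g : Coord → Matrix (Fin 4) (Fin 4) ℝ) (x : Coord) (j l : Fin 4) : ℝ :=
  ∑ i, (pd i (fun z => christoffel g z i j l) x - pd l (fun z => christoffel g z i i j) x
    + ∑ m, (christoffel g x m j l * christoffel g x i i m
        - christoffel g x m i j * christoffel g x i l m))

/-- Ricci scalar `r = g^{jl} r_jl`. -/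
noncomputable def ricciScalar (g : Coord → Matrix (Fin 4) (Fin 4) ℝ) (x : Coord) : ℝ :=
  ∑ j, ∑ l, (g x)⁻¹ j l * ricci g x j l

/-- Einstein tensor `G_ij = r_ij - ½ r g_ij`. -/
noncomputable def einsteinTensor (g : Coord → Matrix (Fin 4) (Fin 4) ℝ) (x : Coord)
    (i j : Fin 4) : ℝ :=
  ricci g x i j - (1 / 2) * ricciScalar g x * g x i j

/-- Faraday tensor `F = dA`, i.e. `F_ij = ∂_i A_j - ∂_j A_i`. -/
noncomputable def faraday (A : Coord → Coord) (x : Coord) (i j : Fin 4) : ℝ :=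
  pd i (fun z => A z j) x - pd j (fun z => A z i) x

/-- `Fⁱ_j = g^{ih} F_hj`. -/
noncomputable def faradayMixed (g : Coord → Matrix (Fin 4) (Fin 4) ℝ) (A : Coord → Coord)
    (x : Coord) (i j : Fin 4) : ℝ :=
  ∑ h, (g x)⁻¹ i h * faraday A x h j

/-- `F_ij F^{ij}`. -/
noncomputable def faradaySq (g : Coord → Matrix (Fin 4) (Fin 4) ℝ) (A : Coord → Coord)
    (x : Coord) : ℝ :=
  ∑ i, ∑ j, ∑ k, ∑ l, (g x)⁻¹ i k * (g x)⁻¹ j l * faraday A x i j * faraday A x k l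

/-- Stress-energy tensor of the electromagnetic field,
`T_ij = (1/4π) (-F_il F_j^l + ¼ g_ij F^{lm} F_lm)`. -/
noncomputable def emStressEnergy (g : Coord → Matrix (Fin 4) (Fin 4) ℝ) (A : Coord → Coord)
    (x : Coord) (i j : Fin 4) : ℝ :=
  1 / (4 * Real.pi) *
    (-(∑ l, ∑ m, faraday A x i l * (g x)⁻¹ l m * faraday A x j m)
      + (1 / 4) * g x i j * faradaySq g A x)

/-! ### Local expressions on the tangent bundle

Points of `TM` are given by their coordinates `(x, y)`. The norm `‖y‖ = √(g_ij yⁱ yʲ)` is the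
complex square root, so that it is defined for all `y`; it is real for `g_ij yⁱ yʲ ≥ 0` and purely
imaginary for `g_ij yⁱ yʲ < 0`. It is smooth off the null cone `g_ij yⁱ yʲ = 0`. -/

/-- `g_ij(x) yⁱ yʲ`. -/
def sqNorm (g : Coord → Matrix (Fin 4) (Fin 4) ℝ) (x y : Coord) : ℝ :=
  ∑ i, ∑ j, g x i j * y i * y j

/-- The (principal) complex square root of a real number. -/
noncomputable def root (q : ℝ) : ℂ := (Real.sqrt q : ℂ) + (Real.sqrt (-q) : ℂ) * Complex.I

/-- `‖y‖ = √(g_ij(x) yⁱ yʲ)`. -/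
noncomputable def norm (g : Coord → Matrix (Fin 4) (Fin 4) ℝ) (x y : Coord) : ℂ :=
  root (sqNorm g x y)

/-- The horizontal vector field `B`, given by `2 Bⁱ = -α ‖y‖ Fⁱ_j yʲ`. -/
noncomputable def fieldB (g : Coord → Matrix (Fin 4) (Fin 4) ℝ) (A : Coord → Coord) (α : ℝ)
    (x y : Coord) (i : Fin 4) : ℂ :=
  -((α : ℂ) / 2) * norm g x y * ∑ j, (faradayMixed g A x i j : ℂ) * (y j : ℂ)

/-- `Bⁱ_j = ∂Bⁱ/∂yʲ`. -/
noncomputable def fieldB1 (g : Coord → Matrix (Fin 4) (Fin 4) ℝ) (A : Coord → Coord) (α : ℝ)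
    (x y : Coord) (i j : Fin 4) : ℂ :=
  pd j (fun w => fieldB g A α x w i) y

/-- `Bⁱ_h B^h_i`. -/
noncomputable def traceBB (g : Coord → Matrix (Fin 4) (Fin 4) ℝ) (A : Coord → Coord) (α : ℝ)
    (x y : Coord) : ℂ :=
  ∑ i, ∑ h, fieldB1 g A α x y i h * fieldB1 g A α x y h i

/-- `B^l B_l = g_lm B^l B^m`. -/
noncomputable def sqB (g : Coord → Matrix (Fin 4) (Fin 4) ℝ) (A : Coord → Coord) (α : ℝ)
    (x y : Coord) : ℂ :=
  ∑ l, ∑ m, (g x l m : ℂ) * fieldB g A α x y l * fieldB g A α x y m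

/-- The spray `Gⁱ`, given by `2 Gⁱ = γⁱ_jk yʲ yᵏ + 2 Bⁱ`. -/
noncomputable def spray (g : Coord → Matrix (Fin 4) (Fin 4) ℝ) (A : Coord → Coord) (α : ℝ)
    (x y : Coord) (i : Fin 4) : ℂ :=
  (1 / 2) * ∑ j, ∑ k, (christoffel g x i j k : ℂ) * (y j : ℂ) * (y k : ℂ) + fieldB g A α x y i

/-- The coefficients `Nⁱ_j = ∂Gⁱ/∂yʲ` of the spray connection. -/
noncomputable def connN (g : Coord → Matrix (Fin 4) (Fin 4) ℝ) (A : Coord → Coord) (α : ℝ)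
    (x y : Coord) (i j : Fin 4) : ℂ :=
  pd j (fun w => spray g A α x w i) y

/-- The adapted derivative `δ_k f = ∂f/∂xᵏ - N^l_k ∂f/∂y^l`. -/
noncomputable def deltaD (g : Coord → Matrix (Fin 4) (Fin 4) ℝ) (A : Coord → Coord) (α : ℝ)
    (k : Fin 4) (f : Coord → Coord → ℂ) (x y : Coord) : ℂ :=
  pd k (fun z => f z y) x - ∑ l, connN g A α x y l k * pd l (fun w => f x w) y

/-- The curvature `Rⁱ_jk = δ_k Nⁱ_j - δ_j Nⁱ_k` of the spray connection. -/
noncomputable def curvN (g : Coord → Matrix (Fin 4) (Fin 4) ℝ) (A : Coord → Coord) (α : ℝ)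
    (x y : Coord) (i j k : Fin 4) : ℂ :=
  deltaD g A α k (fun z w => connN g A α z w i j) x y
    - deltaD g A α j (fun z w => connN g A α z w i k) x y

/-- The tidal tensor `Eⁱ_j = Rⁱ_jk yᵏ`. -/
noncomputable def tidal (g : Coord → Matrix (Fin 4) (Fin 4) ℝ) (A : Coord → Coord) (α : ℝ)
    (x y : Coord) (i j : Fin 4) : ℂ :=
  ∑ k, curvN g A α x y i j k * (y k : ℂ)

/-- The Ricci tensor `R_jl = -½ ∂²(Eⁱ_i)/∂yʲ∂y^l` of the affine connection `D(α)` on `TM`. -/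
noncomputable def ricciD (g : Coord → Matrix (Fin 4) (Fin 4) ℝ) (A : Coord → Coord) (α : ℝ)
    (x y : Coord) (j l : Fin 4) : ℂ :=
  -(1 / 2) * pd l (fun w => pd j (fun w' => ∑ i, tidal g A α x w' i i) w) y

/-- The Ricci scalar `R = g^{jl} R_jl` of `D(α)`. -/
noncomputable def ricciScalarD (g : Coord → Matrix (Fin 4) (Fin 4) ℝ) (A : Coord → Coord) (α : ℝ)
    (x y : Coord) : ℂ :=
  ∑ j, ∑ l, ((g x)⁻¹ j l : ℂ) * ricciD g A α x y j l

/-- `R̃_ij = r_ij - ½ ∂²(B^l_h B^h_l)/∂yⁱ∂yʲ`: the Ricci tensor of `D(α)` without the divergence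
of `∂²B^l/∂yⁱ∂yʲ`. -/
noncomputable def ricciTilde (g : Coord → Matrix (Fin 4) (Fin 4) ℝ) (A : Coord → Coord) (α : ℝ)
    (x y : Coord) (i j : Fin 4) : ℂ :=
  (ricci g x i j : ℂ) - (1 / 2) * pd j (fun w => pd i (fun w' => traceBB g A α x w') w) y

/-- `R̃ = r + (3α²/2) F_ij F^{ij}`. -/
noncomputable def ricciScalarTilde (g : Coord → Matrix (Fin 4) (Fin 4) ℝ) (A : Coord → Coord)
    (α : ℝ) (x : Coord) : ℝ :=
  ricciScalar g x + 3 * α ^ 2 / 2 * faradaySq g A x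

/-- `ℬ = 6 B^l B_l / ‖y‖² + ½ Bⁱ_h B^h_i`. -/
noncomputable def calB (g : Coord → Matrix (Fin 4) (Fin 4) ℝ) (A : Coord → Coord) (α : ℝ)
    (x y : Coord) : ℂ :=
  6 * (sqB g A α x y / norm g x y ^ 2) + (1 / 2) * traceBB g A α x y

/-- The generalized Einstein tensor `𝒢_ij = R̃_ij - ½ R̃ g_ij + ∂²ℬ/∂yⁱ∂yʲ`. -/
noncomputable def calG (g : Coord → Matrix (Fin 4) (Fin 4) ℝ) (A : Coord → Coord) (α : ℝ)
    (x y : Coord) (i j : Fin 4) : ℂ :=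
  ricciTilde g A α x y i j - (1 / 2) * (ricciScalarTilde g A α x : ℂ) * (g x i j : ℂ)
    + pd j (fun w => pd i (fun w' => calB g A α x w') w) y

/-! ### Fields on a 4-manifold -/

section Manifold

variable {M : Type*} [TopologicalSpace M] [ChartedSpace Coord M]

/-- The tangent vector `yⁱ ∂_i` at the point with coordinates `u` in the chart `e`. -/
noncomputable def tangentVec (e : OpenPartialHomeomorph M Coord) (u y : Coord) :
    TangentSpace 𝓘(ℝ, Coord) (e.symm u) :=
  mfderiv 𝓘(ℝ, Coord) 𝓘(ℝ, Coord) e.symm u y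

/-- The coordinate vector field `∂_i` at the point with coordinates `u` in the chart `e`. -/
noncomputable def frame (e : OpenPartialHomeomorph M Coord) (u : Coord) (i : Fin 4) :
    TangentSpace 𝓘(ℝ, Coord) (e.symm u) :=
  tangentVec e u (Pi.single i 1)

/-- Components `T_ij(u)` of a field of bilinear forms in the chart `e`. -/
noncomputable def comp (T : ∀ x : M, LinearMap.BilinForm ℝ (TangentSpace 𝓘(ℝ, Coord) x))
    (e : OpenPartialHomeomorph M Coord) (u : Coord) : Matrix (Fin 4) (Fin 4) ℝ :=
  Matrix.of fun i j => T (e.symm u) (frame e u i) (frame e u j)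

variable (M) in
/-- A smooth Lorentzian metric. Both sign conventions, `(+,-,-,-)` (`σ = 1`) and `(-,+,+,+)`
(`σ = -1`), are allowed. -/
structure LorentzMetric where
  val : ∀ x : M, LinearMap.BilinForm ℝ (TangentSpace 𝓘(ℝ, Coord) x)
  symm : ∀ x v w, val x v w = val x w v
  lorentzian : ∃ σ : ℝ, (σ = 1 ∨ σ = -1) ∧ ∀ x, ∃ t, 0 < σ * val x t t ∧
    ∀ w, w ≠ 0 → val x t w = 0 → σ * val x w w < 0
  smooth : ∀ e ∈ IsManifold.maximalAtlas 𝓘(ℝ, Coord) ∞ M, ∀ i j,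
    ContDiffOn ℝ ∞ (fun u => comp val e u i j) e.target

variable (M) in
/-- A smooth 1-form (the electromagnetic potential). -/
structure OneForm where
  val : ∀ x : M, Module.Dual ℝ (TangentSpace 𝓘(ℝ, Coord) x)
  smooth : ∀ e ∈ IsManifold.maximalAtlas 𝓘(ℝ, Coord) ∞ M, ∀ i,
    ContDiffOn ℝ ∞ (fun u => val (e.symm u) (frame e u i)) e.target

/-- The components `A_i(u)` in the chart `e`. -/
noncomputable def OneForm.comp (A : OneForm M) (e : OpenPartialHomeomorph M Coord) (u : Coord) :
    Coord :=
  fun i => A.val (e.symm u) (frame e u i)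

/-- A fibre metric `v = v_ij(x) δyⁱ ⊗ δyʲ` for `g`: smooth, positive definite, and with
`det (v_ij) = |det (g_ij)|` in all coordinate systems. -/
structure FibreMetric (g : LorentzMetric M) where
  val : ∀ x : M, LinearMap.BilinForm ℝ (TangentSpace 𝓘(ℝ, Coord) x)
  symm : ∀ x v w, val x v w = val x w v
  pos : ∀ x w, w ≠ 0 → 0 < val x w w
  smooth : ∀ e ∈ IsManifold.maximalAtlas 𝓘(ℝ, Coord) ∞ M, ∀ i j,
    ContDiffOn ℝ ∞ (fun u => EinsteinMaxwell.comp val e u i j) e.target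
  det_eq : ∀ e ∈ IsManifold.maximalAtlas 𝓘(ℝ, Coord) ∞ M, ∀ u ∈ e.target,
    (EinsteinMaxwell.comp val e u).det = |(EinsteinMaxwell.comp g.val e u).det|

section Action

variable [MeasurableSpace M]

/-- The measure `√|det g| d⁴x` on the domain of the chart `e`, extended by zero to `M`. -/
noncomputable def localVolume (g : LorentzMetric M) (e : OpenPartialHomeomorph M Coord) :
    MeasureTheory.Measure M :=
  (((MeasureTheory.volume : MeasureTheory.Measure Coord).restrict e.target).withDensity
    (fun u => ENNReal.ofReal (Real.sqrt |(comp g.val e u).det|))).map e.symm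

/-- The volume measure `√|det g| d⁴x` of `(M, g)`. The local measures agree on the overlaps of
the chart domains, so that they glue to a measure on `M`, which is their supremum. -/
noncomputable def volumeMeasure (g : LorentzMetric M) : MeasureTheory.Measure M :=
  ⨆ e ∈ atlas Coord M, localVolume g e

/-- The canonical integration domain `Δ̃(x) = {y | v_ij yⁱ yʲ ≤ √(2/π²)}` in `T_x M`, in the fibre
coordinates of the preferred chart at `x`. It is a ball of volume `1` with respect to `v`. -/
noncomputable def fibreBall {g : LorentzMetric M} (v : FibreMetric g) (x : M) : Set Coord :=
  {y | sqNorm (comp v.val (chartAt Coord x)) (chartAt Coord x x) y ≤ Real.sqrt (2 / Real.pi ^ 2)}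

/-- The action `S_fg = -(c³/16πk) ∫_{Δ × Δ̃} R dΩ`, where `R` is the Ricci scalar of `D(α)` and
`dΩ = (√|det g| d⁴x) ∧ (√(det v) d⁴y)`. The inner integral does not depend on the chart at `x` in
which it is written. -/
noncomputable def action (c k α : ℝ) (A : OneForm M) (g : LorentzMetric M) (v : FibreMetric g)
    (Δ : Set M) : ℂ :=
  -((c ^ 3 / (16 * Real.pi * k) : ℝ) : ℂ) *
    ∫ x in Δ, (∫ y in fibreBall v x,
        ricciScalarD (comp g.val (chartAt Coord x)) (A.comp (chartAt Coord x)) α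
            (chartAt Coord x x) y *
          (Real.sqrt (comp v.val (chartAt Coord x) (chartAt Coord x x)).det : ℂ))
      ∂(volumeMeasure g)

end Action

/-- A smooth variation of the metric `g` (equivalently, of the components `g^{ij}`), supported in
a compact subset of the interior of `Δ`. -/
structure MetricVariation (g : LorentzMetric M) (Δ : Set M) where
  metric : ℝ → LorentzMetric M
  metric_zero : metric 0 = g
  support : ∃ K : Set M, IsCompact K ∧ K ⊆ interior Δ ∧
    ∀ ε, ∀ x ∉ K, (metric ε).val x = g.val x
  smooth : ∀ e ∈ IsManifold.maximalAtlas 𝓘(ℝ, Coord) ∞ M, ∀ i j,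
    ContDiffOn ℝ ∞ (fun p : ℝ × Coord => comp (metric p.1).val e p.2 i j) (Set.univ ×ˢ e.target)

/-- The vacuum Einstein–Maxwell equations in variational form: the first variation of `S_fg` over
`Δ` with respect to the metric vanishes at `g`. `V` is the choice of the fibre metrics. -/
def IsStationary [MeasurableSpace M] (c k α : ℝ) (A : OneForm M)
    (V : ∀ g : LorentzMetric M, FibreMetric g) (g : LorentzMetric M) (Δ : Set M) : Prop :=
  ∀ G : MetricVariation g Δ,
    HasDerivAt (fun ε : ℝ => action c k α A (G.metric ε) (V (G.metric ε)) Δ) 0 0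

/-- A horizontal tensor field `𝒢_ij(x, y) dxⁱ ⊗ dxʲ` on `TM`, defined off the null cones of `g`, is
a family of bilinear forms `T x w` on `T_x M`, indexed by the points `(x, w)` of `TM`, whose
components are smooth there. (The values of `T` on the null cones are irrelevant.) -/
structure HorizontalTensor (g : LorentzMetric M) where
  val : ∀ x : M, TangentSpace 𝓘(ℝ, Coord) x → LinearMap.BilinForm ℝ (TangentSpace 𝓘(ℝ, Coord) x)
  smooth : ∀ e ∈ IsManifold.maximalAtlas 𝓘(ℝ, Coord) ∞ M, ∀ i j,
    ContDiffOn ℝ ∞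
      (fun p : Coord × Coord =>
        val (e.symm p.1) (tangentVec e p.1 p.2) (frame e p.1 i) (frame e p.1 j))
      {p | p.1 ∈ e.target ∧ sqNorm (comp g.val e) p.1 p.2 ≠ 0}

/-- `T` is a symmetric tensor at all points of `TM` off the null cones. -/
def HorizontalTensor.IsSymmetric {g : LorentzMetric M} (T : HorizontalTensor g) : Prop :=
  ∀ x w, g.val x w w ≠ 0 → ∀ a b, T.val x w a b = T.val x w b a

/-- The functions `𝒢_ij` are the components of `T` in all coordinate systems. -/
def HorizontalTensor.HasComponentsCalG {g : LorentzMetric M} (T : HorizontalTensor g)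
    (A : OneForm M) (α : ℝ) : Prop :=
  ∀ e ∈ IsManifold.maximalAtlas 𝓘(ℝ, Coord) ∞ M, ∀ u ∈ e.target, ∀ y,
    sqNorm (comp g.val e) u y ≠ 0 → ∀ i j,
      calG (comp g.val e) (A.comp e) α u y i j =
        ((T.val (e.symm u) (tangentVec e u y) (frame e u i) (frame e u j) : ℝ) : ℂ)

/-- The equations `𝒢_ij(x, y) = 0` for all `x ∈ U` and all non-null `y`, in all coordinate
systems. -/
def CalGVanishesOn (g : LorentzMetric M) (A : OneForm M) (α : ℝ) (U : Set M) : Prop :=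
  ∀ e ∈ IsManifold.maximalAtlas 𝓘(ℝ, Coord) ∞ M, ∀ u ∈ e.target, e.symm u ∈ U → ∀ y,
    sqNorm (comp g.val e) u y ≠ 0 → ∀ i j, calG (comp g.val e) (A.comp e) α u y i j = 0

end Manifold

end EinsteinMaxwell

/-! Both halves of the theorem meet in one tensor on the base, `einsteinMaxwell β`: it is G_ij + β
(2 F_il F_j^l - ½ F² g_ij) with β = 3α²/2, where F² stands for F_lm F^lm.

The algebraic half. Since F is antisymmetric, F_ij yⁱ yʲ = 0, so B is orthogonal to y. Off the null
cone, Bⁱ_j = -(α/2) (y_j Fⁱ_k yᵏ / ‖y‖ + ‖y‖ Fⁱ_j). In the trace of the square of this matrix the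
term with 1/‖y‖² vanishes by orthogonality, and otherwise ‖y‖ occurs only through ‖y‖² = g_ij yⁱ yʲ;
so Bⁱ_h B^h_i is a real quadratic form in y (`traceBB_eq`). The same is true of B^l B_l / ‖y‖²
(`sqB_eq`). Hence all Hessians in 𝒢 are independent of y, those of Bⁱ_h B^h_i in R̃ and in ℬ cancel,
and what remains is `einsteinMaxwell` (`calG_eq`). Reality, symmetry and tensoriality follow, and β
= k/c⁴ turns the terms in F into -(8πk/c⁴) T_ij.

The reduction of the action. The Euler relations for the homogeneous spray give the trace of the
tidal tensor, and from it R = r + β F² - (5α/2) c_k yᵏ / ‖y‖ off the null cone, with c_k the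
covariant divergence of Fⁱ_k (`ricciScalarD_eq`). The last term is odd in y and the fibre ball is
symmetric, so it integrates to zero, provided that it is integrable: its singularity on the null
cone is of the type |z|^(-1/2) (`exists_kernel`). The remaining terms are constant on the fibre and
acquire the factor vol · √(det v), which is the same for all v (`volume_quadForm_le`). So the action
is a nonzero constant times ∫ (r + β F²) √|det g| d⁴x over Δ, whatever the fibre metrics
(`action_eq`).

The variation. This is Hilbert's argument. By the Palatini formula (`MetricFam.palatini`) the
linearized density is E^ab h_ab plus a divergence, where E^ab is -√|det g| times `einsteinMaxwell`
with raised indices (`MetricFam.hasDerivAt_lagDensity`). On the manifold, densities are turned into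
functions by division by the volume density of the unvaried metric; then differentiation under the
integral over the compact set Δ is dominated convergence (`hasDerivAt_integral_lagrangianAt`). The
transformation laws of the curvature and of F make this independent of charts. If E vanishes over
the interior, a partition of unity cuts the variation into pieces supported in charts, where
divergences integrate to zero (`setIntegral_linDensity_eq_zero`). If E does not vanish at some
interior point, a bump function times the value of E there is an admissible direction
(`exists_variation`), in which the first variation is positive
(`eulerLagrange_eq_zero_of_stationary`). -/

namespace EinsteinMaxwell

/-! ### Partial derivatives -/

section Calculus

open Filter Topology

section Rules

variable {V : Type*} [NormedAddCommGroup V] [NormedSpace ℝ V]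

theorem pd_congr {f g : Coord → V} {x : Coord} (h : f =ᶠ[𝓝 x] g) (i : Fin 4) :
    pd i f x = pd i g x := by
  unfold pd; rw [h.fderiv_eq]

theorem pd_congr_of_mem {f g : Coord → V} {x : Coord} {U : Set Coord} (hU : IsOpen U) (hx : x ∈ U)
    (h : ∀ z ∈ U, f z = g z) (i : Fin 4) : pd i f x = pd i g x :=
  pd_congr (Filter.eventuallyEq_of_mem (hU.mem_nhds hx) h) i

theorem _root_.HasFDerivAt.pd_eq {f : Coord → V} {f' : Coord →L[ℝ] V} {x : Coord}
    (h : HasFDerivAt f f' x) (i : Fin 4) : pd i f x = f' (Pi.single i 1) := by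
  unfold pd; rw [h.fderiv]

@[simp] theorem pd_const (i : Fin 4) (c : V) (x : Coord) : pd i (fun _ => c) x = 0 := by
  simp [pd]

theorem pd_add {f g : Coord → V} {x : Coord} (hf : DifferentiableAt ℝ f x)
    (hg : DifferentiableAt ℝ g x) (i : Fin 4) :
    pd i (fun z => f z + g z) x = pd i f x + pd i g x :=
  (hf.hasFDerivAt.add hg.hasFDerivAt).pd_eq i

theorem pd_sub {f g : Coord → V} {x : Coord} (hf : DifferentiableAt ℝ f x)
    (hg : DifferentiableAt ℝ g x) (i : Fin 4) :
    pd i (fun z => f z - g z) x = pd i f x - pd i g x :=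
  (hf.hasFDerivAt.sub hg.hasFDerivAt).pd_eq i

theorem pd_sum {ι : Type*} {s : Finset ι} {f : ι → Coord → V} {x : Coord}
    (hf : ∀ a ∈ s, DifferentiableAt ℝ (f a) x) (i : Fin 4) :
    pd i (fun z => ∑ a ∈ s, f a z) x = ∑ a ∈ s, pd i (f a) x := by
  have := (HasFDerivAt.fun_sum fun a ha => (hf a ha).hasFDerivAt).pd_eq i
  rw [this]; simp [pd]

theorem fderiv_apply_eq_sum_pd (f : Coord → V) (x v : Coord) :
    fderiv ℝ f x v = ∑ a, v a • pd a f x := by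
  have hv : v = ∑ a, v a • (Pi.single a (1 : ℝ) : Coord) := by
    ext b; simp [Finset.sum_apply, Pi.single_apply]
  conv_lhs => rw [hv]
  simp [pd, map_sum]

end Rules

section Algebra

variable {𝔸 : Type*} [NormedCommRing 𝔸] [NormedAlgebra ℝ 𝔸]

theorem pd_mul {f g : Coord → 𝔸} {x : Coord} (hf : DifferentiableAt ℝ f x)
    (hg : DifferentiableAt ℝ g x) (i : Fin 4) :
    pd i (fun z => f z * g z) x = f x * pd i g x + pd i f x * g x := by
  have h := (hf.hasFDerivAt.mul hg.hasFDerivAt).pd_eq i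
  change pd i (f * g) x = _
  rw [h]
  simp [pd, mul_comm]

theorem pd_const_mul {f : Coord → 𝔸} {x : Coord} (hf : DifferentiableAt ℝ f x) (c : 𝔸)
    (i : Fin 4) : pd i (fun z => c * f z) x = c * pd i f x := by
  rw [pd_mul (differentiableAt_const c) hf]; simp

theorem pd_mul_const {f : Coord → 𝔸} {x : Coord} (hf : DifferentiableAt ℝ f x) (c : 𝔸)
    (i : Fin 4) : pd i (fun z => f z * c) x = pd i f x * c := by
  rw [pd_mul hf (differentiableAt_const c)]; simp

end Algebra

theorem _root_.DifferentiableAt.ofReal_comp {E : Type*} [NormedAddCommGroup E] [NormedSpace ℝ E]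
    {f : E → ℝ} {x : E} (hf : DifferentiableAt ℝ f x) :
    DifferentiableAt ℝ (fun z => (f z : ℂ)) x :=
  (Complex.ofRealCLM.hasFDerivAt.comp x hf.hasFDerivAt).differentiableAt

theorem pd_ofReal {f : Coord → ℝ} {x : Coord} (hf : DifferentiableAt ℝ f x) (i : Fin 4) :
    pd i (fun z => (f z : ℂ)) x = ((pd i f x : ℝ) : ℂ) := by
  have h := (Complex.ofRealCLM.hasFDerivAt.comp x hf.hasFDerivAt).pd_eq i
  change pd i (Complex.ofRealCLM ∘ f) x = _
  rw [h]
  simp [pd]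

theorem pd_coord (i a : Fin 4) (x : Coord) :
    pd i (fun z : Coord => z a) x = if a = i then 1 else 0 := by
  have := (hasFDerivAt_apply (𝕜 := ℝ) a x).pd_eq i
  rw [this]; simp [Pi.single_apply]

theorem pd_comp {f : Coord → ℝ} {φ : Coord → Coord} {x : Coord}
    (hf : DifferentiableAt ℝ f (φ x)) (hφ : ∀ a, DifferentiableAt ℝ (fun z => φ z a) x)
    (i : Fin 4) :
    pd i (fun z => f (φ z)) x = ∑ a, pd i (fun z => φ z a) x * pd a f (φ x) := by
  have hφ' : DifferentiableAt ℝ φ x := differentiableAt_pi.2 hφ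
  have h := (hf.hasFDerivAt.comp x hφ'.hasFDerivAt).pd_eq i
  have h2 : ∀ a, pd i (fun z => φ z a) x = fderiv ℝ φ x (Pi.single i 1) a := by
    intro a
    exact ((hasFDerivAt_pi'.1 hφ'.hasFDerivAt) a).pd_eq i
  change pd i (f ∘ φ) x = _
  rw [h]
  simp only [ContinuousLinearMap.comp_apply, h2, fderiv_apply_eq_sum_pd f, smul_eq_mul]

theorem two_le_infty : (2 : ℕ∞ω) ≤ ∞ := 
  WithTop.coe_le_coe.2 le_top

theorem pd_comm {f : Coord → ℝ} {x : Coord} (hf : ContDiffAt ℝ ∞ f x) (i j : Fin 4) :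
    pd i (fun z => pd j f z) x = pd j (fun z => pd i f z) x := by
  have hs := hf.isSymmSndFDerivAt (by simpa using two_le_infty)
  have hd : DifferentiableAt ℝ (fderiv ℝ f) x :=
    (hf.fderiv_right (m := 1) (by simpa [one_add_one_eq_two] using two_le_infty)).differentiableAt (by simp)
  have key : ∀ k l : Fin 4, pd k (fun z => pd l f z) x
      = fderiv ℝ (fderiv ℝ f) x (Pi.single k 1) (Pi.single l 1) := by
    intro k l
    have := (hd.hasFDerivAt.clm_apply (hasFDerivAt_const (Pi.single l (1 : ℝ) : Coord) x)).pd_eq k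
    unfold pd at this ⊢
    rw [this]; simp
  rw [key, key]
  exact hs _ _

/-! ### Smooth families of functions -/

/-- `f ε x` is a smooth function of `(ε, x) ∈ O`. -/
def SmoothFam (O : Set (ℝ × Coord)) (f : ℝ → Coord → ℝ) : Prop :=
  ContDiffOn ℝ ∞ (fun p : ℝ × Coord => f p.1 p.2) O

namespace SmoothFam

variable {O : Set (ℝ × Coord)} {f f' : ℝ → Coord → ℝ}

theorem const (c : ℝ) : SmoothFam O fun _ _ => c := contDiffOn_const

theorem add (h : SmoothFam O f) (h' : SmoothFam O f') : SmoothFam O fun ε x => f ε x + f' ε x :=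
  ContDiffOn.add h h'

theorem sub (h : SmoothFam O f) (h' : SmoothFam O f') : SmoothFam O fun ε x => f ε x - f' ε x :=
  ContDiffOn.sub h h'

theorem mul (h : SmoothFam O f) (h' : SmoothFam O f') : SmoothFam O fun ε x => f ε x * f' ε x :=
  ContDiffOn.mul h h'

theorem sum {ι : Type*} {s : Finset ι} {f : ι → ℝ → Coord → ℝ} (h : ∀ a ∈ s, SmoothFam O (f a)) :
    SmoothFam O fun ε x => ∑ a ∈ s, f a ε x :=
  ContDiffOn.sum h

theorem mono (h : SmoothFam O f) {O' : Set (ℝ × Coord)} (hO : O' ⊆ O) : SmoothFam O' f :=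
  ContDiffOn.mono h hO

theorem contDiffAt (h : SmoothFam O f) (hO : IsOpen O) {ε : ℝ} {x : Coord} (hx : (ε, x) ∈ O) :
    ContDiffAt ℝ ∞ (fun p : ℝ × Coord => f p.1 p.2) (ε, x) :=
  ContDiffOn.contDiffAt h (hO.mem_nhds hx)

theorem slice (h : SmoothFam O f) (hO : IsOpen O) {ε : ℝ} {x : Coord} (hx : (ε, x) ∈ O) :
    ContDiffAt ℝ ∞ (f ε) x :=
  (h.contDiffAt hO hx).comp x (contDiffAt_const.prodMk contDiffAt_id)

theorem differentiableAt (h : SmoothFam O f) (hO : IsOpen O) {ε : ℝ} {x : Coord}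
    (hx : (ε, x) ∈ O) : DifferentiableAt ℝ (f ε) x :=
  (h.slice hO hx).differentiableAt (by simp)

theorem sliceParam (h : SmoothFam O f) (hO : IsOpen O) {ε : ℝ} {x : Coord} (hx : (ε, x) ∈ O) :
    DifferentiableAt ℝ (fun s => f s x) ε :=
  (((h.contDiffAt hO hx).comp ε (contDiffAt_id.prodMk contDiffAt_const)).differentiableAt
    (by simp))

theorem pd_eq (h : SmoothFam O f) (hO : IsOpen O) {ε : ℝ} {x : Coord} (hx : (ε, x) ∈ O)
    (i : Fin 4) :
    pd i (f ε) x = fderiv ℝ (fun p : ℝ × Coord => f p.1 p.2) (ε, x) (0, Pi.single i 1) := by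
  have h1 : HasFDerivAt (fun p : ℝ × Coord => f p.1 p.2) _ ((fun z : Coord => (ε, z)) x) :=
    ((h.contDiffAt hO hx).differentiableAt (by simp)).hasFDerivAt
  have h2 : HasFDerivAt (fun z : Coord => (ε, z)) _ x :=
    (hasFDerivAt_const (𝕜 := ℝ) ε x).prodMk (hasFDerivAt_id x)
  have := (h1.comp x h2).pd_eq i
  change pd i ((fun p : ℝ × Coord => f p.1 p.2) ∘ fun z : Coord => (ε, z)) x = _
  rw [this]; simp

theorem deriv_eq (h : SmoothFam O f) (hO : IsOpen O) {ε : ℝ} {x : Coord} (hx : (ε, x) ∈ O) :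
    deriv (fun s => f s x) ε = fderiv ℝ (fun p : ℝ × Coord => f p.1 p.2) (ε, x) (1, 0) := by
  have h1 : HasFDerivAt (fun p : ℝ × Coord => f p.1 p.2) _ ((fun s : ℝ => (s, x)) ε) :=
    ((h.contDiffAt hO hx).differentiableAt (by simp)).hasFDerivAt
  have h2 : HasDerivAt (fun s : ℝ => (s, x)) _ ε :=
    (hasDerivAt_id ε).prodMk (hasDerivAt_const ε x)
  exact (h1.comp_hasDerivAt ε h2).deriv

theorem pd (h : SmoothFam O f) (hO : IsOpen O) (i : Fin 4) :
    SmoothFam O fun ε x => EinsteinMaxwell.pd i (f ε) x := by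
  have h1 := ContDiffOn.fderiv_of_isOpen (m := ∞) h hO (by simp)
  have h2 : ContDiffOn ℝ ∞ (fun p : ℝ × Coord =>
      fderiv ℝ (fun p : ℝ × Coord => f p.1 p.2) p (0, Pi.single i 1)) O :=
    h1.clm_apply contDiffOn_const
  exact h2.congr fun p hp => h.pd_eq hO hp i

theorem deriv (h : SmoothFam O f) (hO : IsOpen O) :
    SmoothFam O fun ε x => _root_.deriv (fun s => f s x) ε := by
  have h1 := ContDiffOn.fderiv_of_isOpen (m := ∞) h hO (by simp)
  have h2 : ContDiffOn ℝ ∞ (fun p : ℝ × Coord =>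
      fderiv ℝ (fun p : ℝ × Coord => f p.1 p.2) p (1, 0)) O :=
    h1.clm_apply contDiffOn_const
  exact h2.congr fun p hp => h.deriv_eq hO hp

/-- Both sides are values of the second derivative of the joint function of (ε, x), at the
directions (1, 0) and (0, e_i) in either order, and that derivative is symmetric. This lets
variations pass through the coordinate derivatives in the Christoffel symbols and in the curvature.
-/
theorem deriv_pd (h : SmoothFam O f) (hO : IsOpen O) {ε : ℝ} {x : Coord} (hx : (ε, x) ∈ O)
    (i : Fin 4) :
    _root_.deriv (fun s => EinsteinMaxwell.pd i (f s) x) ε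
      = EinsteinMaxwell.pd i (fun z => _root_.deriv (fun s => f s z) ε) x := by
  set F : ℝ × Coord → ℝ := fun p => f p.1 p.2 with hF
  have hc := h.contDiffAt hO hx
  have hs := hc.isSymmSndFDerivAt (by simpa using two_le_infty)
  have hd : DifferentiableAt ℝ (fderiv ℝ F) (ε, x) :=
    (hc.fderiv_right (m := 1) (by simpa [one_add_one_eq_two] using two_le_infty)).differentiableAt (by simp)
  have e1 : (fun s => EinsteinMaxwell.pd i (f s) x)
      =ᶠ[𝓝 ε] fun s => fderiv ℝ F (s, x) (0, Pi.single i 1) := by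
    have : ∀ᶠ s in 𝓝 ε, (s, x) ∈ O :=
      (Continuous.prodMk_left x).continuousAt.eventually (hO.mem_nhds hx)
    filter_upwards [this] with s hs using h.pd_eq hO hs i
  have e2 : (fun z => _root_.deriv (fun s => f s z) ε)
      =ᶠ[𝓝 x] fun z => fderiv ℝ F (ε, z) (1, 0) := by
    have : ∀ᶠ z in 𝓝 x, (ε, z) ∈ O :=
      (Continuous.prodMk_right ε).continuousAt.eventually (hO.mem_nhds hx)
    filter_upwards [this] with s hs using h.deriv_eq hO hs
  rw [e1.deriv_eq, pd_congr e2]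
  have d1 : HasDerivAt (fun s : ℝ => fderiv ℝ F (s, x) (0, Pi.single i 1))
      (fderiv ℝ (fderiv ℝ F) (ε, x) (1, 0) (0, Pi.single i 1)) ε := by
    have hd' : HasFDerivAt (fderiv ℝ F) _ ((fun s : ℝ => (s, x)) ε) := hd.hasFDerivAt
    have h1 : HasDerivAt (fun s : ℝ => (s, x)) (1, 0) ε :=
      (hasDerivAt_id ε).prodMk (hasDerivAt_const ε x)
    exact (ContinuousLinearMap.apply ℝ ℝ
      ((0, Pi.single i 1) : ℝ × Coord)).hasFDerivAt.comp_hasDerivAt ε (hd'.comp_hasDerivAt ε h1)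
  have d2 : EinsteinMaxwell.pd i (fun z => fderiv ℝ F (ε, z) (1, 0)) x
      = fderiv ℝ (fderiv ℝ F) (ε, x) (0, Pi.single i 1) (1, 0) := by
    have hd' : HasFDerivAt (fderiv ℝ F) _ ((fun z : Coord => (ε, z)) x) := hd.hasFDerivAt
    have h1 : HasFDerivAt (fun z : Coord => (ε, z))
        ((0 : Coord →L[ℝ] ℝ).prod (ContinuousLinearMap.id ℝ Coord)) x :=
      (hasFDerivAt_const ε x).prodMk (hasFDerivAt_id x)
    exact ((ContinuousLinearMap.apply ℝ ℝ
      ((1, 0) : ℝ × Coord)).hasFDerivAt.comp x (hd'.comp x h1)).pd_eq i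
  rw [d1.deriv, d2]
  exact hs _ _

theorem of_contDiffOn {U : Set Coord} {f : Coord → ℝ} (h : ContDiffOn ℝ ∞ f U) :
    SmoothFam (Set.univ ×ˢ U) fun _ => f :=
  h.comp contDiffOn_snd fun _ hp => hp.2

theorem contDiffOn_zero {U : Set Coord} (h : SmoothFam (Set.univ ×ˢ U) f) (ε : ℝ) :
    ContDiffOn ℝ ∞ (f ε) U :=
  ContDiffOn.comp (g := fun p : ℝ × Coord => f p.1 p.2) (f := fun x => (ε, x)) h
    (contDiffOn_const.prodMk contDiffOn_id) fun _ hx => ⟨trivial, hx⟩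

end SmoothFam

theorem contDiffOn_pd {U : Set Coord} (hU : IsOpen U) {f : Coord → ℝ} (h : ContDiffOn ℝ ∞ f U)
    (i : Fin 4) : ContDiffOn ℝ ∞ (fun z => pd i f z) U := by
  have h1 := ContDiffOn.fderiv_of_isOpen (m := ∞) h hU (by simp)
  exact h1.clm_apply contDiffOn_const

/-! ### Determinants and inverses of smooth matrices -/

theorem det_updateRow_eq_sum (A : Matrix (Fin 4) (Fin 4) ℝ) (i : Fin 4) (v : Coord) :
    (A.updateRow i v).det = ∑ j, A.adjugate j i * v j := by
  rw [Matrix.det_eq_sum_mul_adjugate_row _ i]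
  refine Finset.sum_congr rfl fun j _ => ?_
  rw [Matrix.adjugate_apply, Matrix.adjugate_apply]
  simp [Matrix.updateRow_idem, mul_comm]

/-- Jacobi's formula: by multilinearity the derivative replaces one row at a time, and each
resulting determinant expands into cofactors along the new row. The source space is left general so
that the formula serves both ∂/∂xⁱ and the derivative in the parameter of a variation. -/
theorem hasFDerivAt_det {E : Type*} [NormedAddCommGroup E] [NormedSpace ℝ E]
    {M : E → Matrix (Fin 4) (Fin 4) ℝ} {M' : Fin 4 → Fin 4 → E →L[ℝ] ℝ} {x : E}
    (h : ∀ i j, HasFDerivAt (fun z => M z i j) (M' i j) x) :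
    HasFDerivAt (fun z => (M z).det) (∑ i, ∑ j, (M x).adjugate j i • M' i j) x := by
  let D : ContinuousMultilinearMap ℝ (fun _ : Fin 4 => Coord) ℝ :=
    { (Matrix.detRowAlternating (n := Fin 4) (R := ℝ)).toMultilinearMap with
      cont := by
        change Continuous fun A : Fin 4 → Fin 4 → ℝ => Matrix.det (Matrix.of A)
        simp only [Matrix.det_apply]
        simp only [Matrix.of_apply]
        fun_prop }
  have hD : ∀ A : Matrix (Fin 4) (Fin 4) ℝ, D A = A.det := fun A => rfl
  have hM : HasFDerivAt (fun z => (fun i => M z i : Fin 4 → Coord))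
      (ContinuousLinearMap.pi fun i => ContinuousLinearMap.pi fun j => M' i j) x :=
    hasFDerivAt_pi.2 fun i => hasFDerivAt_pi.2 fun j => h i j
  have h1 := (D.hasFDerivAt (fun i => M x i)).comp x hM
  refine h1.congr_fderiv ?_
  ext v
  rw [ContinuousLinearMap.comp_apply, ContinuousMultilinearMap.linearDeriv_apply]
  simp only [FunLike.coe_sum, Finset.sum_apply, smul_apply, smul_eq_mul]
  refine Finset.sum_congr rfl fun i _ => ?_
  rw [← det_updateRow_eq_sum (M x) i fun j => M' i j v, ← hD]
  rfl

theorem contDiffOn_det {E : Type*} [NormedAddCommGroup E] [NormedSpace ℝ E] {n : ℕ∞ω}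
    {M : E → Matrix (Fin 4) (Fin 4) ℝ} {s : Set E}
    (h : ∀ i j, ContDiffOn ℝ n (fun z => M z i j) s) :
    ContDiffOn ℝ n (fun z => (M z).det) s := by
  simp only [Matrix.det_apply]
  refine ContDiffOn.sum fun σ _ => ?_
  simp only [Units.smul_def, zsmul_eq_mul]
  exact contDiffOn_const.mul (contDiffOn_prod fun i _ => h _ _)

theorem inv_apply_eq (A : Matrix (Fin 4) (Fin 4) ℝ) (i j : Fin 4) :
    A⁻¹ i j = (A.det)⁻¹ * A.adjugate i j := by
  rw [Matrix.inv_def]; simp [Ring.inverse_eq_inv']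

theorem contDiffOn_inv {E : Type*} [NormedAddCommGroup E] [NormedSpace ℝ E] {n : ℕ∞ω}
    {M : E → Matrix (Fin 4) (Fin 4) ℝ} {s : Set E}
    (h : ∀ i j, ContDiffOn ℝ n (fun z => M z i j) s) (hd : ∀ z ∈ s, (M z).det ≠ 0)
    (i j : Fin 4) : ContDiffOn ℝ n (fun z => (M z)⁻¹ i j) s := by
  simp only [inv_apply_eq]
  refine ((contDiffOn_det h).inv hd).mul ?_
  simp only [Matrix.adjugate_apply]
  refine contDiffOn_det fun a b => ?_
  simp only [Matrix.updateRow_apply]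
  split_ifs
  · exact contDiffOn_const
  · exact h a b

end Calculus

/-! ### Smooth metrics and families of metrics in coordinates; symmetry of the Ricci tensor. -/

section CoordinateMetrics

open Filter Topology

/-- `g` is a smooth symmetric non-degenerate matrix field on the open set `U`. -/
structure CoordMetric (U : Set Coord) (g : Coord → Matrix (Fin 4) (Fin 4) ℝ) : Prop where
  isOpen : IsOpen U
  smooth : ∀ i j, ContDiffOn ℝ ∞ (fun x => g x i j) U
  symm : ∀ x ∈ U, ∀ i j, g x i j = g x j i
  det_ne : ∀ x ∈ U, (g x).det ≠ 0

/-- `g ε x` is a smooth family of symmetric non-degenerate matrices, for `(ε, x) ∈ O`. -/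
structure MetricFam (O : Set (ℝ × Coord)) (g : ℝ → Coord → Matrix (Fin 4) (Fin 4) ℝ) :
    Prop where
  isOpen : IsOpen O
  smooth : ∀ i j, SmoothFam O (fun ε x => g ε x i j)
  symm : ∀ p ∈ O, ∀ i j, g p.1 p.2 i j = g p.1 p.2 j i
  det_ne : ∀ p ∈ O, (g p.1 p.2).det ≠ 0

/-- The volume density `√|det g|`. -/
noncomputable def volDensity (g : Coord → Matrix (Fin 4) (Fin 4) ℝ) (x : Coord) : ℝ :=
  Real.sqrt |(g x).det|

/-- The Lagrange function `r + β F_ij F^ij`. -/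
noncomputable def lagrangian (β : ℝ) (g : Coord → Matrix (Fin 4) (Fin 4) ℝ) (A : Coord → Coord)
    (x : Coord) : ℝ :=
  ricciScalar g x + β * faradaySq g A x

/-- The Lagrange density `√|det g| (r + β F_ij F^ij)`. -/
noncomputable def lagDensity (β : ℝ) (g : Coord → Matrix (Fin 4) (Fin 4) ℝ) (A : Coord → Coord)
    (x : Coord) : ℝ :=
  volDensity g x * lagrangian β g A x

namespace MetricFam

variable {O : Set (ℝ × Coord)} {g : ℝ → Coord → Matrix (Fin 4) (Fin 4) ℝ} {A : Coord → Coord}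

theorem inv (h : MetricFam O g) (i j : Fin 4) : SmoothFam O fun ε x => (g ε x)⁻¹ i j :=
  contDiffOn_inv (M := fun p : ℝ × Coord => g p.1 p.2) h.smooth h.det_ne i j

theorem slice (h : MetricFam O g) (ε : ℝ) : CoordMetric {x | (ε, x) ∈ O} (g ε) where
  isOpen := h.isOpen.preimage (Continuous.prodMk_right ε)
  smooth i j _ hx := ((h.smooth i j).slice h.isOpen hx).contDiffWithinAt
  symm _ hx := h.symm (ε, _) hx
  det_ne _ hx := h.det_ne (ε, _) hx

theorem christoffel (h : MetricFam O g) (i j k : Fin 4) :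
    SmoothFam O fun ε x => christoffel (g ε) x i j k := by
  unfold EinsteinMaxwell.christoffel
  refine (SmoothFam.const _).mul (SmoothFam.sum fun m _ => (h.inv i m).mul ?_)
  exact (((h.smooth _ _).pd h.isOpen _).add ((h.smooth _ _).pd h.isOpen _)).sub
    ((h.smooth _ _).pd h.isOpen _)

theorem ricci (h : MetricFam O g) (j l : Fin 4) :
    SmoothFam O fun ε x => ricci (g ε) x j l := by
  unfold EinsteinMaxwell.ricci
  refine SmoothFam.sum fun i _ => SmoothFam.add
    (((h.christoffel _ _ _).pd h.isOpen _).sub ((h.christoffel _ _ _).pd h.isOpen _))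
    (SmoothFam.sum fun m _ => ?_)
  exact ((h.christoffel _ _ _).mul (h.christoffel _ _ _)).sub
    ((h.christoffel _ _ _).mul (h.christoffel _ _ _))

theorem ricciScalar (h : MetricFam O g) : SmoothFam O fun ε x => ricciScalar (g ε) x := by
  unfold EinsteinMaxwell.ricciScalar
  exact SmoothFam.sum fun j _ => SmoothFam.sum fun l _ => (h.inv j l).mul (h.ricci j l)

theorem faraday {U : Set Coord} (hU : IsOpen U) (hO : ∀ p ∈ O, p.2 ∈ U)
    (hA : ∀ i, ContDiffOn ℝ ∞ (fun x => A x i) U) (i j : Fin 4) :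
    SmoothFam O fun _ x => faraday A x i j := by
  unfold EinsteinMaxwell.faraday
  have h1 : ∀ i j, SmoothFam O fun _ x => pd i (fun z => A z j) x := fun i j =>
    (SmoothFam.of_contDiffOn (contDiffOn_pd hU (hA j) i)).mono fun p hp => ⟨trivial, hO p hp⟩
  exact (h1 i j).sub (h1 j i)

theorem faradaySq (h : MetricFam O g) {U : Set Coord} (hU : IsOpen U) (hO : ∀ p ∈ O, p.2 ∈ U)
    (hA : ∀ i, ContDiffOn ℝ ∞ (fun x => A x i) U) :
    SmoothFam O fun ε x => faradaySq (g ε) A x := by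
  unfold EinsteinMaxwell.faradaySq
  exact SmoothFam.sum fun i _ => SmoothFam.sum fun j _ => SmoothFam.sum fun k _ =>
    SmoothFam.sum fun l _ => (((h.inv _ _).mul (h.inv _ _)).mul
      (faraday hU hO hA _ _)).mul (faraday hU hO hA _ _)

theorem volDensity (h : MetricFam O g) : SmoothFam O fun ε x => volDensity (g ε) x := by
  unfold EinsteinMaxwell.volDensity SmoothFam
  intro p hp
  have h1 : ContDiffWithinAt ℝ ∞ (fun p : ℝ × Coord => (g p.1 p.2).det) O p :=
    contDiffOn_det (M := fun p : ℝ × Coord => g p.1 p.2) h.smooth p hp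
  exact (h1.abs (h.det_ne p hp)).sqrt (abs_ne_zero.2 (h.det_ne p hp))

theorem lagDensity (h : MetricFam O g) {U : Set Coord} (hU : IsOpen U) (hO : ∀ p ∈ O, p.2 ∈ U)
    (hA : ∀ i, ContDiffOn ℝ ∞ (fun x => A x i) U) (β : ℝ) :
    SmoothFam O fun ε x => lagDensity β (g ε) A x :=
  h.volDensity.mul (h.ricciScalar.add ((SmoothFam.const β).mul (h.faradaySq hU hO hA)))

end MetricFam

theorem volDensity_pos {g : Coord → Matrix (Fin 4) (Fin 4) ℝ} {x : Coord} (h : (g x).det ≠ 0) :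
    0 < volDensity g x :=
  Real.sqrt_pos.2 (abs_pos.2 h)

/-- Writing the derivative with d itself in the denominator absorbs the sign, so the logarithmic
derivative of √|det| is half that of the determinant for either sign. -/
theorem hasDerivAt_sqrt_abs {d : ℝ} (hd : d ≠ 0) :
    HasDerivAt (fun t : ℝ => Real.sqrt |t|) (Real.sqrt |d| / (2 * d)) d := by
  have h1 : HasDerivAt (fun t : ℝ => Real.sqrt |t|) _ d :=
    (hasDerivAt_abs hd).sqrt (abs_ne_zero.2 hd)
  convert h1 using 1
  have hs : Real.sqrt |d| ≠ 0 := (Real.sqrt_pos.2 (abs_pos.2 hd)).ne'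
  have hsq : Real.sqrt |d| * Real.sqrt |d| = SignType.sign d * d := by
    rw [Real.mul_self_sqrt (abs_nonneg d), sign_mul_self]
  field_simp
  rw [sq, hsq]
  ring

theorem hasFDerivAt_volDensity {E : Type*} [NormedAddCommGroup E] [NormedSpace ℝ E]
    {M : E → Matrix (Fin 4) (Fin 4) ℝ} {M' : Fin 4 → Fin 4 → E →L[ℝ] ℝ} {x : E}
    (h : ∀ i j, HasFDerivAt (fun z => M z i j) (M' i j) x) (hd : (M x).det ≠ 0) :
    HasFDerivAt (fun z => Real.sqrt |(M z).det|)
      ((1 / 2 * Real.sqrt |(M x).det|) • ∑ i, ∑ j, (M x)⁻¹ j i • M' i j) x := by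
  have h1 := (hasDerivAt_sqrt_abs hd).comp_hasFDerivAt x (hasFDerivAt_det h)
  refine h1.congr_fderiv ?_
  simp only [inv_apply_eq, Finset.smul_sum, smul_smul]
  refine Finset.sum_congr rfl fun i _ => Finset.sum_congr rfl fun j _ => ?_
  congr 1
  field_simp

theorem inv_mul_cancel_apply {m : Matrix (Fin 4) (Fin 4) ℝ} (hd : m.det ≠ 0) (i j : Fin 4) :
    ∑ a, m⁻¹ i a * m a j = if i = j then 1 else 0 := by
  have := congrFun (congrFun (Matrix.nonsing_inv_mul m (isUnit_iff_ne_zero.2 hd)) i) j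
  rw [Matrix.mul_apply, Matrix.one_apply] at this
  exact this

theorem mul_inv_cancel_apply {m : Matrix (Fin 4) (Fin 4) ℝ} (hd : m.det ≠ 0) (i j : Fin 4) :
    ∑ a, m i a * m⁻¹ a j = if i = j then 1 else 0 := by
  have := congrFun (congrFun (Matrix.mul_nonsing_inv m (isUnit_iff_ne_zero.2 hd)) i) j
  rw [Matrix.mul_apply, Matrix.one_apply] at this
  exact this

theorem inv_symm_apply {m : Matrix (Fin 4) (Fin 4) ℝ} (h : ∀ i j, m i j = m j i) (i j : Fin 4) :
    m⁻¹ i j = m⁻¹ j i := by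
  have hm : m.transpose = m := by ext a b; exact h b a
  conv_rhs => rw [← hm, ← Matrix.transpose_nonsing_inv]
  rfl

/-- A derivation of `m⁻¹ m = 1`. -/
theorem inv_derivation {m m' n' : Matrix (Fin 4) (Fin 4) ℝ} (hd : m.det ≠ 0)
    (h : ∀ i j, ∑ a, (m⁻¹ i a * m' a j + n' i a * m a j) = 0) (i j : Fin 4) :
    n' i j = -∑ a, ∑ b, m⁻¹ i a * m' a b * m⁻¹ b j := by
  have h1 : m⁻¹ * m' + n' * m = 0 := by
    ext a b
    rw [Matrix.add_apply, Matrix.mul_apply, Matrix.mul_apply, ← Finset.sum_add_distrib, h]; rfl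
  have h2 : n' = -(m⁻¹ * m' * m⁻¹) := by
    have hu := isUnit_iff_ne_zero.2 hd
    have h3 : n' * m = -(m⁻¹ * m') := by rw [eq_neg_iff_add_eq_zero, add_comm]; exact h1
    calc n' = n' * m * m⁻¹ := by rw [mul_assoc, Matrix.mul_nonsing_inv m hu, mul_one]
      _ = _ := by rw [h3, neg_mul]
  rw [h2, Matrix.neg_apply, Matrix.mul_apply]
  simp only [Matrix.mul_apply, Finset.sum_mul]
  rw [Finset.sum_comm]

namespace CoordMetric

variable {U : Set Coord} {g : Coord → Matrix (Fin 4) (Fin 4) ℝ} {x : Coord}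

theorem fam (h : CoordMetric U g) : MetricFam (Set.univ ×ˢ U) (fun _ => g) where
  isOpen := isOpen_univ.prod h.isOpen
  smooth i j := SmoothFam.of_contDiffOn (h.smooth i j)
  symm p hp := h.symm p.2 hp.2
  det_ne p hp := h.det_ne p.2 hp.2

theorem differentiableAt (h : CoordMetric U g) (hx : x ∈ U) (i j : Fin 4) :
    DifferentiableAt ℝ (fun z => g z i j) x :=
  ((h.smooth i j).contDiffAt (h.isOpen.mem_nhds hx)).differentiableAt (by simp)

theorem contDiffOn_inv (h : CoordMetric U g) (i j : Fin 4) :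
    ContDiffOn ℝ ∞ (fun z => (g z)⁻¹ i j) U :=
  (h.fam.inv i j).contDiffOn_zero 0

theorem contDiffOn_christoffel (h : CoordMetric U g) (i j k : Fin 4) :
    ContDiffOn ℝ ∞ (fun z => christoffel g z i j k) U :=
  (h.fam.christoffel i j k).contDiffOn_zero 0

theorem contDiffOn_ricci (h : CoordMetric U g) (i j : Fin 4) :
    ContDiffOn ℝ ∞ (fun z => ricci g z i j) U :=
  (h.fam.ricci i j).contDiffOn_zero 0

theorem contDiffOn_ricciScalar (h : CoordMetric U g) :
    ContDiffOn ℝ ∞ (fun z => ricciScalar g z) U :=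
  h.fam.ricciScalar.contDiffOn_zero 0

theorem contDiffOn_volDensity (h : CoordMetric U g) :
    ContDiffOn ℝ ∞ (fun z => volDensity g z) U :=
  h.fam.volDensity.contDiffOn_zero 0

theorem differentiableAt_inv (h : CoordMetric U g) (hx : x ∈ U) (i j : Fin 4) :
    DifferentiableAt ℝ (fun z => (g z)⁻¹ i j) x :=
  ((h.contDiffOn_inv i j).contDiffAt (h.isOpen.mem_nhds hx)).differentiableAt (by simp)

theorem differentiableAt_christoffel (h : CoordMetric U g) (hx : x ∈ U) (i j k : Fin 4) :
    DifferentiableAt ℝ (fun z => christoffel g z i j k) x :=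
  ((h.contDiffOn_christoffel i j k).contDiffAt (h.isOpen.mem_nhds hx)).differentiableAt (by simp)

theorem pd_symm (h : CoordMetric U g) (hx : x ∈ U) (k i j : Fin 4) :
    pd k (fun z => g z i j) x = pd k (fun z => g z j i) x :=
  pd_congr_of_mem h.isOpen hx (fun z hz => h.symm z hz i j) k

theorem christoffel_symm (h : CoordMetric U g) (hx : x ∈ U) (i j k : Fin 4) :
    christoffel g x i j k = christoffel g x i k j := by
  unfold christoffel
  congr 1
  refine Finset.sum_congr rfl fun a _ => ?_
  rw [h.pd_symm hx a j k]
  ring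

theorem christoffel_lower (h : CoordMetric U g) (hx : x ∈ U) (i j k : Fin 4) :
    ∑ a, g x i a * christoffel g x a j k
      = (1 / 2) * (pd j (fun z => g z i k) x + pd k (fun z => g z i j) x
          - pd i (fun z => g z j k) x) := by
  unfold christoffel
  simp only [Finset.mul_sum]
  rw [Finset.sum_comm]
  have : ∀ b, ∑ a, g x i a * (1 / 2 * ((g x)⁻¹ a b * (pd j (fun z => g z b k) x
      + pd k (fun z => g z b j) x - pd b (fun z => g z j k) x)))
      = (if i = b then 1 else 0) * ((1 / 2) * (pd j (fun z => g z b k) x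
        + pd k (fun z => g z b j) x - pd b (fun z => g z j k) x)) := by
    intro b
    rw [← mul_inv_cancel_apply (h.det_ne x hx) i b, Finset.sum_mul]
    exact Finset.sum_congr rfl fun a _ => by ring
  simp only [this]
  simp

/-- Metric compatibility ∇g = 0: in the sum of the two lowered Christoffel symbols every other
derivative of g cancels. -/
theorem pd_eq_christoffel (h : CoordMetric U g) (hx : x ∈ U) (i j k : Fin 4) :
    pd i (fun z => g z j k) x
      = ∑ a, (g x j a * christoffel g x a i k + g x k a * christoffel g x a i j) := by
  rw [Finset.sum_add_distrib, h.christoffel_lower hx, h.christoffel_lower hx,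
    h.pd_symm hx i k j, h.pd_symm hx j k i, h.pd_symm hx k i j]
  ring

theorem pd_inv (h : CoordMetric U g) (hx : x ∈ U) (k i j : Fin 4) :
    pd k (fun z => (g z)⁻¹ i j) x
      = -∑ a, ∑ b, (g x)⁻¹ i a * pd k (fun z => g z a b) x * (g x)⁻¹ b j := by
  refine inv_derivation (m' := Matrix.of fun a b => pd k (fun z => g z a b) x)
    (n' := Matrix.of fun a b => pd k (fun z => (g z)⁻¹ a b) x) (h.det_ne x hx) (fun a b => ?_) i j
  have h1 : pd k (fun z => ∑ c, (g z)⁻¹ a c * g z c b) x = 0 := by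
    rw [pd_congr_of_mem h.isOpen hx (fun z hz => inv_mul_cancel_apply (h.det_ne z hz) a b), pd_const]
  rw [pd_sum fun c _ => (h.differentiableAt_inv hx a c).fun_mul (h.differentiableAt hx c b)] at h1
  rw [← h1]
  refine Finset.sum_congr rfl fun c _ => ?_
  rw [pd_mul (h.differentiableAt_inv hx a c) (h.differentiableAt hx c b)]
  rfl

/-- Metric compatibility for the inverse, ∇g⁻¹ = 0: insert the previous formula for ∂g into ∂g⁻¹ =
-g⁻¹ ∂g g⁻¹ and contract each g⁻¹ g. -/
theorem pd_inv_eq_christoffel (h : CoordMetric U g) (hx : x ∈ U) (k i j : Fin 4) :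
    pd k (fun z => (g z)⁻¹ i j) x
      = -∑ m, (christoffel g x i k m * (g x)⁻¹ m j + christoffel g x j k m * (g x)⁻¹ i m) := by
  have hs := inv_symm_apply (h.symm x hx)
  have hd := h.det_ne x hx
  rw [h.pd_inv hx]
  congr 1
  simp only [h.pd_eq_christoffel hx, Finset.mul_sum, Finset.sum_mul, Finset.sum_add_distrib,
    mul_add, add_mul]
  congr 1
  · rw [Finset.sum_comm]
    refine Finset.sum_congr rfl fun b _ => ?_
    rw [Finset.sum_comm]
    have : ∀ c, ∑ a, (g x)⁻¹ i a * (g x a c * christoffel g x c k b) * (g x)⁻¹ b j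
        = (if i = c then 1 else 0) * (christoffel g x c k b * (g x)⁻¹ b j) := by
      intro c
      rw [← inv_mul_cancel_apply hd i c, Finset.sum_mul]
      exact Finset.sum_congr rfl fun a _ => by ring
    simp only [this]
    simp
  · refine Finset.sum_congr rfl fun a _ => ?_
    rw [Finset.sum_comm]
    have : ∀ c, ∑ b, (g x)⁻¹ i a * (g x b c * christoffel g x c k a) * (g x)⁻¹ b j
        = (if j = c then 1 else 0) * (christoffel g x c k a * (g x)⁻¹ i a) := by
      intro c
      rw [← inv_mul_cancel_apply hd j c, Finset.sum_mul]
      exact Finset.sum_congr rfl fun b _ => by rw [hs j b]; ring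
    simp only [this]
    simp

/-- The contraction `γ^l_li`. -/
theorem trace_christoffel (h : CoordMetric U g) (hx : x ∈ U) (i : Fin 4) :
    ∑ l, christoffel g x l l i
      = 1 / 2 * ∑ a, ∑ b, (g x)⁻¹ b a * pd i (fun z => g z a b) x := by
  have hs := inv_symm_apply (h.symm x hx)
  have e1 : ∀ a b, (g x)⁻¹ b a * pd i (fun z => g z a b) x
      = (g x)⁻¹ a b * pd i (fun z => g z b a) x := fun a b => by rw [hs, h.pd_symm hx]
  unfold christoffel
  rw [← Finset.mul_sum]
  congr 1
  simp only [mul_sub, mul_add, Finset.sum_sub_distrib, Finset.sum_add_distrib]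
  have e2 : ∑ a, ∑ b, (g x)⁻¹ a b * pd a (fun z => g z b i) x
      = ∑ a, ∑ b, (g x)⁻¹ a b * pd b (fun z => g z a i) x := by
    rw [Finset.sum_comm]
    exact Finset.sum_congr rfl fun a _ => Finset.sum_congr rfl fun b _ => by rw [hs]
  rw [e2, add_comm, add_sub_assoc, sub_self, add_zero]
  exact Finset.sum_congr rfl fun a _ => Finset.sum_congr rfl fun b _ => (e1 a b).symm

theorem pd_volDensity (h : CoordMetric U g) (hx : x ∈ U) (i : Fin 4) :
    pd i (fun z => volDensity g z) x = volDensity g x * ∑ l, christoffel g x l l i := by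
  have h1 := (hasFDerivAt_volDensity (fun a b => (h.differentiableAt hx a b).hasFDerivAt)
    (h.det_ne x hx)).pd_eq i
  unfold volDensity
  rw [h1, h.trace_christoffel hx]
  simp only [pd, FunLike.coe_sum, Finset.sum_apply, smul_apply, smul_eq_mul]
  ring

/-- The traced Christoffel symbol is the gradient of log √|det g|, so this is the equality of mixed
second derivatives of the volume density. It is the only part of the symmetry of the Ricci tensor
that does not follow from γⁱ_jk = γⁱ_kj. -/
theorem pd_trace_christoffel_symm (h : CoordMetric U g) (hx : x ∈ U) (i j : Fin 4) :
    pd i (fun z => ∑ l, christoffel g z l l j) x = pd j (fun z => ∑ l, christoffel g z l l i) x := by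
  have hs : volDensity g x ≠ 0 := (volDensity_pos (h.det_ne x hx)).ne'
  have hd : DifferentiableAt ℝ (fun z => volDensity g z) x :=
    (h.contDiffOn_volDensity.contDiffAt (h.isOpen.mem_nhds hx)).differentiableAt (by simp)
  have hΓ : ∀ k, DifferentiableAt ℝ (fun z => ∑ l, christoffel g z l l k) x := fun k =>
    DifferentiableAt.fun_sum fun l _ => h.differentiableAt_christoffel hx l l k
  -- The product of the two traces is symmetric in a and b, so it drops out when the two orders of
  -- differentiation are compared.
  have key : ∀ a b, pd a (fun z => pd b (fun w => volDensity g w) z) x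
      = volDensity g x * pd a (fun z => ∑ l, christoffel g z l l b) x
        + (volDensity g x * ∑ l, christoffel g x l l a) * ∑ l, christoffel g x l l b := by
    intro a b
    rw [pd_congr_of_mem h.isOpen hx (fun z hz => h.pd_volDensity hz b), pd_mul hd (hΓ b),
      h.pd_volDensity hx]
  have hc := pd_comm (h.contDiffOn_volDensity.contDiffAt (h.isOpen.mem_nhds hx)) i j
  rw [key, key] at hc
  have : volDensity g x * pd i (fun z => ∑ l, christoffel g z l l j) x
      = volDensity g x * pd j (fun z => ∑ l, christoffel g z l l i) x := by linarith
  exact mul_left_cancel₀ hs this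

theorem ricci_eq (h : CoordMetric U g) (hx : x ∈ U) (j l : Fin 4) :
    ricci g x j l = ∑ i, pd i (fun z => christoffel g z i j l) x
      - pd l (fun z => ∑ i, christoffel g z i i j) x
      + ∑ m, christoffel g x m j l * ∑ i, christoffel g x i i m
      - ∑ i, ∑ m, christoffel g x m i j * christoffel g x i l m := by
  unfold ricci
  rw [pd_sum fun i _ => h.differentiableAt_christoffel hx i i j]
  simp only [Finset.sum_add_distrib, Finset.sum_sub_distrib, Finset.mul_sum]
  rw [Finset.sum_comm (f := fun i m => christoffel g x m j l * christoffel g x i i m)]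
  ring

theorem ricci_symm (h : CoordMetric U g) (hx : x ∈ U) (j l : Fin 4) :
    ricci g x j l = ricci g x l j := by
  rw [h.ricci_eq hx, h.ricci_eq hx, h.pd_trace_christoffel_symm hx]
  have e1 : ∑ i, ∑ m, christoffel g x m i j * christoffel g x i l m
      = ∑ i, ∑ m, christoffel g x m i l * christoffel g x i j m := by
    rw [Finset.sum_comm]
    refine Finset.sum_congr rfl fun a _ => Finset.sum_congr rfl fun b _ => ?_
    rw [h.christoffel_symm hx a b j, h.christoffel_symm hx b l a]
    ring
  rw [e1]
  have e2 : ∀ i, pd i (fun z => christoffel g z i j l) x = pd i (fun z => christoffel g z i l j) x :=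
    fun i => pd_congr_of_mem h.isOpen hx (fun z hz => h.christoffel_symm hz i j l) i
  simp only [e2, h.christoffel_symm hx _ j l]

end CoordMetric

end CoordinateMetrics

/-! ### The Palatini formula for the variation of the Ricci tensor. -/

section Variation

open Filter Topology

/-- The algebraic identity behind the Palatini formula. Here `c^i_jl` stands for the variation of
`γ^i_jl`, and `dc a i j l` for its derivative `∂_a c^i_jl`. -/
theorem palatini_algebra (G : Fin 4 → Fin 4 → ℝ) (γ c : Fin 4 → Fin 4 → Fin 4 → ℝ)
    (dc : Fin 4 → Fin 4 → Fin 4 → Fin 4 → ℝ) (hG : ∀ i j, G i j = G j i)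
    (hγ : ∀ i j l, γ i j l = γ i l j) (hc : ∀ i j l, c i j l = c i l j) :
    ∑ j, ∑ l, G j l * ∑ i, (dc i i j l - dc l i i j + ∑ m, ((c m j l * γ i i m + γ m j l * c i i m)
        - (c m i j * γ i l m + γ m i j * c i l m)))
      = ∑ i, ((∑ j, ∑ l, (G j l * dc i i j l + ((∑ p, γ p p i) * G j l
              - ∑ m, (γ j i m * G m l + γ l i m * G j m)) * c i j l))
          - ∑ j, (G i j * (∑ l, dc i l l j) + ((∑ p, γ p p i) * G i j
              - ∑ m, (γ i i m * G m j + γ j i m * G i m)) * ∑ l, c l l j)) := by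
  have e1 : ∑ j, ∑ l, ∑ i, G j l * dc i i j l = ∑ i, ∑ j, ∑ l, G j l * dc i i j l := by
    simp only [← Fintype.sum_prod_type']
    exact Finset.sum_bij' (fun p _ => (p.2.2, p.1, p.2.1)) (fun p _ => (p.2.1, p.2.2, p.1))
      (by simp) (by simp) (by simp) (by simp) (by simp)
  have e2 : ∑ j, ∑ l, ∑ i, G j l * dc l i i j = ∑ i, ∑ j, ∑ l, G i j * dc i l l j := by
    rw [Finset.sum_comm]
    exact Finset.sum_congr rfl fun _ _ => Finset.sum_congr rfl fun _ _ =>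
      Finset.sum_congr rfl fun _ _ => by rw [hG]
  have e3 : ∑ j, ∑ l, ∑ i, ∑ m, G j l * (c m j l * γ i i m)
      = ∑ i, ∑ j, ∑ l, ∑ p, γ p p i * G j l * c i j l := by
    simp only [← Fintype.sum_prod_type']
    refine Finset.sum_bij' (fun p _ => (p.2.2.2, p.1, p.2.1, p.2.2.1))
      (fun p _ => (p.2.1, p.2.2.1, p.2.2.2, p.1)) (by simp) (by simp) (by simp) (by simp) ?_
    rintro ⟨j, l, i, m⟩ -
    ring
  have e4 : ∑ j, ∑ l, ∑ i, ∑ m, G j l * (γ m j l * c i i m)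
      = ∑ i, ∑ j, ∑ l, ∑ m, γ j i m * G i m * c l l j := by
    simp only [← Fintype.sum_prod_type']
    refine Finset.sum_bij' (fun p _ => (p.1, p.2.2.2, p.2.2.1, p.2.1))
      (fun p _ => (p.1, p.2.2.2, p.2.2.1, p.2.1)) (by simp) (by simp) (by simp) (by simp) ?_
    rintro ⟨j, l, i, m⟩ -
    ring
  have e5 : ∑ j, ∑ l, ∑ i, ∑ m, G j l * (c m i j * γ i l m)
      = ∑ i, ∑ j, ∑ l, ∑ m, γ l i m * G j m * c i j l := by
    simp only [← Fintype.sum_prod_type']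
    refine Finset.sum_bij' (fun p _ => (p.2.2.2, p.1, p.2.2.1, p.2.1))
      (fun p _ => (p.2.1, p.2.2.2, p.2.2.1, p.1)) (by simp) (by simp) (by simp) (by simp) ?_
    rintro ⟨j, l, i, m⟩ -
    simp only [hc m i j, hγ i l m]
    ring
  have e6 : ∑ j, ∑ l, ∑ i, ∑ m, G j l * (γ m i j * c i l m)
      = ∑ i, ∑ j, ∑ l, ∑ m, γ j i m * G m l * c i j l := by
    simp only [← Fintype.sum_prod_type']
    refine Finset.sum_bij' (fun p _ => (p.2.2.1, p.2.2.2, p.2.1, p.1))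
      (fun p _ => (p.2.2.2, p.2.2.1, p.1, p.2.1)) (by simp) (by simp) (by simp) (by simp) ?_
    rintro ⟨j, l, i, m⟩ -
    simp only [hc i l m]
    ring
  -- The derivative of the density and the connection term on the free index i of G^ij cancel, as
  -- always in the divergence of a vector density.
  have e7 : ∑ i, ∑ j, ∑ l, ∑ p, γ p p i * G i j * c l l j
      = ∑ i, ∑ j, ∑ l, ∑ m, γ i i m * G m j * c l l j := by
    simp only [← Fintype.sum_prod_type']
    exact Finset.sum_bij' (fun p _ => (p.2.2.2, p.2.1, p.2.2.1, p.1))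
      (fun p _ => (p.2.2.2, p.2.1, p.2.2.1, p.1)) (by simp) (by simp) (by simp) (by simp) (by simp)
  simp only [mul_add, mul_sub, add_mul, sub_mul, Finset.mul_sum, Finset.sum_mul,
    Finset.sum_add_distrib, Finset.sum_sub_distrib]
  linarith

/-- The variation of `γ^i_jl` when the metric varies in the direction `k`. -/
noncomputable def christoffelVar (g k : Coord → Matrix (Fin 4) (Fin 4) ℝ) (x : Coord)
    (i j l : Fin 4) : ℝ :=
  -(∑ a, ∑ b, (g x)⁻¹ i a * k x a b * christoffel g x b j l)
    + (1 / 2) * ∑ a, (g x)⁻¹ i a *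
      (pd j (fun z => k z a l) x + pd l (fun z => k z a j) x - pd a (fun z => k z j l) x)

/-- The vector density whose divergence occurs in the variation of `√|det g| r`. -/
noncomputable def ricciFlux (g k : Coord → Matrix (Fin 4) (Fin 4) ℝ) (x : Coord) (i : Fin 4) : ℝ :=
  volDensity g x * ((∑ j, ∑ l, (g x)⁻¹ j l * christoffelVar g k x i j l)
    - ∑ j, (g x)⁻¹ i j * ∑ l, christoffelVar g k x l l j)

/-- The tensor `G_ij + β (2 F_il F_j^l - ½ F_lm F^lm g_ij)`. -/
noncomputable def einsteinMaxwell (β : ℝ) (g : Coord → Matrix (Fin 4) (Fin 4) ℝ)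
    (A : Coord → Coord) (x : Coord) (i j : Fin 4) : ℝ :=
  einsteinTensor g x i j + β * (2 * (∑ l, ∑ m, faraday A x i l * (g x)⁻¹ l m * faraday A x j m)
    - (1 / 2) * g x i j * faradaySq g A x)

/-- The Euler–Lagrange expression of the Lagrange density. -/
noncomputable def eulerLagrange (β : ℝ) (g : Coord → Matrix (Fin 4) (Fin 4) ℝ)
    (A : Coord → Coord) (x : Coord) (a b : Fin 4) : ℝ :=
  -(volDensity g x * ∑ i, ∑ j, (g x)⁻¹ a i * einsteinMaxwell β g A x i j * (g x)⁻¹ j b)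

/-- The linearization of the Lagrange density in the direction `k`. -/
noncomputable def linDensity (β : ℝ) (g : Coord → Matrix (Fin 4) (Fin 4) ℝ)
    (A : Coord → Coord) (k : Coord → Matrix (Fin 4) (Fin 4) ℝ) (x : Coord) : ℝ :=
  (∑ a, ∑ b, eulerLagrange β g A x a b * k x a b) + ∑ i, pd i (fun z => ricciFlux g k z i) x

/-- The derivative of a family of matrix fields with respect to the parameter. -/
noncomputable def famDeriv (g : ℝ → Coord → Matrix (Fin 4) (Fin 4) ℝ) (ε : ℝ) (x : Coord) :
    Matrix (Fin 4) (Fin 4) ℝ :=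
  Matrix.of fun i j => deriv (fun s => g s x i j) ε

theorem christoffelVar_symm {U : Set Coord} {g k : Coord → Matrix (Fin 4) (Fin 4) ℝ} {x : Coord}
    (h : CoordMetric U g) (hk : ∀ z ∈ U, ∀ i j, k z i j = k z j i) (hx : x ∈ U) (i j l : Fin 4) :
    christoffelVar g k x i j l = christoffelVar g k x i l j := by
  unfold christoffelVar
  congr 1
  · simp only [h.christoffel_symm hx _ j l]
  · congr 1
    refine Finset.sum_congr rfl fun a _ => ?_
    rw [pd_congr_of_mem h.isOpen hx (fun z hz => hk z hz j l) a]
    ring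

namespace MetricFam

variable {O : Set (ℝ × Coord)} {g : ℝ → Coord → Matrix (Fin 4) (Fin 4) ℝ} {A : Coord → Coord}
  {ε : ℝ} {x : Coord}

theorem famDeriv_symm (h : MetricFam O g) (hx : (ε, x) ∈ O) (i j : Fin 4) :
    famDeriv g ε x i j = famDeriv g ε x j i := by
  have : ∀ᶠ s in 𝓝 ε, (s, x) ∈ O :=
    (Continuous.prodMk_left x).continuousAt.eventually (h.isOpen.mem_nhds hx)
  have : (fun s => g s x i j) =ᶠ[𝓝 ε] fun s => g s x j i :=
    this.mono fun s hs => h.symm (s, x) hs i j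
  exact this.deriv_eq

theorem hasDerivAt (h : MetricFam O g) (hx : (ε, x) ∈ O) (i j : Fin 4) :
    HasDerivAt (fun s => g s x i j) (famDeriv g ε x i j) ε :=
  ((h.smooth i j).sliceParam h.isOpen hx).hasDerivAt

theorem hasDerivAt_pd (h : MetricFam O g) (hx : (ε, x) ∈ O) (a i j : Fin 4) :
    HasDerivAt (fun s => pd a (fun z => g s z i j) x) (pd a (fun z => famDeriv g ε z i j) x) ε := by
  have h1 := (((h.smooth i j).pd h.isOpen a).sliceParam h.isOpen hx).hasDerivAt
  rwa [(h.smooth i j).deriv_pd h.isOpen hx a] at h1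

theorem hasDerivAt_inv (h : MetricFam O g) (hx : (ε, x) ∈ O) (i j : Fin 4) :
    HasDerivAt (fun s => (g s x)⁻¹ i j)
      (-∑ a, ∑ b, (g ε x)⁻¹ i a * famDeriv g ε x a b * (g ε x)⁻¹ b j) ε := by
  have hd := fun i j => ((h.inv i j).sliceParam h.isOpen hx).hasDerivAt
  have key := inv_derivation (m' := famDeriv g ε x)
    (n' := Matrix.of fun a b => deriv (fun s => (g s x)⁻¹ a b) ε) (h.det_ne _ hx) (fun a b => ?_) i j
  · rw [← key]; exact hd i j
  · have h0 : ∀ᶠ s in 𝓝 ε, (s, x) ∈ O :=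
      (Continuous.prodMk_left x).continuousAt.eventually (h.isOpen.mem_nhds hx)
    have h1 : HasDerivAt (fun s => ∑ c, (g s x)⁻¹ a c * g s x c b) 0 ε :=
      (hasDerivAt_const ε (if a = b then (1 : ℝ) else 0)).congr_of_eventuallyEq
        (h0.mono fun s hs => inv_mul_cancel_apply (h.det_ne _ hs) a b)
    have h2 := HasDerivAt.fun_sum (u := Finset.univ) fun c _ => (hd a c).fun_mul (h.hasDerivAt hx c b)
    rw [← h2.unique h1]
    exact Finset.sum_congr rfl fun c _ => add_comm _ _

theorem hasDerivAt_christoffel (h : MetricFam O g) (hx : (ε, x) ∈ O) (i j l : Fin 4) :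
    HasDerivAt (fun s => EinsteinMaxwell.christoffel (g s) x i j l)
      (christoffelVar (g ε) (famDeriv g ε) x i j l) ε := by
  have h1 := (HasDerivAt.fun_sum (u := Finset.univ) fun a _ => (h.hasDerivAt_inv hx i a).fun_mul
    (((h.hasDerivAt_pd hx j a l).add (h.hasDerivAt_pd hx l a j)).sub
      (h.hasDerivAt_pd hx a j l))).const_mul (1 / 2 : ℝ)
  refine h1.congr_deriv ?_
  unfold christoffelVar EinsteinMaxwell.christoffel
  rw [Finset.sum_add_distrib, mul_add]
  congr 1
  simp only [neg_mul, Finset.sum_neg_distrib, mul_neg, Finset.sum_mul, Finset.mul_sum]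
  congr 1
  rw [Finset.sum_comm]
  refine Finset.sum_congr rfl fun a _ => ?_
  rw [Finset.sum_comm]
  refine Finset.sum_congr rfl fun b _ => Finset.sum_congr rfl fun c _ => ?_
  simp only [Pi.add_apply, Pi.sub_apply]
  ring

theorem pd_christoffelVar (h : MetricFam O g) (hx : (ε, x) ∈ O) (a i j l : Fin 4) :
    HasDerivAt (fun s => pd a (fun z => EinsteinMaxwell.christoffel (g s) z i j l) x)
      (pd a (fun z => christoffelVar (g ε) (famDeriv g ε) z i j l) x) ε := by
  have h1 := (((h.christoffel i j l).pd h.isOpen a).sliceParam h.isOpen hx).hasDerivAt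
  rw [(h.christoffel i j l).deriv_pd h.isOpen hx a] at h1
  rwa [pd_congr_of_mem (h.slice ε).isOpen hx
    (fun z hz => (h.hasDerivAt_christoffel hz i j l).deriv) a] at h1

theorem differentiableAt_christoffelVar (h : MetricFam O g) (hx : (ε, x) ∈ O) (i j l : Fin 4) :
    DifferentiableAt ℝ (fun z => christoffelVar (g ε) (famDeriv g ε) z i j l) x := by
  have h1 := ((h.christoffel i j l).deriv h.isOpen).differentiableAt h.isOpen hx
  refine h1.congr_of_eventuallyEq (eventually_of_mem ((h.slice ε).isOpen.mem_nhds hx) fun z hz => ?_)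
  exact (h.hasDerivAt_christoffel hz i j l).deriv.symm

theorem hasDerivAt_ricci (h : MetricFam O g) (hx : (ε, x) ∈ O) (j l : Fin 4) :
    HasDerivAt (fun s => EinsteinMaxwell.ricci (g s) x j l)
      (∑ i, (pd i (fun z => christoffelVar (g ε) (famDeriv g ε) z i j l) x
        - pd l (fun z => christoffelVar (g ε) (famDeriv g ε) z i i j) x
        + ∑ m, ((christoffelVar (g ε) (famDeriv g ε) x m j l * EinsteinMaxwell.christoffel (g ε) x i i m
          + EinsteinMaxwell.christoffel (g ε) x m j l * christoffelVar (g ε) (famDeriv g ε) x i i m)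
          - (christoffelVar (g ε) (famDeriv g ε) x m i j * EinsteinMaxwell.christoffel (g ε) x i l m
          + EinsteinMaxwell.christoffel (g ε) x m i j
            * christoffelVar (g ε) (famDeriv g ε) x i l m)))) ε := by
  unfold EinsteinMaxwell.ricci
  have hc := fun i j l => h.hasDerivAt_christoffel hx i j l
  refine HasDerivAt.fun_sum fun i _ => ((h.pd_christoffelVar hx i i j l).fun_sub
    (h.pd_christoffelVar hx l i i j)).fun_add (HasDerivAt.fun_sum fun m _ => ?_)
  exact ((hc m j l).fun_mul (hc i i m)).fun_sub ((hc m i j).fun_mul (hc i l m))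

/-- Derivatives of √|det g| and of g⁻¹ are expressible by Christoffel symbols, so only the varied
symbols are left differentiated. The result is arranged to be, summed over i, the right-hand side of
`palatini_algebra`. -/
theorem pd_ricciFlux (h : MetricFam O g) (hx : (ε, x) ∈ O) (i : Fin 4) :
    pd i (fun z => ricciFlux (g ε) (famDeriv g ε) z i) x
      = EinsteinMaxwell.volDensity (g ε) x *
        ((∑ j, ∑ l, ((g ε x)⁻¹ j l * pd i (fun z => christoffelVar (g ε) (famDeriv g ε) z i j l) x
            + ((∑ p, EinsteinMaxwell.christoffel (g ε) x p p i) * (g ε x)⁻¹ j l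
              - ∑ m, (EinsteinMaxwell.christoffel (g ε) x j i m * (g ε x)⁻¹ m l
                + EinsteinMaxwell.christoffel (g ε) x l i m * (g ε x)⁻¹ j m))
              * christoffelVar (g ε) (famDeriv g ε) x i j l))
          - ∑ j, ((g ε x)⁻¹ i j * (∑ l, pd i (fun z => christoffelVar (g ε) (famDeriv g ε) z l l j) x)
            + ((∑ p, EinsteinMaxwell.christoffel (g ε) x p p i) * (g ε x)⁻¹ i j
              - ∑ m, (EinsteinMaxwell.christoffel (g ε) x i i m * (g ε x)⁻¹ m j
                + EinsteinMaxwell.christoffel (g ε) x j i m * (g ε x)⁻¹ i m))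
              * ∑ l, christoffelVar (g ε) (famDeriv g ε) x l l j)) := by
  have hs := h.slice ε
  have hG := fun i j => hs.differentiableAt_inv hx i j
  have hc := fun i j l => h.differentiableAt_christoffelVar hx i j l
  have hv : DifferentiableAt ℝ (fun z => EinsteinMaxwell.volDensity (g ε) z) x :=
    h.volDensity.differentiableAt h.isOpen hx
  have hcs : ∀ j, DifferentiableAt ℝ
      (fun z => ∑ l, christoffelVar (g ε) (famDeriv g ε) z l l j) x := fun j =>
    DifferentiableAt.fun_sum fun l _ => hc l l j
  have h1 : ∀ j, DifferentiableAt ℝ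
      (fun z => ∑ l, (g ε z)⁻¹ j l * christoffelVar (g ε) (famDeriv g ε) z i j l) x := fun j =>
    DifferentiableAt.fun_sum fun l _ => (hG j l).fun_mul (hc i j l)
  have h2 : DifferentiableAt ℝ
      (fun z => ∑ j, ∑ l, (g ε z)⁻¹ j l * christoffelVar (g ε) (famDeriv g ε) z i j l) x :=
    DifferentiableAt.fun_sum fun j _ => h1 j
  have h3 : ∀ j, DifferentiableAt ℝ (fun z => (g ε z)⁻¹ i j
      * ∑ l, christoffelVar (g ε) (famDeriv g ε) z l l j) x := fun j => (hG i j).fun_mul (hcs j)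
  have h4 : DifferentiableAt ℝ (fun z => ∑ j, (g ε z)⁻¹ i j
      * ∑ l, christoffelVar (g ε) (famDeriv g ε) z l l j) x :=
    DifferentiableAt.fun_sum fun j _ => h3 j
  unfold ricciFlux
  rw [pd_mul hv (h2.fun_sub h4), pd_sub h2 h4, pd_sum fun j _ => h1 j, pd_sum fun j _ => h3 j,
    hs.pd_volDensity hx]
  have e1 : ∀ j, pd i (fun z => ∑ l, (g ε z)⁻¹ j l * christoffelVar (g ε) (famDeriv g ε) z i j l) x
      = ∑ l, ((g ε x)⁻¹ j l * pd i (fun z => christoffelVar (g ε) (famDeriv g ε) z i j l) x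
        + -(∑ m, (EinsteinMaxwell.christoffel (g ε) x j i m * (g ε x)⁻¹ m l
                + EinsteinMaxwell.christoffel (g ε) x l i m * (g ε x)⁻¹ j m))
          * christoffelVar (g ε) (famDeriv g ε) x i j l) := by
    intro j
    rw [pd_sum fun l _ => (hG j l).fun_mul (hc i j l)]
    refine Finset.sum_congr rfl fun l _ => ?_
    rw [pd_mul (hG j l) (hc i j l), hs.pd_inv_eq_christoffel hx]
  have e2 : ∀ j, pd i (fun z => (g ε z)⁻¹ i j
      * ∑ l, christoffelVar (g ε) (famDeriv g ε) z l l j) x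
      = (g ε x)⁻¹ i j * (∑ l, pd i (fun z => christoffelVar (g ε) (famDeriv g ε) z l l j) x)
        + -(∑ m, (EinsteinMaxwell.christoffel (g ε) x i i m * (g ε x)⁻¹ m j
                + EinsteinMaxwell.christoffel (g ε) x j i m * (g ε x)⁻¹ i m))
          * ∑ l, christoffelVar (g ε) (famDeriv g ε) x l l j := by
    intro j
    rw [pd_mul (hG i j) (hcs j), pd_sum fun l _ => hc l l j, hs.pd_inv_eq_christoffel hx]
  simp only [e1, e2]
  rw [mul_assoc, ← mul_add]
  congr 1
  rw [mul_sub, Finset.mul_sum, Finset.mul_sum, sub_add_sub_comm, ← Finset.sum_add_distrib,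
    ← Finset.sum_add_distrib]
  congr 1
  · refine Finset.sum_congr rfl fun j _ => ?_
    rw [Finset.mul_sum, ← Finset.sum_add_distrib]
    refine Finset.sum_congr rfl fun l _ => ?_
    ring
  · refine Finset.sum_congr rfl fun j _ => ?_
    ring

/-- The Palatini formula. -/
theorem palatini (h : MetricFam O g) (hx : (ε, x) ∈ O) :
    EinsteinMaxwell.volDensity (g ε) x *
        ∑ j, ∑ l, (g ε x)⁻¹ j l * deriv (fun s => EinsteinMaxwell.ricci (g s) x j l) ε
      = ∑ i, pd i (fun z => ricciFlux (g ε) (famDeriv g ε) z i) x := by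
  have hs := h.slice ε
  simp only [h.pd_ricciFlux hx, (h.hasDerivAt_ricci hx _ _).deriv]
  rw [← Finset.mul_sum]
  congr 1
  exact palatini_algebra (fun j l => (g ε x)⁻¹ j l) (EinsteinMaxwell.christoffel (g ε) x)
    (christoffelVar (g ε) (famDeriv g ε) x)
    (fun a i j l => pd a (fun z => christoffelVar (g ε) (famDeriv g ε) z i j l) x)
    (inv_symm_apply (hs.symm x hx)) (hs.christoffel_symm hx)
    (christoffelVar_symm hs (fun z hz => h.famDeriv_symm hz) hx)

end MetricFam

end Variation

/-! ### The first variation of the Lagrange density. -/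

section Variation

open Filter Topology

theorem faraday_antisymm (A : Coord → Coord) (x : Coord) (i j : Fin 4) :
    faraday A x i j = -faraday A x j i := by
  unfold faraday; ring

theorem faradaySq_eq (g : Coord → Matrix (Fin 4) (Fin 4) ℝ) (A : Coord → Coord) (x : Coord) :
    faradaySq g A x
      = ∑ i, ∑ k, (g x)⁻¹ i k * ∑ l, ∑ m, faraday A x i l * (g x)⁻¹ l m * faraday A x k m := by
  unfold faradaySq
  simp only [Finset.mul_sum]
  refine Finset.sum_congr rfl fun i _ => ?_
  rw [Finset.sum_comm]
  refine Finset.sum_congr rfl fun k _ => Finset.sum_congr rfl fun l _ =>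
    Finset.sum_congr rfl fun m _ => by ring

/-- By symmetry of G the two indices may be raised on either factor. This moves the inverse metrics
from the field equations onto the direction of variation, which is where the derivative of g⁻¹ puts
them. -/
theorem sum_contract_comm (G X K : Fin 4 → Fin 4 → ℝ) (hG : ∀ i j, G i j = G j i) :
    ∑ a, ∑ b, (∑ i, ∑ j, G a i * X i j * G j b) * K a b
      = ∑ i, ∑ j, (∑ a, ∑ b, G i a * K a b * G b j) * X i j := by
  simp only [Finset.sum_mul, ← Fintype.sum_prod_type']
  refine Finset.sum_bij' (fun p _ => (p.2.2.1, p.2.2.2, p.1, p.2.1))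
    (fun p _ => (p.2.2.1, p.2.2.2, p.1, p.2.1)) (by simp) (by simp) (by simp) (by simp) ?_
  rintro ⟨a, b, i, j⟩ -
  simp only [hG a i, hG j b]
  ring

theorem sum_inv_mul_mul_inv {m : Matrix (Fin 4) (Fin 4) ℝ} (hd : m.det ≠ 0) (a b : Fin 4) :
    ∑ i, ∑ j, m⁻¹ a i * m i j * m⁻¹ j b = m⁻¹ a b := by
  rw [Finset.sum_comm]
  simp only [← Finset.sum_mul, inv_mul_cancel_apply hd]
  simp

namespace MetricFam

variable {O : Set (ℝ × Coord)} {g : ℝ → Coord → Matrix (Fin 4) (Fin 4) ℝ} {A : Coord → Coord}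
  {ε : ℝ} {x : Coord}

theorem hasDerivAt_volDensity (h : MetricFam O g) (hx : (ε, x) ∈ O) :
    HasDerivAt (fun s => EinsteinMaxwell.volDensity (g s) x)
      (1 / 2 * EinsteinMaxwell.volDensity (g ε) x
        * ∑ a, ∑ b, (g ε x)⁻¹ a b * famDeriv g ε x a b) ε := by
  have h1 := (hasFDerivAt_volDensity (fun a b => (h.hasDerivAt hx a b).hasFDerivAt)
    (h.det_ne _ hx)).hasDerivAt
  refine h1.congr_deriv ?_
  simp only [FunLike.coe_sum, Finset.sum_apply, smul_apply, smul_eq_mul,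
    ContinuousLinearMap.toSpanSingleton_apply, one_mul]
  have hG : ∀ i j, (g ε x)⁻¹ i j = (g ε x)⁻¹ j i := inv_symm_apply (h.symm _ hx)
  congr 1
  exact Finset.sum_congr rfl fun a _ => Finset.sum_congr rfl fun b _ => by rw [hG]

theorem hasDerivAt_ricciScalar (h : MetricFam O g) (hx : (ε, x) ∈ O) :
    HasDerivAt (fun s => EinsteinMaxwell.ricciScalar (g s) x)
      (-(∑ j, ∑ l, (∑ a, ∑ b, (g ε x)⁻¹ j a * famDeriv g ε x a b * (g ε x)⁻¹ b l)
          * EinsteinMaxwell.ricci (g ε) x j l)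
        + ∑ j, ∑ l, (g ε x)⁻¹ j l * deriv (fun s => EinsteinMaxwell.ricci (g s) x j l) ε) ε := by
  unfold EinsteinMaxwell.ricciScalar
  have h1 := HasDerivAt.fun_sum (u := Finset.univ) fun j _ =>
    HasDerivAt.fun_sum (u := Finset.univ) fun l _ =>
      (h.hasDerivAt_inv hx j l).fun_mul (h.hasDerivAt_ricci hx j l).differentiableAt.hasDerivAt
  refine h1.congr_deriv ?_
  simp only [Finset.sum_add_distrib, neg_mul, Finset.sum_neg_distrib]

/-- The two inverse metrics contribute equally: exchanging the index pairs costs two signs, one from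
each factor F. This is the origin of the factor 2 in front of F_il F_j^l. -/
theorem hasDerivAt_faradaySq (h : MetricFam O g) (hx : (ε, x) ∈ O) :
    HasDerivAt (fun s => EinsteinMaxwell.faradaySq (g s) A x)
      (-(2 * ∑ i, ∑ j, (∑ a, ∑ b, (g ε x)⁻¹ i a * famDeriv g ε x a b * (g ε x)⁻¹ b j)
          * ∑ l, ∑ m, EinsteinMaxwell.faraday A x i l * (g ε x)⁻¹ l m
            * EinsteinMaxwell.faraday A x j m)) ε := by
  unfold EinsteinMaxwell.faradaySq
  have h1 := HasDerivAt.fun_sum (u := Finset.univ) fun i _ =>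
    HasDerivAt.fun_sum (u := Finset.univ) fun j _ => HasDerivAt.fun_sum (u := Finset.univ) fun k _ =>
    HasDerivAt.fun_sum (u := Finset.univ) fun l _ =>
      (((h.hasDerivAt_inv hx i k).fun_mul (h.hasDerivAt_inv hx j l)).mul_const
        (EinsteinMaxwell.faraday A x i j)).mul_const (EinsteinMaxwell.faraday A x k l)
  refine h1.congr_deriv ?_
  set Y : Fin 4 → Fin 4 → ℝ := fun i j =>
    ∑ a, ∑ b, (g ε x)⁻¹ i a * famDeriv g ε x a b * (g ε x)⁻¹ b j with hY
  set F := EinsteinMaxwell.faraday A x with hF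
  set G := (g ε x)⁻¹ with hG
  change ∑ i, ∑ j, ∑ k, ∑ l, ((-Y i k) * G j l + G i k * (-Y j l)) * F i j * F k l
    = -(2 * ∑ i, ∑ j, Y i j * ∑ l, ∑ m, F i l * G l m * F j m)
  have e1 : ∑ i, ∑ j, ∑ k, ∑ l, Y i k * G j l * F i j * F k l
      = ∑ i, ∑ j, ∑ l, ∑ m, Y i j * (F i l * G l m * F j m) := by
    simp only [← Fintype.sum_prod_type']
    refine Finset.sum_bij' (fun p _ => (p.1, p.2.2.1, p.2.1, p.2.2.2))
      (fun p _ => (p.1, p.2.2.1, p.2.1, p.2.2.2)) (by simp) (by simp) (by simp) (by simp) ?_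
    rintro ⟨i, j, k, l⟩ -
    ring
  have e2 : ∑ i, ∑ j, ∑ k, ∑ l, G i k * Y j l * F i j * F k l
      = ∑ i, ∑ j, ∑ l, ∑ m, Y i j * (F i l * G l m * F j m) := by
    simp only [← Fintype.sum_prod_type']
    refine Finset.sum_bij' (fun p _ => (p.2.1, p.2.2.2, p.1, p.2.2.1))
      (fun p _ => (p.2.2.1, p.1, p.2.2.2, p.2.1)) (by simp) (by simp) (by simp) (by simp) ?_
    rintro ⟨i, j, k, l⟩ -
    simp only [hF]
    rw [faraday_antisymm A x i j, faraday_antisymm A x k l]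
    ring
  have e3 : ∑ i, ∑ j, ∑ k, ∑ l, ((-Y i k) * G j l + G i k * (-Y j l)) * F i j * F k l
      = -(∑ i, ∑ j, ∑ k, ∑ l, Y i k * G j l * F i j * F k l)
        - ∑ i, ∑ j, ∑ k, ∑ l, G i k * Y j l * F i j * F k l := by
    simp only [← Finset.sum_neg_distrib, ← Finset.sum_sub_distrib]
    refine Finset.sum_congr rfl fun i _ => Finset.sum_congr rfl fun j _ =>
      Finset.sum_congr rfl fun k _ => Finset.sum_congr rfl fun l _ => by ring
  rw [e3, e1, e2]
  simp only [Finset.mul_sum]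
  simp only [← Finset.mul_sum]
  ring

/-- The right-hand side is what the product rule gives for √|det g| (r + β F²) apart from the
Palatini term: the trace part comes from the volume density, the others from the inverse metrics. -/
theorem sum_eulerLagrange_mul (h : MetricFam O g) (hx : (ε, x) ∈ O) (β : ℝ)
    (K : Matrix (Fin 4) (Fin 4) ℝ) :
    ∑ a, ∑ b, eulerLagrange β (g ε) A x a b * K a b
      = 1 / 2 * EinsteinMaxwell.volDensity (g ε) x * (∑ a, ∑ b, (g ε x)⁻¹ a b * K a b)
          * lagrangian β (g ε) A x
        - EinsteinMaxwell.volDensity (g ε) x *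
          ((∑ j, ∑ l, (∑ a, ∑ b, (g ε x)⁻¹ j a * K a b * (g ε x)⁻¹ b l)
            * EinsteinMaxwell.ricci (g ε) x j l)
          + β * (2 * ∑ i, ∑ j, (∑ a, ∑ b, (g ε x)⁻¹ i a * K a b * (g ε x)⁻¹ b j)
          * ∑ l, ∑ m, EinsteinMaxwell.faraday A x i l * (g ε x)⁻¹ l m
            * EinsteinMaxwell.faraday A x j m)) := by
  have hG := inv_symm_apply (h.symm _ hx)
  have hd := h.det_ne _ hx
  have e0 : ∑ a, ∑ b, eulerLagrange β (g ε) A x a b * K a b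
      = -(EinsteinMaxwell.volDensity (g ε) x * ∑ a, ∑ b, (∑ i, ∑ j, (g ε x)⁻¹ a i
        * einsteinMaxwell β (g ε) A x i j * (g ε x)⁻¹ j b) * K a b) := by
    unfold eulerLagrange
    simp only [neg_mul, Finset.sum_neg_distrib, mul_assoc, ← Finset.mul_sum]
  have e1 := sum_contract_comm (fun i j => (g ε x)⁻¹ i j) (fun i j => g ε x i j)
    (fun i j => K i j) hG
  simp only [sum_inv_mul_mul_inv hd] at e1
  rw [e0, sum_contract_comm (fun i j => (g ε x)⁻¹ i j) _ (fun i j => K i j) hG]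
  unfold einsteinMaxwell einsteinTensor lagrangian
  rw [e1]
  generalize hY : (fun i j => ∑ a, ∑ b, (g ε x)⁻¹ i a * K a b * (g ε x)⁻¹ b j) = Y
  have hY' : ∀ i j, ∑ a, ∑ b, (g ε x)⁻¹ i a * K a b * (g ε x)⁻¹ b j = Y i j := fun i j => by
    rw [← hY]
  simp only [hY']
  generalize EinsteinMaxwell.ricciScalar (g ε) x = r
  generalize EinsteinMaxwell.faradaySq (g ε) A x = f
  generalize hΦ : (fun i j => ∑ l, ∑ m, EinsteinMaxwell.faraday A x i l * (g ε x)⁻¹ l m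
            * EinsteinMaxwell.faraday A x j m) = Φ
  have hΦ' : ∀ i j, ∑ l, ∑ m, EinsteinMaxwell.faraday A x i l * (g ε x)⁻¹ l m
            * EinsteinMaxwell.faraday A x j m = Φ i j := fun i j => by rw [← hΦ]
  simp only [hΦ']
  simp only [Finset.mul_sum, Finset.sum_mul, ← Finset.sum_sub_distrib, ← Finset.sum_add_distrib,
    ← Finset.sum_neg_distrib]
  refine Finset.sum_congr rfl fun i _ => Finset.sum_congr rfl fun j _ => by ring

/-- The first variation of the Lagrange density. -/
theorem hasDerivAt_lagDensity (h : MetricFam O g) (hx : (ε, x) ∈ O) (β : ℝ) :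
    HasDerivAt (fun s => EinsteinMaxwell.lagDensity β (g s) A x)
      (linDensity β (g ε) A (famDeriv g ε) x) ε := by
  unfold EinsteinMaxwell.lagDensity lagrangian
  have h1 := (h.hasDerivAt_volDensity hx).fun_mul
    ((h.hasDerivAt_ricciScalar hx).fun_add ((h.hasDerivAt_faradaySq (A := A) hx).const_mul β))
  refine h1.congr_deriv ?_
  unfold linDensity
  rw [← h.palatini hx, h.sum_eulerLagrange_mul hx]
  unfold lagrangian
  ring

end MetricFam

end Variation

/-! ### Transformation law of the Christoffel symbols. -/

section CoordinateChange

open Filter Topology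

/-- The Jacobian matrix of `φ`. -/
noncomputable def jac (φ : Coord → Coord) (u : Coord) : Matrix (Fin 4) (Fin 4) ℝ :=
  Matrix.of fun a i => pd i (fun z => φ z a) u

/-- `φ` is a smooth map of the open set `W` into the open set `U`, with invertible Jacobian. -/
structure CoordChange (W U : Set Coord) (φ : Coord → Coord) : Prop where
  isOpen : IsOpen W
  mapsTo : Set.MapsTo φ W U
  smooth : ∀ a, ContDiffOn ℝ ∞ (fun u => φ u a) W
  det_ne : ∀ u ∈ W, (jac φ u).det ≠ 0

/-- Entrywise partial derivative of a matrix field. -/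
noncomputable def pdM (j : Fin 4) (N : Coord → Matrix (Fin 4) (Fin 4) ℝ) (u : Coord) :
    Matrix (Fin 4) (Fin 4) ℝ :=
  Matrix.of fun a b => pd j (fun z => N z a b) u

theorem pdM_mul {M N : Coord → Matrix (Fin 4) (Fin 4) ℝ} {u : Coord}
    (hM : ∀ a b, DifferentiableAt ℝ (fun z => M z a b) u)
    (hN : ∀ a b, DifferentiableAt ℝ (fun z => N z a b) u) (j : Fin 4) :
    pdM j (fun z => M z * N z) u = M u * pdM j N u + pdM j M u * N u := by
  ext a b
  simp only [pdM, Matrix.of_apply, Matrix.add_apply, Matrix.mul_apply]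
  rw [pd_sum fun c _ => (hM a c).fun_mul (hN c b), ← Finset.sum_add_distrib]
  exact Finset.sum_congr rfl fun c _ => pd_mul (hM a c) (hN c b) j

theorem pdM_congr {M N : Coord → Matrix (Fin 4) (Fin 4) ℝ} {W : Set Coord} {u : Coord}
    (hW : IsOpen W) (hu : u ∈ W) (h : ∀ z ∈ W, M z = N z) (j : Fin 4) : pdM j M u = pdM j N u := by
  ext a b
  exact pd_congr_of_mem hW hu (fun z hz => by rw [h z hz]) j

theorem pdM_add {M N : Coord → Matrix (Fin 4) (Fin 4) ℝ} {u : Coord}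
    (hM : ∀ a b, DifferentiableAt ℝ (fun z => M z a b) u)
    (hN : ∀ a b, DifferentiableAt ℝ (fun z => N z a b) u) (j : Fin 4) :
    pdM j (fun z => M z + N z) u = pdM j M u + pdM j N u := by
  ext a b
  exact pd_add (hM a b) (hN a b) j

theorem differentiableAt_mul_apply {M N : Coord → Matrix (Fin 4) (Fin 4) ℝ} {u : Coord}
    (hM : ∀ a b, DifferentiableAt ℝ (fun z => M z a b) u)
    (hN : ∀ a b, DifferentiableAt ℝ (fun z => N z a b) u) (a b : Fin 4) :
    DifferentiableAt ℝ (fun z => (M z * N z) a b) u := by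
  simp only [Matrix.mul_apply]
  exact DifferentiableAt.fun_sum fun c _ => (hM a c).fun_mul (hN c b)

/-- The connection matrices `(Γ_j)^i_k = γ^i_jk`. -/
noncomputable def connMat (g : Coord → Matrix (Fin 4) (Fin 4) ℝ) (j : Fin 4) (x : Coord) :
    Matrix (Fin 4) (Fin 4) ℝ :=
  Matrix.of fun i k => christoffel g x i j k

/-- The curvature matrices `Ω_jl = ∂_j Γ_l - ∂_l Γ_j + [Γ_j, Γ_l]`. -/
noncomputable def curvMat (g : Coord → Matrix (Fin 4) (Fin 4) ℝ) (j l : Fin 4) (x : Coord) :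
    Matrix (Fin 4) (Fin 4) ℝ :=
  pdM j (connMat g l) x - pdM l (connMat g j) x + connMat g j x * connMat g l x
    - connMat g l x * connMat g j x

theorem CoordMetric.ricci_eq_curvMat {U : Set Coord} {g : Coord → Matrix (Fin 4) (Fin 4) ℝ}
    {x : Coord} (h : CoordMetric U g) (hx : x ∈ U) (j l : Fin 4) :
    ricci g x j l = ∑ i, curvMat g i l x i j := by
  unfold ricci curvMat
  refine Finset.sum_congr rfl fun i _ => ?_
  simp only [Matrix.sub_apply, Matrix.add_apply, Matrix.mul_apply, pdM, connMat, Matrix.of_apply,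
    Finset.sum_sub_distrib]
  have e1 : pd i (fun z => christoffel g z i j l) x = pd i (fun z => christoffel g z i l j) x :=
    pd_congr_of_mem h.isOpen hx (fun z hz => h.christoffel_symm hz i j l) i
  rw [e1, ← add_sub_assoc]
  simp only [h.christoffel_symm hx _ j l, mul_comm (christoffel g x i _ _)]

/-- A relabelling of summation indices. It supplies the part of the transformation law that is free
of second derivatives of φ. -/
theorem sum_jac_christoffel (J : Fin 4 → Fin 4 → ℝ) (D : Fin 4 → Fin 4 → Fin 4 → ℝ) (j h k : Fin 4) :
    ∑ b, ∑ a, ∑ d, J b j * (J a h * ((1 / 2) * (D b a d + D d a b - D a b d)) * J d k)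
      = (1 / 2) * ((∑ c, ∑ a, ∑ d, J c j * (J a h * D c a d * J d k))
        + (∑ c, ∑ a, ∑ d, J c k * (J a h * D c a d * J d j))
        - ∑ c, ∑ a, ∑ d, J c h * (J a j * D c a d * J d k)) := by
  have e1 : ∑ c, ∑ a, ∑ d, J c k * (J a h * D c a d * J d j)
      = ∑ b, ∑ a, ∑ d, J b j * (J a h * D d a b * J d k) := by
    simp only [← Fintype.sum_prod_type']
    refine Finset.sum_bij' (fun p _ => (p.2.2, p.2.1, p.1)) (fun p _ => (p.2.2, p.2.1, p.1))
      (by simp) (by simp) (by simp) (by simp) ?_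
    rintro ⟨a, b, c⟩ -
    ring
  have e2 : ∑ c, ∑ a, ∑ d, J c h * (J a j * D c a d * J d k)
      = ∑ b, ∑ a, ∑ d, J b j * (J a h * D a b d * J d k) := by
    rw [Finset.sum_comm]
    exact Finset.sum_congr rfl fun a _ => Finset.sum_congr rfl fun b _ =>
      Finset.sum_congr rfl fun c _ => by ring
  rw [e1, e2]
  simp only [← Finset.sum_add_distrib, ← Finset.sum_sub_distrib, Finset.mul_sum]
  exact Finset.sum_congr rfl fun a _ => Finset.sum_congr rfl fun b _ =>
      Finset.sum_congr rfl fun c _ => by ring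

namespace CoordChange

variable {W U : Set Coord} {φ : Coord → Coord} {g g' : Coord → Matrix (Fin 4) (Fin 4) ℝ}
  {A A' : Coord → Coord} {u : Coord}

theorem contDiffAt (h : CoordChange W U φ) (hu : u ∈ W) (a : Fin 4) :
    ContDiffAt ℝ ∞ (fun z => φ z a) u :=
  (h.smooth a).contDiffAt (h.isOpen.mem_nhds hu)

theorem differentiableAt (h : CoordChange W U φ) (hu : u ∈ W) (a : Fin 4) :
    DifferentiableAt ℝ (fun z => φ z a) u :=
  (h.contDiffAt hu a).differentiableAt (by simp)

theorem contDiffOn_jac (h : CoordChange W U φ) (a i : Fin 4) :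
    ContDiffOn ℝ ∞ (fun z => jac φ z a i) W :=
  contDiffOn_pd h.isOpen (h.smooth a) i

theorem differentiableAt_jac (h : CoordChange W U φ) (hu : u ∈ W) (a i : Fin 4) :
    DifferentiableAt ℝ (fun z => jac φ z a i) u :=
  ((h.contDiffOn_jac a i).contDiffAt (h.isOpen.mem_nhds hu)).differentiableAt (by simp)

theorem pd_jac_symm (h : CoordChange W U φ) (hu : u ∈ W) (a i j : Fin 4) :
    pd j (fun z => jac φ z a i) u = pd i (fun z => jac φ z a j) u :=
  pd_comm (h.contDiffAt hu a) j i

theorem pd_comp (h : CoordChange W U φ) (hu : u ∈ W) {f : Coord → ℝ}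
    (hf : DifferentiableAt ℝ f (φ u)) (i : Fin 4) :
    pd i (fun z => f (φ z)) u = ∑ a, jac φ u a i * pd a f (φ u) :=
  EinsteinMaxwell.pd_comp hf (h.differentiableAt hu) i

theorem differentiableAt_comp (h : CoordChange W U φ) (hu : u ∈ W) {f : Coord → ℝ}
    (hf : DifferentiableAt ℝ f (φ u)) : DifferentiableAt ℝ (fun z => f (φ z)) u :=
  hf.comp u (differentiableAt_pi.2 (h.differentiableAt hu))

theorem pdM_comp (h : CoordChange W U φ) (hu : u ∈ W) {N : Coord → Matrix (Fin 4) (Fin 4) ℝ}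
    (hN : ∀ a b, DifferentiableAt ℝ (fun z => N z a b) (φ u)) (i : Fin 4) :
    pdM i (fun z => N (φ z)) u = ∑ c, jac φ u c i • pdM c N (φ u) := by
  ext a b
  simp only [Matrix.sum_apply, Matrix.smul_apply, smul_eq_mul]
  exact h.pd_comp hu (hN a b) i

/-- The transformation law of the Christoffel symbols. -/
theorem jac_mul_connMat (h : CoordChange W U φ) (hg : CoordMetric U g) (hg' : CoordMetric W g')
    (hp : ∀ z ∈ W, g' z = (jac φ z).transpose * g (φ z) * jac φ z) (hu : u ∈ W) (j : Fin 4) :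
    jac φ u * connMat g' j u
      = pdM j (jac φ) u + (∑ b, jac φ u b j • connMat g b (φ u)) * jac φ u := by
  have hx : φ u ∈ U := h.mapsTo hu
  set J := jac φ u with hJ
  have hdJ : IsUnit J.det := isUnit_iff_ne_zero.2 (h.det_ne u hu)
  have hdg : IsUnit (g (φ u)).det := isUnit_iff_ne_zero.2 (hg.det_ne _ hx)
  have hsymm : (g (φ u)).transpose = g (φ u) := by
    ext a b; exact hg.symm _ hx b a
  -- the lowered Christoffel symbols
  have low : ∀ b, g (φ u) * connMat g b (φ u)
      = Matrix.of fun a d => (1 / 2) * (pd b (fun z => g z a d) (φ u)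
        + pd d (fun z => g z a b) (φ u) - pd a (fun z => g z b d) (φ u)) := by
    intro b
    ext a d
    rw [Matrix.mul_apply]
    exact hg.christoffel_lower hx a b d
  have low' : g' u * connMat g' j u
      = Matrix.of fun a d => (1 / 2) * (pd j (fun z => g' z a d) u
        + pd d (fun z => g' z a j) u - pd a (fun z => g' z j d) u) := by
    ext a d
    rw [Matrix.mul_apply]
    exact hg'.christoffel_lower hu a j d
  -- the derivatives of the metric
  have hJd := fun a b => h.differentiableAt_jac hu a b
  have hgd : ∀ a b, DifferentiableAt ℝ (fun z => g (φ z) a b) u := fun a b =>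
    h.differentiableAt_comp hu (hg.differentiableAt hx a b)
  have hpd : ∀ i, pdM i g' u = J.transpose * g (φ u) * pdM i (jac φ) u
      + (J.transpose * g (φ u) * pdM i (jac φ) u).transpose
      + J.transpose * (∑ c, J c i • pdM c g (φ u)) * J := by
    intro i
    rw [pdM_congr h.isOpen hu hp]
    rw [pdM_mul (M := fun z => (jac φ z).transpose * g (φ z)) (N := jac φ)
      (differentiableAt_mul_apply (fun a b => hJd b a) hgd) hJd,
      pdM_mul (M := fun z => (jac φ z).transpose) (fun a b => hJd b a) hgd,
      h.pdM_comp hu (hg.differentiableAt hx)]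
    have : pdM i (fun z => (jac φ z).transpose) u = (pdM i (jac φ) u).transpose := rfl
    rw [this]
    simp only [Matrix.transpose_mul, Matrix.transpose_transpose, hsymm]
    rw [add_mul, ← hJ]
    simp only [mul_assoc]
    abel
  -- The part of ∂_i g' with second derivatives of φ is X i plus its transpose. The symmetry `hXs`
  -- reduces the six such terms of the Christoffel combination to 2 X j, and the factor ½ leaves X
  -- j.
  set X : Fin 4 → Matrix (Fin 4) (Fin 4) ℝ := fun i => J.transpose * g (φ u) * pdM i (jac φ) u
    with hX
  have hXs : ∀ i a b, X i a b = X b a i := by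
    intro i a b
    simp only [hX, Matrix.mul_apply]
    refine Finset.sum_congr rfl fun c _ => ?_
    congr 1
    exact h.pd_jac_symm hu c b i
  have hY : ∀ c a b, (J.transpose * (∑ c', J c' c • pdM c' g (φ u)) * J) a b
      = ∑ c', ∑ a', ∑ b', J c' c * (J a' a * pd c' (fun z => g z a' b') (φ u) * J b' b) := by
    intro c a b
    simp only [Matrix.mul_apply, Matrix.sum_apply, Matrix.smul_apply, smul_eq_mul, pdM,
      Matrix.of_apply, Matrix.transpose_apply, Finset.mul_sum, Finset.sum_mul]
    simp only [← Fintype.sum_prod_type']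
    refine Finset.sum_bij' (fun p _ => (p.2.1, p.2.2, p.1)) (fun p _ => (p.2.2, p.1, p.2.1))
      (by simp) (by simp) (by simp) (by simp) ?_
    rintro ⟨a, b, c⟩ -
    ring
  have hpde : ∀ i a b, pd i (fun z => g' z a b) u = X i a b + X i b a
      + ∑ c', ∑ a', ∑ b', J c' i * (J a' a * pd c' (fun z => g z a' b') (φ u) * J b' b) := by
    intro i a b
    have := congrFun (congrFun (hpd i) a) b
    rw [Matrix.add_apply, Matrix.add_apply, hY] at this
    exact this
  have key : g' u * connMat g' j u
      = X j + J.transpose * (∑ b, J b j • (g (φ u) * connMat g b (φ u))) * J := by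
    rw [low']
    simp only [low]
    ext a d
    have e1 : (J.transpose * (∑ b, J b j • Matrix.of fun a d => (1 / 2) *
        (pd b (fun z => g z a d) (φ u) + pd d (fun z => g z a b) (φ u)
          - pd a (fun z => g z b d) (φ u))) * J) a d
        = ∑ b, ∑ a', ∑ d', J b j * (J a' a * ((1 / 2) * (pd b (fun z => g z a' d') (φ u)
          + pd d' (fun z => g z a' b) (φ u) - pd a' (fun z => g z b d') (φ u))) * J d' d) := by
      simp only [Matrix.mul_apply, Matrix.sum_apply, Matrix.smul_apply, smul_eq_mul,
        Matrix.of_apply, Matrix.transpose_apply, Finset.mul_sum, Finset.sum_mul]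
      simp only [← Fintype.sum_prod_type']
      refine Finset.sum_bij' (fun p _ => (p.2.1, p.2.2, p.1)) (fun p _ => (p.2.2, p.1, p.2.1))
        (by simp) (by simp) (by simp) (by simp) ?_
      rintro ⟨a, b, c⟩ -
      ring
    rw [Matrix.add_apply, e1, sum_jac_christoffel (fun a b => J a b)
      (fun b a d => pd b (fun z => g z a d) (φ u)), Matrix.of_apply, hpde, hpde, hpde]
    rw [hXs d j a, hXs d a j, hXs a d j]
    ring
  -- The law has so far been obtained with lowered index, that is, multiplied by Jᵀ g; this
  -- invertible factor is now cancelled.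
  have hu2 : IsUnit (J.transpose * g (φ u)).det := by
    rw [Matrix.det_mul, Matrix.det_transpose]; exact hdJ.mul hdg
  have e2 : J.transpose * g (φ u) * (J * connMat g' j u)
      = J.transpose * g (φ u) * (pdM j (jac φ) u
        + (∑ b, J b j • connMat g b (φ u)) * J) := by
    rw [← mul_assoc, ← hp u hu, key, mul_add]
    congr 1
    simp only [← mul_smul_comm, ← Finset.mul_sum, mul_assoc]
  have := congrArg (fun N => (J.transpose * g (φ u))⁻¹ * N) e2
  simpa only [← mul_assoc, Matrix.nonsing_inv_mul _ hu2, one_mul] using this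

end CoordChange

end CoordinateChange

/-! ### Transformation laws of curvature, Ricci tensor, F and the field equations. -/

section CoordinateChange

open Filter Topology

/-- A gauge transformation in a noncommutative ring. The first two hypotheses are the law of the
connection in two directions, the others its cross derivatives; the second derivative H of J is
common to them, so it cancels on antisymmetrization together with all terms in dJ. With J kept on
the outside no inverse is needed. -/
theorem curvature_algebra {R : Type*} [Ring R] {J G G' Gh Gh' dJ dJ' dGi dGl H P P' : R}
    (hi : J * G = dJ + Gh * J) (hl : J * G' = dJ' + Gh' * J)
    (hil : J * dGl + dJ * G' = H + (Gh' * dJ + P * J))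
    (hli : J * dGi + dJ' * G = H + (Gh * dJ' + P' * J)) :
    J * (dGl - dGi + G * G' - G' * G) = (P - P' + Gh * Gh' - Gh' * Gh) * J := by
  have e1 : J * dGl = H + (Gh' * dJ + P * J) - dJ * G' := eq_sub_of_add_eq hil
  have e2 : J * dGi = H + (Gh * dJ' + P' * J) - dJ' * G := eq_sub_of_add_eq hli
  have e3 : J * (G * G') = dJ * G' + Gh * (dJ' + Gh' * J) := by
    rw [← mul_assoc, hi, add_mul, mul_assoc, hl]
  have e4 : J * (G' * G) = dJ' * G + Gh' * (dJ + Gh * J) := by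
    rw [← mul_assoc, hl, add_mul, mul_assoc, hi]
  rw [mul_sub, mul_add, mul_sub, e1, e2, e3, e4]
  noncomm_ring

namespace CoordChange

variable {W U : Set Coord} {φ : Coord → Coord} {g g' : Coord → Matrix (Fin 4) (Fin 4) ℝ}
  {A A' : Coord → Coord} {u : Coord}

/-- The transformation law of the curvature. -/
theorem jac_mul_curvMat (h : CoordChange W U φ) (hg : CoordMetric U g) (hg' : CoordMetric W g')
    (hp : ∀ z ∈ W, g' z = (jac φ z).transpose * g (φ z) * jac φ z) (hu : u ∈ W) (i l : Fin 4) :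
    jac φ u * curvMat g' i l u
      = (∑ b, ∑ c, (jac φ u b i * jac φ u c l) • curvMat g b c (φ u)) * jac φ u := by
  have hx : φ u ∈ U := h.mapsTo hu
  have hJd := fun a b => h.differentiableAt_jac hu a b
  have hΓ : ∀ b, ∀ a c, DifferentiableAt ℝ (fun z => connMat g b z a c) (φ u) := fun b a c =>
    hg.differentiableAt_christoffel hx a b c
  have hΓ' : ∀ b, ∀ a c, DifferentiableAt ℝ (fun z => connMat g' b z a c) u := fun b a c =>
    hg'.differentiableAt_christoffel hu a b c
  have hΓφ : ∀ b, ∀ a c, DifferentiableAt ℝ (fun z => connMat g b (φ z) a c) u := fun b a c =>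
    h.differentiableAt_comp hu (hΓ b a c)
  set Gh : Fin 4 → Coord → Matrix (Fin 4) (Fin 4) ℝ := fun l z =>
    ∑ b, jac φ z b l • connMat g b (φ z) with hGh
  have hGhd : ∀ l a c, DifferentiableAt ℝ (fun z => Gh l z a c) u := by
    intro l a c
    simp only [hGh, Matrix.sum_apply, Matrix.smul_apply, smul_eq_mul]
    exact DifferentiableAt.fun_sum fun b _ => (hJd b l).fun_mul (hΓφ b a c)
  have hdJd : ∀ l a c, DifferentiableAt ℝ (fun z => pdM l (jac φ) z a c) u := by
    intro l a c
    exact ((contDiffOn_pd h.isOpen (h.contDiffOn_jac a c) l).contDiffAt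
      (h.isOpen.mem_nhds hu)).differentiableAt (by simp)
  have hD : ∀ i l, jac φ u * pdM i (connMat g' l) u + pdM i (jac φ) u * connMat g' l u
      = pdM i (pdM l (jac φ)) u + (Gh l u * pdM i (jac φ) u + pdM i (Gh l) u * jac φ u) := by
    intro i l
    have h1 := pdM_congr h.isOpen hu (fun z hz => h.jac_mul_connMat hg hg' hp hz l) i
    rwa [pdM_mul hJd (hΓ' l), pdM_add (M := pdM l (jac φ)) (N := fun z => Gh l z * jac φ z)
      (hdJd l) (differentiableAt_mul_apply (hGhd l) hJd), pdM_mul (hGhd l) hJd] at h1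
  have hH : pdM l (pdM i (jac φ)) u = pdM i (pdM l (jac φ)) u := by
    ext a b
    exact pd_comm ((h.contDiffOn_jac a b).contDiffAt (h.isOpen.mem_nhds hu)) l i
  have hli := hD l i
  rw [hH] at hli
  have h1 := curvature_algebra (h.jac_mul_connMat hg hg' hp hu i)
    (h.jac_mul_connMat hg hg' hp hu l) (hD i l) hli
  unfold curvMat
  rw [h1]
  congr 1
  have hP : ∀ i l, pdM i (Gh l) u = (∑ b, pdM i (jac φ) u b l • connMat g b (φ u))
      + ∑ b, ∑ c, (jac φ u b l * jac φ u c i) • pdM c (connMat g b) (φ u) := by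
    intro i l
    ext a d
    simp only [Matrix.add_apply, Matrix.sum_apply, Matrix.smul_apply, smul_eq_mul, hGh]
    simp only [pdM, Matrix.of_apply, Matrix.sum_apply, Matrix.smul_apply, smul_eq_mul]
    rw [pd_sum fun b _ => (hJd b l).fun_mul (hΓφ b a d), ← Finset.sum_add_distrib]
    refine Finset.sum_congr rfl fun b _ => ?_
    rw [pd_mul (hJd b l) (hΓφ b a d), h.pd_comp hu (hΓ b a d), Finset.mul_sum, add_comm]
    congr 1
    exact Finset.sum_congr rfl fun c _ => by ring
  rw [hP, hP]
  -- The derivatives of the pulled-back connection contain second derivatives of φ as well; being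
  -- symmetric in i and l, these cancel in the difference.
  have hsym : ∀ b, pdM i (jac φ) u b l = pdM l (jac φ) u b i := fun b => h.pd_jac_symm hu b l i
  simp only [hsym]
  have e1 : ∑ b, ∑ c, (jac φ u b l * jac φ u c i) • pdM c (connMat g b) (φ u)
      = ∑ b, ∑ c, (jac φ u b i * jac φ u c l) • pdM b (connMat g c) (φ u) := by
    rw [Finset.sum_comm]
    exact Finset.sum_congr rfl fun b _ => Finset.sum_congr rfl fun c _ => by rw [mul_comm]
  have e2 : (∑ b, jac φ u b i • connMat g b (φ u)) * (∑ b, jac φ u b l • connMat g b (φ u))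
      = ∑ b, ∑ c, (jac φ u b i * jac φ u c l) • (connMat g b (φ u) * connMat g c (φ u)) := by
    simp only [Finset.sum_mul, Finset.mul_sum, smul_mul_smul_comm]
    exact Finset.sum_comm
  have e3 : (∑ b, jac φ u b l • connMat g b (φ u)) * (∑ b, jac φ u b i • connMat g b (φ u))
      = ∑ b, ∑ c, (jac φ u b i * jac φ u c l) • (connMat g c (φ u) * connMat g b (φ u)) := by
    simp only [Finset.sum_mul, Finset.mul_sum, smul_mul_smul_comm]
    exact Finset.sum_congr rfl fun b _ => Finset.sum_congr rfl fun c _ => by rw [mul_comm]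
  rw [e1, e2, e3]
  simp only [smul_sub, smul_add, Finset.sum_sub_distrib, Finset.sum_add_distrib]
  abel

/-- The transformation law of the Ricci tensor. -/
theorem ricci_eq (h : CoordChange W U φ) (hg : CoordMetric U g) (hg' : CoordMetric W g')
    (hp : ∀ z ∈ W, g' z = (jac φ z).transpose * g (φ z) * jac φ z) (hu : u ∈ W) :
    (Matrix.of (ricci g' u) : Matrix (Fin 4) (Fin 4) ℝ)
      = (jac φ u).transpose * Matrix.of (ricci g (φ u)) * jac φ u := by
  have hx : φ u ∈ U := h.mapsTo hu
  have hd := h.det_ne u hu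
  have hcurv : ∀ i l, curvMat g' i l u = (jac φ u)⁻¹
      * (∑ b, ∑ c, (jac φ u b i * jac φ u c l) • curvMat g b c (φ u)) * jac φ u := by
    intro i l
    rw [mul_assoc, ← h.jac_mul_curvMat hg hg' hp hu, ← mul_assoc,
      Matrix.nonsing_inv_mul _ (isUnit_iff_ne_zero.2 hd), one_mul]
  ext j l
  rw [Matrix.of_apply, hg'.ricci_eq_curvMat hu]
  set J := jac φ u with hJ
  have e1 : ∀ i, curvMat g' i l u i j
      = ∑ b, ∑ c, ∑ a, ∑ d, (J b i * J⁻¹ i a) * (J c l * curvMat g b c (φ u) a d * J d j) := by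
    intro i
    rw [hcurv]
    simp only [Matrix.mul_apply, Matrix.sum_apply, Matrix.smul_apply, smul_eq_mul,
      Finset.sum_mul, Finset.mul_sum]
    simp only [← Fintype.sum_prod_type']
    refine Finset.sum_bij' (fun p _ => (p.2.1, p.2.2.1, p.2.2.2, p.1))
      (fun p _ => (p.2.2.2, p.1, p.2.1, p.2.2.1)) (by simp) (by simp) (by simp) (by simp) ?_
    rintro ⟨a, b, c, d⟩ -
    ring
  simp only [e1]
  rw [Finset.sum_comm]
  -- The trace defining the Ricci tensor sums over i, which collapses J J⁻¹ and identifies the upper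
  -- index a with the form index b.
  have e2 : ∀ b, ∑ i, ∑ c, ∑ a, ∑ d, (J b i * J⁻¹ i a) * (J c l * curvMat g b c (φ u) a d * J d j)
      = ∑ c, ∑ d, J c l * curvMat g b c (φ u) b d * J d j := by
    intro b
    rw [Finset.sum_comm]
    refine Finset.sum_congr rfl fun c _ => ?_
    rw [Finset.sum_comm]
    have : ∀ a, ∑ i, ∑ d, (J b i * J⁻¹ i a) * (J c l * curvMat g b c (φ u) a d * J d j)
        = (if b = a then 1 else 0) * ∑ d, (J c l * curvMat g b c (φ u) a d * J d j) := by
      intro a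
      rw [← mul_inv_cancel_apply hd b a, Finset.sum_mul]
      exact Finset.sum_congr rfl fun i _ => (Finset.mul_sum _ _ _).symm
    simp only [this]
    simp
  simp only [e2, Matrix.mul_apply, Matrix.of_apply, hg.ricci_eq_curvMat hx, Matrix.transpose_apply,
    Finset.sum_mul, Finset.mul_sum]
  simp only [← Fintype.sum_prod_type']
  refine Finset.sum_bij' (fun p _ => (p.2.1, p.2.2, p.1))
    (fun p _ => (p.2.2, p.1, p.2.1)) (by simp) (by simp) (by simp) (by simp) ?_
  rintro ⟨a, b, c⟩ -
  ring

end CoordChange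

theorem ricciScalar_eq_trace (g : Coord → Matrix (Fin 4) (Fin 4) ℝ) (x : Coord) :
    ricciScalar g x = ((g x)⁻¹ * (Matrix.of (ricci g x)).transpose).trace := by
  simp [ricciScalar, Matrix.trace, Matrix.mul_apply]

/-- The matrix `F_il g^lm F_jm`. -/
noncomputable def faradayContract (g : Coord → Matrix (Fin 4) (Fin 4) ℝ) (A : Coord → Coord)
    (x : Coord) : Matrix (Fin 4) (Fin 4) ℝ :=
  Matrix.of (faraday A x) * (g x)⁻¹ * (Matrix.of (faraday A x)).transpose

theorem faradayContract_apply (g : Coord → Matrix (Fin 4) (Fin 4) ℝ) (A : Coord → Coord)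
    (x : Coord) (i j : Fin 4) : faradayContract g A x i j
      = ∑ l, ∑ m, faraday A x i l * (g x)⁻¹ l m * faraday A x j m := by
  simp only [faradayContract, Matrix.mul_apply, Finset.sum_mul, Matrix.transpose_apply,
    Matrix.of_apply]
  exact Finset.sum_comm

theorem faradaySq_eq_trace (g : Coord → Matrix (Fin 4) (Fin 4) ℝ) (A : Coord → Coord) (x : Coord) :
    faradaySq g A x = ((g x)⁻¹ * (faradayContract g A x).transpose).trace := by
  rw [faradaySq_eq]
  simp [Matrix.trace, Matrix.mul_apply, ← faradayContract_apply]

/-- The factors Jᵀ cancel and the trace does not see the remaining conjugation by J. One computation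
covers both scalars, r and F_ij F^ij. -/
theorem trace_inv_mul_congruence {m X J : Matrix (Fin 4) (Fin 4) ℝ} (hJ : IsUnit J.det) :
    ((J.transpose * m * J)⁻¹ * (J.transpose * X * J).transpose).trace
      = (m⁻¹ * X.transpose).trace := by
  have hJt : IsUnit J.transpose.det := by rwa [Matrix.det_transpose]
  rw [Matrix.mul_inv_rev, Matrix.mul_inv_rev, Matrix.transpose_mul, Matrix.transpose_mul,
    Matrix.transpose_transpose]
  have : J⁻¹ * (m⁻¹ * J.transpose⁻¹) * (J.transpose * (X.transpose * J))
      = J⁻¹ * (m⁻¹ * X.transpose * J) := by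
    simp only [mul_assoc]
    rw [Matrix.nonsing_inv_mul_cancel_left _ _ hJt]
  rw [this, Matrix.trace_mul_comm, mul_assoc, Matrix.mul_nonsing_inv _ hJ, mul_one]

namespace CoordChange

variable {W U : Set Coord} {φ : Coord → Coord} {g g' : Coord → Matrix (Fin 4) (Fin 4) ℝ}
  {A A' : Coord → Coord} {u : Coord}

theorem ricciScalar_eq (h : CoordChange W U φ) (hg : CoordMetric U g) (hg' : CoordMetric W g')
    (hp : ∀ z ∈ W, g' z = (jac φ z).transpose * g (φ z) * jac φ z) (hu : u ∈ W) :
    ricciScalar g' u = ricciScalar g (φ u) := by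
  rw [ricciScalar_eq_trace, ricciScalar_eq_trace, h.ricci_eq hg hg' hp hu, hp u hu,
    trace_inv_mul_congruence (isUnit_iff_ne_zero.2 (h.det_ne u hu))]

/-- Pullback commutes with d: the second derivatives of φ multiplying A are symmetric in the two
indices and drop out of the antisymmetrized derivative. -/
theorem faraday_eq (h : CoordChange W U φ) (hU : IsOpen U)
    (hA : ∀ i, ContDiffOn ℝ ∞ (fun x => A x i) U)
    (hpA : ∀ z ∈ W, ∀ i, A' z i = ∑ a, jac φ z a i * A (φ z) a) (hu : u ∈ W) :
    (Matrix.of (faraday A' u) : Matrix (Fin 4) (Fin 4) ℝ)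
      = (jac φ u).transpose * Matrix.of (faraday A (φ u)) * jac φ u := by
  have hx : φ u ∈ U := h.mapsTo hu
  have hAd : ∀ a, DifferentiableAt ℝ (fun x => A x a) (φ u) := fun a =>
    ((hA a).contDiffAt (hU.mem_nhds hx)).differentiableAt (by simp)
  have key : ∀ i j, pd i (fun z => A' z j) u
      = ∑ a, (jac φ u a j * ∑ b, jac φ u b i * pd b (fun x => A x a) (φ u)
        + pd i (fun z => jac φ z a j) u * A (φ u) a) := by
    intro i j
    rw [pd_congr_of_mem h.isOpen hu (fun z hz => hpA z hz j), pd_sum fun a _ =>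
      (h.differentiableAt_jac hu a j).fun_mul (h.differentiableAt_comp hu (hAd a))]
    refine Finset.sum_congr rfl fun a _ => ?_
    rw [pd_mul (h.differentiableAt_jac hu a j) (h.differentiableAt_comp hu (hAd a)),
      h.pd_comp hu (hAd a)]
  ext i j
  simp only [Matrix.of_apply, Matrix.mul_apply, Matrix.transpose_apply]
  unfold faraday
  rw [key, key]
  simp only [Finset.sum_add_distrib, h.pd_jac_symm hu _ j i, add_sub_add_right_eq_sub,
    Finset.mul_sum, Finset.sum_mul, mul_sub, sub_mul, Finset.sum_sub_distrib]
  congr 1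
  · exact Finset.sum_congr rfl fun a _ => Finset.sum_congr rfl fun b _ => by ring
  · rw [Finset.sum_comm]
    exact Finset.sum_congr rfl fun a _ => Finset.sum_congr rfl fun b _ => by ring

theorem faradayContract_eq (h : CoordChange W U φ) (hU : IsOpen U)
    (hp : ∀ z ∈ W, g' z = (jac φ z).transpose * g (φ z) * jac φ z)
    (hA : ∀ i, ContDiffOn ℝ ∞ (fun x => A x i) U)
    (hpA : ∀ z ∈ W, ∀ i, A' z i = ∑ a, jac φ z a i * A (φ z) a) (hu : u ∈ W) :
    faradayContract g' A' u = (jac φ u).transpose * faradayContract g A (φ u) * jac φ u := by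
  have hJ : IsUnit (jac φ u).det := isUnit_iff_ne_zero.2 (h.det_ne u hu)
  have hJt : IsUnit (jac φ u).transpose.det := by rwa [Matrix.det_transpose]
  unfold faradayContract
  rw [h.faraday_eq hU hA hpA hu, hp u hu, Matrix.mul_inv_rev, Matrix.mul_inv_rev,
    Matrix.transpose_mul, Matrix.transpose_mul, Matrix.transpose_transpose]
  simp only [mul_assoc]
  rw [Matrix.nonsing_inv_mul_cancel_left _ _ hJt, Matrix.mul_nonsing_inv_cancel_left _ _ hJ]

theorem faradaySq_eq (h : CoordChange W U φ) (hU : IsOpen U)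
    (hp : ∀ z ∈ W, g' z = (jac φ z).transpose * g (φ z) * jac φ z)
    (hA : ∀ i, ContDiffOn ℝ ∞ (fun x => A x i) U)
    (hpA : ∀ z ∈ W, ∀ i, A' z i = ∑ a, jac φ z a i * A (φ z) a) (hu : u ∈ W) :
    faradaySq g' A' u = faradaySq g A (φ u) := by
  rw [faradaySq_eq_trace, faradaySq_eq_trace, h.faradayContract_eq hU hp hA hpA hu, hp u hu,
    trace_inv_mul_congruence (isUnit_iff_ne_zero.2 (h.det_ne u hu))]

theorem volDensity_eq (hp : ∀ z ∈ W, g' z = (jac φ z).transpose * g (φ z) * jac φ z) (hu : u ∈ W) :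
    volDensity g' u = |(jac φ u).det| * volDensity g (φ u) := by
  unfold volDensity
  rw [hp u hu, Matrix.det_mul, Matrix.det_mul, Matrix.det_transpose, mul_comm, ← mul_assoc,
    abs_mul, abs_mul, Real.sqrt_mul (by positivity), Real.sqrt_mul_self (abs_nonneg _)]

theorem lagrangian_eq (h : CoordChange W U φ) (hg : CoordMetric U g) (hg' : CoordMetric W g')
    (hp : ∀ z ∈ W, g' z = (jac φ z).transpose * g (φ z) * jac φ z)
    (hA : ∀ i, ContDiffOn ℝ ∞ (fun x => A x i) U)
    (hpA : ∀ z ∈ W, ∀ i, A' z i = ∑ a, jac φ z a i * A (φ z) a) (β : ℝ) (hu : u ∈ W) :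
    lagrangian β g' A' u = lagrangian β g A (φ u) := by
  unfold lagrangian
  rw [h.ricciScalar_eq hg hg' hp hu, h.faradaySq_eq hg.isOpen hp hA hpA hu]

theorem lagDensity_eq (h : CoordChange W U φ) (hg : CoordMetric U g) (hg' : CoordMetric W g')
    (hp : ∀ z ∈ W, g' z = (jac φ z).transpose * g (φ z) * jac φ z)
    (hA : ∀ i, ContDiffOn ℝ ∞ (fun x => A x i) U)
    (hpA : ∀ z ∈ W, ∀ i, A' z i = ∑ a, jac φ z a i * A (φ z) a) (β : ℝ) (hu : u ∈ W) :
    lagDensity β g' A' u = |(jac φ u).det| * lagDensity β g A (φ u) := by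
  unfold lagDensity
  rw [h.lagrangian_eq hg hg' hp hA hpA β hu, volDensity_eq hp hu, mul_assoc]

theorem einsteinMaxwell_eq (h : CoordChange W U φ) (hg : CoordMetric U g) (hg' : CoordMetric W g')
    (hp : ∀ z ∈ W, g' z = (jac φ z).transpose * g (φ z) * jac φ z)
    (hA : ∀ i, ContDiffOn ℝ ∞ (fun x => A x i) U)
    (hpA : ∀ z ∈ W, ∀ i, A' z i = ∑ a, jac φ z a i * A (φ z) a) (β : ℝ) (hu : u ∈ W) (i j : Fin 4) :
    einsteinMaxwell β g' A' u i j
      = ∑ a, ∑ b, jac φ u a i * jac φ u b j * einsteinMaxwell β g A (φ u) a b := by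
  have hmat : ∀ (g : Coord → Matrix (Fin 4) (Fin 4) ℝ) (A : Coord → Coord) (x : Coord),
      (Matrix.of (einsteinMaxwell β g A x) : Matrix (Fin 4) (Fin 4) ℝ)
        = Matrix.of (ricci g x) + (2 * β) • faradayContract g A x
          - (1 / 2 * ricciScalar g x + β * (1 / 2) * faradaySq g A x) • g x := by
    intro g A x
    ext a b
    simp only [Matrix.of_apply, Matrix.add_apply, Matrix.sub_apply, Matrix.smul_apply, smul_eq_mul,
      faradayContract_apply, einsteinMaxwell, einsteinTensor]
    ring
  have e1 : (Matrix.of (einsteinMaxwell β g' A' u) : Matrix (Fin 4) (Fin 4) ℝ)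
      = (jac φ u).transpose * Matrix.of (einsteinMaxwell β g A (φ u)) * jac φ u := by
    rw [hmat, hmat, h.ricciScalar_eq hg hg' hp hu, h.faradaySq_eq hg.isOpen hp hA hpA hu,
      h.ricci_eq hg hg' hp hu, h.faradayContract_eq hg.isOpen hp hA hpA hu, hp u hu]
    simp only [mul_add, mul_sub, add_mul, sub_mul, Matrix.mul_smul, Matrix.smul_mul, mul_assoc]
  have := congrFun (congrFun e1 i) j
  rw [Matrix.of_apply] at this
  rw [this]
  simp only [Matrix.mul_apply, Finset.sum_mul, Matrix.transpose_apply, Matrix.of_apply]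
  rw [Finset.sum_comm]
  exact Finset.sum_congr rfl fun a _ => Finset.sum_congr rfl fun b _ => by ring

end CoordChange

end CoordinateChange

/-! ### Calculus on the fibres: ‖y‖, quadratic and linear forms, contractions of F with y. -/

section Fibre

open Filter Topology

/-! ### The complex square root -/

theorem root_sq (q : ℝ) : root q ^ 2 = (q : ℂ) := by
  unfold root
  rcases le_total 0 q with h | h
  · rw [Real.sqrt_eq_zero_of_nonpos (neg_nonpos.2 h)]
    simp only [Complex.ofReal_zero, zero_mul, add_zero]
    rw [← Complex.ofReal_pow, Real.sq_sqrt h]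
  · rw [Real.sqrt_eq_zero_of_nonpos h]
    simp only [Complex.ofReal_zero, zero_add]
    rw [mul_pow, Complex.I_sq, ← Complex.ofReal_pow, Real.sq_sqrt (neg_nonneg.2 h)]
    push_cast; ring

theorem root_ne_zero {q : ℝ} (hq : q ≠ 0) : root q ≠ 0 := by
  intro h
  have := root_sq q
  rw [h] at this
  exact hq (by exact_mod_cast (by simpa using this.symm : (q : ℂ) = 0))

theorem norm_root (q : ℝ) : ‖root q‖ = Real.sqrt |q| := by
  have h : ‖root q‖ ^ 2 = |q| := by
    rw [← norm_pow, root_sq, Complex.norm_real, Real.norm_eq_abs]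
  rw [← h, Real.sqrt_sq (norm_nonneg _)]

/-- On the negative side the function is i√(-q), and i² = -1 restores the usual formula. With one
formula on both sides of 0, timelike and spacelike y need not be distinguished from here on. -/
theorem hasDerivAt_root {q : ℝ} (hq : q ≠ 0) : HasDerivAt root (1 / (2 * root q)) q := by
  rcases lt_or_gt_of_ne hq with h | h
  · have e : root =ᶠ[𝓝 q] fun t => ((Real.sqrt (-t) : ℝ) : ℂ) * Complex.I := by
      filter_upwards [gt_mem_nhds h] with t ht
      simp [root, Real.sqrt_eq_zero_of_nonpos (le_of_lt ht)]
    have h1 : HasDerivAt (fun t : ℝ => Real.sqrt (-t)) (-1 / (2 * Real.sqrt (-q))) q :=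
      ((hasDerivAt_id q).neg).sqrt (neg_ne_zero.2 hq)
    have h2 := (h1.ofReal_comp.mul_const Complex.I).congr_of_eventuallyEq e
    refine h2.congr_deriv ?_
    have hs : ((Real.sqrt (-q) : ℝ) : ℂ) ≠ 0 := by
      exact_mod_cast (Real.sqrt_pos.2 (neg_pos.2 h)).ne'
    rw [e.eq_of_nhds]
    push_cast
    field_simp
    simp
  · have e : root =ᶠ[𝓝 q] fun t => ((Real.sqrt t : ℝ) : ℂ) := by
      filter_upwards [lt_mem_nhds h] with t ht
      simp [root, Real.sqrt_eq_zero_of_nonpos (neg_nonpos.2 (le_of_lt ht))]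
    have h1 : HasDerivAt (fun t : ℝ => Real.sqrt t) (1 / (2 * Real.sqrt q)) q :=
      (hasDerivAt_id q).sqrt hq
    refine (h1.ofReal_comp.congr_of_eventuallyEq e).congr_deriv ?_
    rw [e.eq_of_nhds]
    push_cast
    rfl

theorem differentiableAt_root {f : Coord → ℝ} {x : Coord} (hf : DifferentiableAt ℝ f x)
    (h : f x ≠ 0) : DifferentiableAt ℝ (fun z => root (f z)) x :=
  ((hasDerivAt_root h).differentiableAt.comp x hf)

theorem pd_root {f : Coord → ℝ} {x : Coord} (hf : DifferentiableAt ℝ f x) (h : f x ≠ 0)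
    (i : Fin 4) : pd i (fun z => root (f z)) x = (pd i f x : ℝ) / (2 * root (f x)) := by
  have h1 := ((hasDerivAt_root h).hasFDerivAt.comp x hf.hasFDerivAt).pd_eq i
  change pd i (root ∘ f) x = _
  rw [h1]
  simp [pd, div_eq_mul_inv]

/-! ### Quadratic and linear forms on the fibres -/

/-- The quadratic form `t_ab yᵃ yᵇ`. -/
def quadForm (t : Fin 4 → Fin 4 → ℝ) (y : Coord) : ℝ := ∑ a, ∑ b, t a b * y a * y b

/-- The linear form `c_a yᵃ`. -/
def linForm (c : Fin 4 → ℝ) (y : Coord) : ℝ := ∑ a, c a * y a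

theorem differentiable_linForm (c : Fin 4 → ℝ) : Differentiable ℝ (linForm c) := by
  unfold linForm; fun_prop

theorem differentiable_quadForm (t : Fin 4 → Fin 4 → ℝ) : Differentiable ℝ (quadForm t) := by
  unfold quadForm; fun_prop

theorem pd_linForm (c : Fin 4 → ℝ) (y : Coord) (i : Fin 4) : pd i (linForm c) y = c i := by
  unfold linForm
  rw [pd_sum fun a _ => by fun_prop]
  have : ∀ a, pd i (fun z : Coord => c a * z a) y = if a = i then c a else 0 := by
    intro a
    rw [pd_const_mul (by fun_prop), pd_coord]; simp
  simp [this]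

theorem quadForm_eq_sum_linForm (t : Fin 4 → Fin 4 → ℝ) (y : Coord) :
    quadForm t y = ∑ a, y a * linForm (t a) y := by
  unfold quadForm linForm
  simp only [Finset.mul_sum]
  exact Finset.sum_congr rfl fun a _ => Finset.sum_congr rfl fun b _ => by ring

theorem pd_quadForm (t : Fin 4 → Fin 4 → ℝ) (y : Coord) (i : Fin 4) :
    pd i (quadForm t) y = linForm (fun a => t i a + t a i) y := by
  have : quadForm t = fun y => ∑ a, y a * linForm (t a) y := funext (quadForm_eq_sum_linForm t)
  have hl := fun a => differentiable_linForm (t a)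
  rw [this, pd_sum fun a _ => by fun_prop]
  have e : ∀ a, pd i (fun z : Coord => z a * linForm (t a) z) y
      = y a * t a i + (if a = i then linForm (t a) y else 0) := by
    intro a
    rw [pd_mul (by fun_prop) (by fun_prop), pd_linForm, pd_coord]
    split_ifs <;> simp
  simp only [e, Finset.sum_add_distrib]
  simp only [linForm, add_mul, Finset.sum_add_distrib, Finset.sum_ite_eq', Finset.mem_univ, if_true]
  rw [add_comm]
  congr 1
  exact Finset.sum_congr rfl fun a _ => mul_comm _ _

theorem pd_pd_ofReal_quadForm (t : Fin 4 → Fin 4 → ℝ) (y : Coord) (i j : Fin 4) :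
    pd j (fun w => pd i (fun w' => (quadForm t w' : ℂ)) w) y = ((t i j + t j i : ℝ) : ℂ) := by
  have : (fun w => pd i (fun w' => (quadForm t w' : ℂ)) w)
      = fun w => (linForm (fun a => t i a + t a i) w : ℂ) := by
    funext w
    rw [pd_ofReal (differentiable_quadForm t w), pd_quadForm]
  rw [this, pd_ofReal (differentiable_linForm _ y), pd_linForm]

theorem isOpen_nonnull (g : Coord → Matrix (Fin 4) (Fin 4) ℝ) (x : Coord) :
    IsOpen {w | sqNorm g x w ≠ 0} :=
  isOpen_ne_fun (differentiable_quadForm (g x)).continuous continuous_const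

/-! ### The fields `B`, `ℬ` and `𝒢` -/

section AtPoint

variable {g : Coord → Matrix (Fin 4) (Fin 4) ℝ} {A : Coord → Coord} {α : ℝ} {x : Coord}

theorem norm_sq (g : Coord → Matrix (Fin 4) (Fin 4) ℝ) (x y : Coord) :
    norm g x y ^ 2 = (sqNorm g x y : ℂ) := root_sq _

theorem norm_ne_zero {y : Coord} (hy : sqNorm g x y ≠ 0) : norm g x y ≠ 0 := root_ne_zero hy

theorem differentiableAt_norm {y : Coord} (hy : sqNorm g x y ≠ 0) :
    DifferentiableAt ℝ (fun w => norm g x w) y :=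
  differentiableAt_root (differentiable_quadForm (g x) y) hy

theorem pd_norm (hs : ∀ i j, g x i j = g x j i) {y : Coord} (hy : sqNorm g x y ≠ 0) (i : Fin 4) :
    pd i (fun w => norm g x w) y = (linForm (g x i) y : ℂ) / norm g x y := by
  have h1 : pd i (fun w => norm g x w) y = _ := pd_root (differentiable_quadForm (g x) y) hy i
  have h2 : pd i (quadForm (g x)) y = _ := pd_quadForm _ y i
  rw [h1, h2]
  have : linForm (fun a => g x i a + g x a i) y = 2 * linForm (g x i) y := by
    unfold linForm
    rw [Finset.mul_sum]
    refine Finset.sum_congr rfl fun a _ => ?_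
    change (g x i a + g x a i) * y a = _
    rw [hs a i]; ring
  rw [this]
  have hn := norm_ne_zero hy
  change ((2 * linForm (g x i) y : ℝ) : ℂ) / (2 * norm g x y) = _
  push_cast
  field_simp

theorem fieldB_eq (g : Coord → Matrix (Fin 4) (Fin 4) ℝ) (A : Coord → Coord) (α : ℝ)
    (x y : Coord) (i : Fin 4) :
    fieldB g A α x y i
      = -((α : ℂ) / 2) * (norm g x y * (linForm (faradayMixed g A x i) y : ℂ)) := by
  unfold fieldB linForm
  push_cast
  ring

theorem fieldB1_eq (hs : ∀ i j, g x i j = g x j i) {y : Coord} (hy : sqNorm g x y ≠ 0)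
    (i j : Fin 4) :
    fieldB1 g A α x y i j
      = -((α : ℂ) / 2) * ((linForm (g x j) y : ℂ) / norm g x y
          * (linForm (faradayMixed g A x i) y : ℂ) + norm g x y * (faradayMixed g A x i j : ℂ)) := by
  unfold fieldB1
  simp only [fieldB_eq]
  have hl := (differentiable_linForm (faradayMixed g A x i) y)
  have hn := differentiableAt_norm (g := g) hy
  rw [pd_const_mul (hn.fun_mul hl.ofReal_comp), pd_mul hn hl.ofReal_comp, pd_norm hs hy,
    pd_ofReal hl, pd_linForm]
  ring

theorem linForm_lower (hs : ∀ i j, g x i j = g x j i) (c : Fin 4 → ℝ) (y : Coord) :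
    ∑ h, linForm (g x h) y * c h = linForm (fun b => ∑ h, g x b h * c h) y := by
  simp only [linForm, Finset.sum_mul]
  rw [Finset.sum_comm]
  exact Finset.sum_congr rfl fun b _ => Finset.sum_congr rfl fun h _ => by rw [hs h b]; ring

theorem lower_faradayMixed (hd : (g x).det ≠ 0) (b j : Fin 4) :
    ∑ h, g x b h * faradayMixed g A x h j = faraday A x b j := by
  unfold faradayMixed
  simp only [Finset.mul_sum]
  rw [Finset.sum_comm]
  simp only [← mul_assoc, ← Finset.sum_mul, mul_inv_cancel_apply hd]
  simp

theorem sum_antisymm_eq_zero {X : Fin 4 → Fin 4 → ℝ} (h : ∀ i j, X i j = -X j i) :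
    ∑ i, ∑ j, X i j = 0 := by
  have : ∑ i, ∑ j, X i j = -∑ i, ∑ j, X i j := by
    conv_lhs => rw [Finset.sum_comm]
    simp only [← Finset.sum_neg_distrib]
    exact Finset.sum_congr rfl fun i _ => Finset.sum_congr rfl fun j _ => h j i
  linarith

theorem faraday_quadForm_eq_zero (A : Coord → Coord) (x y : Coord) :
    quadForm (faraday A x) y = 0 :=
  sum_antisymm_eq_zero fun i j => by rw [faraday_antisymm]; ring

theorem sum_lower_mul_faradayMixed (hs : ∀ i j, g x i j = g x j i) (hd : (g x).det ≠ 0)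
    (y : Coord) (j : Fin 4) :
    ∑ h, linForm (g x h) y * faradayMixed g A x h j = -linForm (faraday A x j) y := by
  rw [linForm_lower hs]
  simp only [lower_faradayMixed hd]
  simp only [linForm, ← Finset.sum_neg_distrib]
  exact Finset.sum_congr rfl fun b _ => by rw [faraday_antisymm]; ring

/-- Lowering the index leaves F_ij yⁱ yʲ, which vanishes by antisymmetry. This orthogonality of B
and y removes the inverse powers of ‖y‖ from the trace of Bⁱ_j and from the trace of its square. -/
theorem sum_lower_mul_linForm_faradayMixed (hs : ∀ i j, g x i j = g x j i) (hd : (g x).det ≠ 0)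
    (y : Coord) : ∑ h, linForm (g x h) y * linForm (faradayMixed g A x h) y = 0 := by
  have e : ∑ h, linForm (g x h) y * linForm (faradayMixed g A x h) y
      = ∑ j, y j * ∑ h, linForm (g x h) y * faradayMixed g A x h j := by
    have : ∀ h, linForm (faradayMixed g A x h) y = ∑ j, faradayMixed g A x h j * y j := fun _ => rfl
    simp only [this, Finset.mul_sum]
    rw [Finset.sum_comm]
    exact Finset.sum_congr rfl fun b _ => Finset.sum_congr rfl fun h _ => by ring
  rw [e]
  simp only [sum_lower_mul_faradayMixed hs hd, mul_neg, Finset.sum_neg_distrib]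
  rw [← quadForm_eq_sum_linForm, faraday_quadForm_eq_zero, neg_zero]

theorem sum_faraday_mul_faradayMixed (y : Coord) :
    ∑ i, linForm (faraday A x i) y * linForm (faradayMixed g A x i) y
      = quadForm (faradayContract g A x) y := by
  simp only [linForm, quadForm, faradayMixed, faradayContract_apply, Finset.mul_sum, Finset.sum_mul]
  simp only [← Fintype.sum_prod_type']
  refine Finset.sum_bij' (fun p _ => (p.2.2.2, p.2.1, p.1, p.2.2.1))
    (fun p _ => (p.2.2.1, p.2.1, p.2.2.2, p.1)) (by simp) (by simp) (by simp) (by simp) ?_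
  rintro ⟨i, a, b, h⟩ -
  simp only
  rw [faraday_antisymm A x i, faraday_antisymm A x b]
  ring

theorem trace_faradayMixed (hs : ∀ i j, g x i j = g x j i) : ∑ i, faradayMixed g A x i i = 0 := by
  unfold faradayMixed
  exact sum_antisymm_eq_zero fun i j => by rw [inv_symm_apply hs i j, faraday_antisymm]; ring

theorem trace_faradayMixed_sq (hs : ∀ i j, g x i j = g x j i) :
    ∑ i, ∑ h, faradayMixed g A x i h * faradayMixed g A x h i = -faradaySq g A x := by
  rw [faradaySq_eq]
  simp only [faradayMixed, Finset.mul_sum, Finset.sum_mul, ← Finset.sum_neg_distrib]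
  simp only [← Fintype.sum_prod_type']
  refine Finset.sum_bij' (fun p _ => (p.2.2.2, p.1, p.2.1, p.2.2.1))
    (fun p _ => (p.2.1, p.2.2.1, p.2.2.2, p.1)) (by simp) (by simp) (by simp) (by simp) ?_
  rintro ⟨i, a, b, h⟩ -
  simp only
  rw [inv_symm_apply hs i, faraday_antisymm A x b i]
  ring

end AtPoint

end Fibre

/-! ### Closed forms of Bⁱ_h B^h_i, ℬ and 𝒢; first formulas for the spray connection. -/

section Fibre

open Filter Topology

section AtPoint

variable {g : Coord → Matrix (Fin 4) (Fin 4) ℝ} {A : Coord → Coord} {α : ℝ} {x : Coord}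

/-- The coefficients of `Bⁱ_h B^h_i`, a quadratic form in `y`. -/
noncomputable def traceBBCoeff (g : Coord → Matrix (Fin 4) (Fin 4) ℝ) (A : Coord → Coord) (α : ℝ)
    (x : Coord) (a b : Fin 4) : ℝ :=
  -(α ^ 2 / 4) * (2 * faradayContract g A x a b + faradaySq g A x * g x a b)

theorem quadForm_traceBBCoeff (y : Coord) :
    quadForm (traceBBCoeff g A α x) y = -(α ^ 2 / 4) *
      (2 * quadForm (faradayContract g A x) y + faradaySq g A x * sqNorm g x y) := by
  unfold quadForm traceBBCoeff sqNorm
  simp only [Finset.mul_sum, ← Finset.sum_add_distrib]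
  exact Finset.sum_congr rfl fun a _ => Finset.sum_congr rfl fun b _ => by ring

theorem faradayContract_symm (hs : ∀ i j, g x i j = g x j i) (a b : Fin 4) :
    faradayContract g A x a b = faradayContract g A x b a := by
  rw [faradayContract_apply, faradayContract_apply, Finset.sum_comm]
  exact Finset.sum_congr rfl fun i _ => Finset.sum_congr rfl fun j _ => by
    rw [inv_symm_apply hs j i]; ring

theorem traceBBCoeff_symm (hs : ∀ i j, g x i j = g x j i) (a b : Fin 4) :
    traceBBCoeff g A α x a b = traceBBCoeff g A α x b a := by
  unfold traceBBCoeff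
  rw [faradayContract_symm hs, hs a b]

/-- The product of two copies of `fieldB1_eq` has four kinds of terms. The one over ‖y‖² is a
product of two sums that vanish by orthogonality, the two mixed ones each give -F_il F_j^l yⁱ yʲ,
and the last gives -‖y‖² F_lm F^lm; the common factor is α²/4. -/
theorem traceBB_eq (hs : ∀ i j, g x i j = g x j i) (hd : (g x).det ≠ 0) {y : Coord}
    (hy : sqNorm g x y ≠ 0) :
    traceBB g A α x y = (quadForm (traceBBCoeff g A α x) y : ℂ) := by
  unfold traceBB
  simp only [fieldB1_eq hs hy]
  set n := norm g x y with hn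
  have hn0 : n ≠ 0 := norm_ne_zero hy
  have hn2 : n ^ 2 = (sqNorm g x y : ℂ) := norm_sq g x y
  have e1 : ∀ i h, (-((α : ℂ) / 2) * ((linForm (g x h) y : ℂ) / n
        * (linForm (faradayMixed g A x i) y : ℂ) + n * (faradayMixed g A x i h : ℂ)))
      * (-((α : ℂ) / 2) * ((linForm (g x i) y : ℂ) / n
        * (linForm (faradayMixed g A x h) y : ℂ) + n * (faradayMixed g A x h i : ℂ)))
      = ((α : ℂ) ^ 2 / 4) * (
        ((linForm (g x i) y * linForm (faradayMixed g A x i) y)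
          * (linForm (g x h) y * linForm (faradayMixed g A x h) y) : ℝ) / n ^ 2
        + (linForm (faradayMixed g A x i) y * (linForm (g x h) y * faradayMixed g A x h i) : ℝ)
        + (linForm (faradayMixed g A x h) y * (linForm (g x i) y * faradayMixed g A x i h) : ℝ)
        + n ^ 2 * (faradayMixed g A x i h * faradayMixed g A x h i : ℝ)) := by
    intro i h
    push_cast
    field_simp
    ring
  simp only [e1]
  simp only [← Finset.mul_sum, Finset.sum_add_distrib, ← Finset.sum_div, ← Complex.ofReal_sum]
  have z1 := sum_lower_mul_linForm_faradayMixed (A := A) hs hd y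
  have z2 : ∑ i, linForm (faradayMixed g A x i) y
      * ∑ h, linForm (g x h) y * faradayMixed g A x h i = -quadForm (faradayContract g A x) y := by
    simp only [sum_lower_mul_faradayMixed hs hd]
    rw [← sum_faraday_mul_faradayMixed, ← Finset.sum_neg_distrib]
    exact Finset.sum_congr rfl fun i _ => by ring
  have z3 : ∑ i, ∑ h, linForm (faradayMixed g A x h) y
      * (linForm (g x i) y * faradayMixed g A x i h) = -quadForm (faradayContract g A x) y := by
    rw [Finset.sum_comm, ← z2]
    exact Finset.sum_congr rfl fun i _ => (Finset.mul_sum _ _ _).symm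
  rw [z1, z2, z3, trace_faradayMixed_sq hs, hn2, quadForm_traceBBCoeff]
  simp only [mul_zero, Finset.sum_const_zero]
  push_cast
  ring

/-- Lowering Fⁱ_j yʲ gives F_ij yʲ, hence the contraction of two copies of F. The explicit factor
‖y‖² is the one that the division in ℬ removes. -/
theorem sqB_eq (hd : (g x).det ≠ 0) (y : Coord) :
    sqB g A α x y
      = ((α : ℂ) ^ 2 / 4) * norm g x y ^ 2 * (quadForm (faradayContract g A x) y : ℂ) := by
  have hl : ∀ b, ∑ h, g x b h * linForm (faradayMixed g A x h) y = linForm (faraday A x b) y := by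
    intro b
    simp only [linForm, Finset.mul_sum]
    rw [Finset.sum_comm]
    refine Finset.sum_congr rfl fun j _ => ?_
    rw [← lower_faradayMixed hd, Finset.sum_mul]
    exact Finset.sum_congr rfl fun h _ => by ring
  have key : ∑ l, ∑ m, g x l m * linForm (faradayMixed g A x l) y
      * linForm (faradayMixed g A x m) y = quadForm (faradayContract g A x) y := by
    rw [← sum_faraday_mul_faradayMixed]
    refine Finset.sum_congr rfl fun l _ => ?_
    rw [← hl, Finset.sum_mul]
    exact Finset.sum_congr rfl fun h _ => by ring
  unfold sqB
  rw [← key]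
  push_cast
  simp only [fieldB_eq, Finset.mul_sum]
  exact Finset.sum_congr rfl fun l _ => Finset.sum_congr rfl fun m _ => by ring

theorem calB_eq (hs : ∀ i j, g x i j = g x j i) (hd : (g x).det ≠ 0) {y : Coord}
    (hy : sqNorm g x y ≠ 0) :
    calB g A α x y = (quadForm (fun a b => 3 * α ^ 2 / 2 * faradayContract g A x a b
      + 1 / 2 * traceBBCoeff g A α x a b) y : ℂ) := by
  have hn0 : norm g x y ≠ 0 := norm_ne_zero hy
  have e : quadForm (fun a b => 3 * α ^ 2 / 2 * faradayContract g A x a b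
      + 1 / 2 * traceBBCoeff g A α x a b) y = 3 * α ^ 2 / 2 * quadForm (faradayContract g A x) y
        + 1 / 2 * quadForm (traceBBCoeff g A α x) y := by
    unfold quadForm
    simp only [Finset.mul_sum, ← Finset.sum_add_distrib]
    exact Finset.sum_congr rfl fun a _ => Finset.sum_congr rfl fun b _ => by ring
  unfold calB
  rw [sqB_eq hd, traceBB_eq hs hd hy, e]
  push_cast
  field_simp
  ring

theorem pd_pd_eq_of_eq_quadForm {f : Coord → ℂ} {U : Set Coord} (hU : IsOpen U)
    {t : Fin 4 → Fin 4 → ℝ} (h : ∀ w ∈ U, f w = (quadForm t w : ℂ)) {y : Coord} (hy : y ∈ U)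
    (i j : Fin 4) :
    pd j (fun w => pd i (fun w' => f w') w) y = ((t i j + t j i : ℝ) : ℂ) := by
  rw [← pd_pd_ofReal_quadForm t y i j]
  exact pd_congr_of_mem hU hy (fun w hw => pd_congr_of_mem hU hw h i) j

/-- The tensor `𝒢_ij` is `G_ij + β (2 F_il F_j^l - ½ F_lm F^lm g_ij)` with `β = 3α²/2`. -/
theorem calG_eq (hs : ∀ i j, g x i j = g x j i) (hd : (g x).det ≠ 0) {y : Coord}
    (hy : sqNorm g x y ≠ 0) (i j : Fin 4) :
    calG g A α x y i j = (einsteinMaxwell (3 * α ^ 2 / 2) g A x i j : ℂ) := by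
  unfold calG ricciTilde
  rw [pd_pd_eq_of_eq_quadForm (isOpen_nonnull g x) (fun w hw => traceBB_eq hs hd hw) hy,
    pd_pd_eq_of_eq_quadForm (isOpen_nonnull g x) (fun w hw => calB_eq hs hd hw) hy]
  -- The Hessian of Bⁱ_h B^h_i enters with -½ through R̃_ij and with +½ through ℬ, so it cancels; of
  -- the Hessians only 3α² F_il F_j^l is left.
  rw [faradayContract_symm hs j i, traceBBCoeff_symm hs j i]
  unfold einsteinMaxwell einsteinTensor ricciScalarTilde traceBBCoeff
  rw [← faradayContract_apply]
  push_cast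
  ring

/-- With β = k/c⁴ the prefactor 8πk/c⁴ · 1/(4π) equals 2β. This is where the special value of α is
used; the variational statement holds for every α. -/
theorem einsteinMaxwell_eq_stressEnergy {c k : ℝ} (hα : 3 * α ^ 2 / 2 = k / c ^ 4) (i j : Fin 4) :
    einsteinMaxwell (3 * α ^ 2 / 2) g A x i j
      = einsteinTensor g x i j - 8 * Real.pi * k / c ^ 4 * emStressEnergy g A x i j := by
  unfold einsteinMaxwell emStressEnergy
  rw [hα]
  have := Real.pi_ne_zero
  have e : 8 * Real.pi * k / c ^ 4 = 8 * Real.pi * (k / c ^ 4) := by ring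
  rw [e]
  generalize k / c ^ 4 = β
  field_simp
  ring

theorem einsteinMaxwell_symm {U : Set Coord} (h : CoordMetric U g) (hx : x ∈ U) (β : ℝ)
    (i j : Fin 4) : einsteinMaxwell β g A x i j = einsteinMaxwell β g A x j i := by
  have hs := h.symm x hx
  unfold einsteinMaxwell einsteinTensor
  rw [← faradayContract_apply, ← faradayContract_apply, h.ricci_symm hx, faradayContract_symm hs,
    hs i j]

end AtPoint

/-! ### The Ricci scalar of `D(α)` -/

section RicciScalar

variable {U : Set Coord} {g : Coord → Matrix (Fin 4) (Fin 4) ℝ} {A : Coord → Coord} {α : ℝ}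
  {x : Coord}

theorem pd_sqNorm_base (h : CoordMetric U g) (hx : x ∈ U) (y : Coord) (k : Fin 4) :
    pd k (fun z => sqNorm g z y) x = quadForm (fun a b => pd k (fun z => g z a b) x) y := by
  unfold sqNorm quadForm
  have hd := fun a b => h.differentiableAt hx a b
  rw [pd_sum fun a _ => DifferentiableAt.fun_sum fun b _ =>
    ((hd a b).mul_const _).mul_const _]
  refine Finset.sum_congr rfl fun a _ => ?_
  rw [pd_sum fun b _ => ((hd a b).mul_const _).mul_const _]
  refine Finset.sum_congr rfl fun b _ => ?_
  rw [pd_mul_const ((hd a b).mul_const _), pd_mul_const (hd a b)]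

theorem differentiableAt_sqNorm_base (h : CoordMetric U g) (hx : x ∈ U) (y : Coord) :
    DifferentiableAt ℝ (fun z => sqNorm g z y) x := by
  unfold sqNorm
  exact DifferentiableAt.fun_sum fun a _ => DifferentiableAt.fun_sum fun b _ =>
    ((h.differentiableAt hx a b).mul_const _).mul_const _

theorem isOpen_nonnull_base (h : CoordMetric U g) (y : Coord) :
    IsOpen {z | z ∈ U ∧ sqNorm g z y ≠ 0} := by
  have hc : ContinuousOn (fun z => sqNorm g z y) U := fun z hz =>
    (differentiableAt_sqNorm_base h hz y).continuousAt.continuousWithinAt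
  exact hc.isOpen_inter_preimage h.isOpen isOpen_ne

theorem contDiffOn_faradayMixed (h : CoordMetric U g)
    (hA : ∀ i, ContDiffOn ℝ ∞ (fun x => A x i) U) (i j : Fin 4) :
    ContDiffOn ℝ ∞ (fun z => faradayMixed g A z i j) U := by
  unfold faradayMixed
  exact ContDiffOn.sum fun a _ => (h.contDiffOn_inv i a).mul
    ((MetricFam.faraday h.isOpen (O := Set.univ ×ˢ U) (fun p hp => hp.2) hA a j).contDiffOn_zero 0)

theorem differentiableAt_faradayMixed (h : CoordMetric U g)
    (hA : ∀ i, ContDiffOn ℝ ∞ (fun x => A x i) U) (hx : x ∈ U) (i j : Fin 4) :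
    DifferentiableAt ℝ (fun z => faradayMixed g A z i j) x :=
  ((contDiffOn_faradayMixed h hA i j).contDiffAt (h.isOpen.mem_nhds hx)).differentiableAt (by simp)

theorem differentiableAt_linForm_base {c : Coord → Fin 4 → ℝ} {y : Coord}
    (hc : ∀ a, DifferentiableAt ℝ (fun z => c z a) x) :
    DifferentiableAt ℝ (fun z => linForm (c z) y) x := by
  unfold linForm
  exact DifferentiableAt.fun_sum fun a _ => (hc a).mul_const _

theorem pd_linForm_base {c : Coord → Fin 4 → ℝ} {y : Coord}
    (hc : ∀ a, DifferentiableAt ℝ (fun z => c z a) x) (k : Fin 4) :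
    pd k (fun z => linForm (c z) y) x = linForm (fun a => pd k (fun z => c z a) x) y := by
  unfold linForm
  rw [pd_sum fun a _ => (hc a).mul_const _]
  exact Finset.sum_congr rfl fun a _ => pd_mul_const (hc a) _ k

theorem differentiableAt_quadForm_base {c : Coord → Fin 4 → Fin 4 → ℝ} {y : Coord}
    (hc : ∀ a b, DifferentiableAt ℝ (fun z => c z a b) x) :
    DifferentiableAt ℝ (fun z => quadForm (c z) y) x := by
  unfold quadForm
  exact DifferentiableAt.fun_sum fun a _ => DifferentiableAt.fun_sum fun b _ =>
    ((hc a b).mul_const _).mul_const _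

theorem pd_quadForm_base {c : Coord → Fin 4 → Fin 4 → ℝ} {y : Coord}
    (hc : ∀ a b, DifferentiableAt ℝ (fun z => c z a b) x) (k : Fin 4) :
    pd k (fun z => quadForm (c z) y) x = quadForm (fun a b => pd k (fun z => c z a b) x) y := by
  unfold quadForm
  rw [pd_sum fun a _ => DifferentiableAt.fun_sum fun b _ => ((hc a b).mul_const _).mul_const _]
  refine Finset.sum_congr rfl fun a _ => ?_
  rw [pd_sum fun b _ => ((hc a b).mul_const _).mul_const _]
  refine Finset.sum_congr rfl fun b _ => ?_
  rw [pd_mul_const ((hc a b).mul_const _), pd_mul_const (hc a b)]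

theorem spray_eq (g : Coord → Matrix (Fin 4) (Fin 4) ℝ) (A : Coord → Coord) (α : ℝ)
    (x y : Coord) (i : Fin 4) :
    spray g A α x y i = (1 / 2) * (quadForm (christoffel g x i) y : ℂ) + fieldB g A α x y i := by
  unfold spray quadForm
  push_cast
  rfl

theorem differentiableAt_fieldB {y : Coord} (hy : sqNorm g x y ≠ 0) (i : Fin 4) :
    DifferentiableAt ℝ (fun w => fieldB g A α x w i) y := by
  simp only [fieldB_eq]
  exact ((differentiableAt_norm hy).fun_mul
    (differentiable_linForm _ y).ofReal_comp).const_mul _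

theorem connN_eq (h : CoordMetric U g) (hx : x ∈ U) {y : Coord} (hy : sqNorm g x y ≠ 0)
    (i j : Fin 4) :
    connN g A α x y i j = (linForm (christoffel g x i j) y : ℂ) + fieldB1 g A α x y i j := by
  unfold connN
  have hq := (differentiable_quadForm (christoffel g x i) y)
  simp only [spray_eq]
  rw [pd_add (hq.ofReal_comp.const_mul _) (differentiableAt_fieldB hy i),
    pd_const_mul hq.ofReal_comp, pd_ofReal hq, pd_quadForm]
  have : linForm (fun a => christoffel g x i j a + christoffel g x i a j) y
      = 2 * linForm (christoffel g x i j) y := by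
    unfold linForm
    rw [Finset.mul_sum]
    refine Finset.sum_congr rfl fun a _ => ?_
    change (christoffel g x i j a + christoffel g x i a j) * y a = _
    rw [h.christoffel_symm hx i a j]; ring
  rw [this]
  push_cast
  unfold fieldB1
  ring

end RicciScalar

end Fibre

/-! ### The trace of the tidal tensor of the spray. -/

section RicciScalar

open Filter Topology

variable {U : Set Coord} {g : Coord → Matrix (Fin 4) (Fin 4) ℝ} {A : Coord → Coord} {α : ℝ}
  {x : Coord}

/-- The contracted covariant derivative of `Fⁱ_k`. -/
noncomputable def faradayDiv (g : Coord → Matrix (Fin 4) (Fin 4) ℝ) (A : Coord → Coord)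
    (x : Coord) (k : Fin 4) : ℝ :=
  ∑ i, pd i (fun z => faradayMixed g A z i k) x
    + ∑ l, (∑ i, christoffel g x i i l) * faradayMixed g A x l k
    - ∑ i, ∑ l, christoffel g x l i k * faradayMixed g A x i l

/-- Fⁱ_i = 0 and y_i Fⁱ_j yʲ = 0, both by antisymmetry. Hence the trace of N is that of the
Levi-Civita connection and is linear in y. -/
theorem sum_fieldB1_diag (hs : ∀ i j, g x i j = g x j i) (hd : (g x).det ≠ 0) {y : Coord}
    (hy : sqNorm g x y ≠ 0) : ∑ i, fieldB1 g A α x y i i = 0 := by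
  simp only [fieldB1_eq hs hy]
  rw [← Finset.mul_sum, Finset.sum_add_distrib, ← Finset.mul_sum, ← Complex.ofReal_sum,
    trace_faradayMixed hs]
  have : ∀ i, (linForm (g x i) y : ℂ) / norm g x y * (linForm (faradayMixed g A x i) y : ℂ)
      = (linForm (g x i) y * linForm (faradayMixed g A x i) y : ℝ) / norm g x y := by
    intro i; push_cast; ring
  simp only [this]
  rw [← Finset.sum_div, ← Complex.ofReal_sum, sum_lower_mul_linForm_faradayMixed hs hd]
  simp

theorem sqNorm_eq_sum_linForm (y : Coord) : sqNorm g x y = ∑ j, y j * linForm (g x j) y :=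
  quadForm_eq_sum_linForm _ y

/-- Euler's relation for homogeneity of degree two: the factors ‖y‖ and Fⁱ_k yᵏ contribute one copy
of B each. -/
theorem sum_fieldB1_euler (hs : ∀ i j, g x i j = g x j i) {y : Coord}
    (hy : sqNorm g x y ≠ 0) (i : Fin 4) :
    ∑ k, fieldB1 g A α x y i k * (y k : ℂ) = 2 * fieldB g A α x y i := by
  have hn0 : norm g x y ≠ 0 := norm_ne_zero hy
  have e : ∀ k, fieldB1 g A α x y i k * (y k : ℂ)
      = -((α : ℂ) / 2) * ((y k * linForm (g x k) y : ℝ) / norm g x y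
          * (linForm (faradayMixed g A x i) y : ℂ)
          + norm g x y * (faradayMixed g A x i k * y k : ℝ)) := by
    intro k
    rw [fieldB1_eq hs hy]
    push_cast
    ring
  simp only [e]
  rw [← Finset.mul_sum, Finset.sum_add_distrib, ← Finset.sum_mul, ← Finset.sum_div,
    ← Complex.ofReal_sum, ← sqNorm_eq_sum_linForm, ← Finset.mul_sum, ← Complex.ofReal_sum, fieldB_eq,
    ← norm_sq]
  change -((α : ℂ) / 2) * (norm g x y ^ 2 / norm g x y * _
    + norm g x y * (linForm (faradayMixed g A x i) y : ℂ)) = _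
  field_simp
  ring

theorem sum_connN_diag (h : CoordMetric U g) (hx : x ∈ U) {y : Coord} (hy : sqNorm g x y ≠ 0) :
    ∑ i, connN g A α x y i i = (linForm (fun k => ∑ i, christoffel g x i i k) y : ℂ) := by
  simp only [connN_eq h hx hy, Finset.sum_add_distrib]
  rw [sum_fieldB1_diag (h.symm x hx) (h.det_ne x hx) hy, add_zero, ← Complex.ofReal_sum]
  congr 1
  unfold linForm
  rw [Finset.sum_comm]
  exact Finset.sum_congr rfl fun k _ => (Finset.sum_mul _ _ _).symm

theorem sum_connN_euler (h : CoordMetric U g) (hx : x ∈ U) {y : Coord} (hy : sqNorm g x y ≠ 0)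
    (i : Fin 4) : ∑ k, connN g A α x y i k * (y k : ℂ) = 2 * spray g A α x y i := by
  simp only [connN_eq h hx hy, add_mul, Finset.sum_add_distrib]
  rw [sum_fieldB1_euler (h.symm x hx) hy, spray_eq, quadForm_eq_sum_linForm]
  push_cast
  have : ∀ k, (linForm (christoffel g x i k) y : ℂ) * (y k : ℂ)
    = (y k : ℂ) * (linForm (christoffel g x i k) y : ℂ) := fun k => mul_comm _ _
  simp only [this]
  ring

theorem differentiableAt_connN_fibre (h : CoordMetric U g) (hx : x ∈ U) {y : Coord}
    (hy : sqNorm g x y ≠ 0) (i j : Fin 4) :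
    DifferentiableAt ℝ (fun w => connN g A α x w i j) y := by
  have e : (fun w => connN g A α x w i j) =ᶠ[𝓝 y] fun w =>
      (linForm (christoffel g x i j) w : ℂ) + -((α : ℂ) / 2) * ((linForm (g x j) w : ℂ)
        / norm g x w * (linForm (faradayMixed g A x i) w : ℂ)
        + norm g x w * (faradayMixed g A x i j : ℂ)) := by
    refine eventually_of_mem ((isOpen_nonnull g x).mem_nhds hy) fun w hw => ?_
    exact (connN_eq h hx hw i j).trans (by rw [fieldB1_eq (h.symm x hx) hw])
  refine DifferentiableAt.congr_of_eventuallyEq ?_ e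
  have hl : ∀ c, DifferentiableAt ℝ (fun w => (linForm c w : ℂ)) y := fun c =>
    (differentiable_linForm c y).ofReal_comp
  have hn := differentiableAt_norm hy
  exact (hl _).fun_add ((((hl _).fun_mul (hn.fun_inv (norm_ne_zero hy))).fun_mul (hl _)).fun_add
    (hn.mul_const _) |>.const_mul _)

theorem differentiableAt_norm_base (h : CoordMetric U g) (hx : x ∈ U) {y : Coord}
    (hy : sqNorm g x y ≠ 0) : DifferentiableAt ℝ (fun z => norm g z y) x :=
  differentiableAt_root (differentiableAt_sqNorm_base h hx y) hy

theorem differentiableAt_connN_base (h : CoordMetric U g)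
    (hA : ∀ i, ContDiffOn ℝ ∞ (fun x => A x i) U) (hx : x ∈ U) {y : Coord}
    (hy : sqNorm g x y ≠ 0) (i j : Fin 4) :
    DifferentiableAt ℝ (fun z => connN g A α z y i j) x := by
  have e : (fun z => connN g A α z y i j) =ᶠ[𝓝 x] fun z =>
      (linForm (christoffel g z i j) y : ℂ) + -((α : ℂ) / 2) * ((linForm (g z j) y : ℂ)
        / norm g z y * (linForm (faradayMixed g A z i) y : ℂ)
        + norm g z y * (faradayMixed g A z i j : ℂ)) := by
    refine eventually_of_mem ((isOpen_nonnull_base h y).mem_nhds ⟨hx, hy⟩) fun z hz => ?_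
    exact (connN_eq h hz.1 hz.2 i j).trans (by rw [fieldB1_eq (h.symm z hz.1) hz.2])
  refine DifferentiableAt.congr_of_eventuallyEq ?_ e
  have hn := differentiableAt_norm_base h hx hy
  have h1 : DifferentiableAt ℝ (fun z => (linForm (christoffel g z i j) y : ℂ)) x :=
    (differentiableAt_linForm_base fun a => h.differentiableAt_christoffel hx i j a).ofReal_comp
  have h2 : DifferentiableAt ℝ (fun z => (linForm (g z j) y : ℂ)) x :=
    (differentiableAt_linForm_base fun a => h.differentiableAt hx j a).ofReal_comp
  have h3 : DifferentiableAt ℝ (fun z => (linForm (faradayMixed g A z i) y : ℂ)) x :=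
    (differentiableAt_linForm_base fun a => differentiableAt_faradayMixed h hA hx i a).ofReal_comp
  exact h1.fun_add (((h2.fun_mul (hn.fun_inv (norm_ne_zero hy))).fun_mul h3).fun_add
    (hn.fun_mul (differentiableAt_faradayMixed h hA hx i j).ofReal_comp) |>.const_mul _)

/-- The trace of the tidal tensor, for an abstract spray connection. -/
theorem sum_tidal_eq (h : CoordMetric U g) (hA : ∀ i, ContDiffOn ℝ ∞ (fun x => A x i) U)
    (hx : x ∈ U) {y : Coord} (hy : sqNorm g x y ≠ 0) :
    ∑ i, tidal g A α x y i i
      = (quadForm (fun k m => pd k (fun z => ∑ i, christoffel g z i i m) x) y : ℂ)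
        - 2 * (∑ l, spray g A α x y l * ((∑ i, christoffel g x i i l : ℝ) : ℂ))
        - 2 * (∑ i, pd i (fun z => spray g A α z y i) x)
        + ∑ i, ∑ l, connN g A α x y l i * connN g A α x y i l := by
  have hdf := fun i j => differentiableAt_connN_fibre (A := A) (α := α) h hx hy i j
  have hdb := fun i j => differentiableAt_connN_base (α := α) h hA hx hy i j
  have hΓ : ∀ m, DifferentiableAt ℝ (fun z => ∑ i, christoffel g z i i m) x := fun m =>
    DifferentiableAt.fun_sum fun i _ => h.differentiableAt_christoffel hx i i m
  -- the four contractions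
  have t1 : ∀ k, ∑ i, pd k (fun z => connN g A α z y i i) x
      = (linForm (fun m => pd k (fun z => ∑ i, christoffel g z i i m) x) y : ℂ) := by
    intro k
    rw [← pd_sum fun i _ => hdb i i, ← pd_linForm_base hΓ, ← pd_ofReal
      (differentiableAt_linForm_base hΓ)]
    exact pd_congr_of_mem (isOpen_nonnull_base h y) ⟨hx, hy⟩
      (fun z hz => sum_connN_diag h hz.1 hz.2) k
  have t2 : ∀ l, ∑ i, pd l (fun w => connN g A α x w i i) y
      = ((∑ i, christoffel g x i i l : ℝ) : ℂ) := by
    intro l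
    rw [← pd_sum fun i _ => hdf i i, pd_congr_of_mem (isOpen_nonnull g x) hy
      (fun w hw => sum_connN_diag h hx hw), pd_ofReal (differentiable_linForm _ y), pd_linForm]
  -- Differentiability of the spray is read off from that of N through the Euler relation 2 Gⁱ =
  -- Nⁱ_k yᵏ.
  have hds : ∀ i, DifferentiableAt ℝ (fun z => 2 * spray g A α z y i) x := by
    intro i
    have e : (fun z => 2 * spray g A α z y i) =ᶠ[𝓝 x]
        fun z => ∑ k, connN g A α z y i k * (y k : ℂ) :=
      eventually_of_mem ((isOpen_nonnull_base h y).mem_nhds ⟨hx, hy⟩) fun z hz =>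
        (sum_connN_euler h hz.1 hz.2 i).symm
    exact (DifferentiableAt.fun_sum fun k _ => (hdb i k).mul_const _).congr_of_eventuallyEq e
  have hds' : ∀ i, DifferentiableAt ℝ (fun z => spray g A α z y i) x := by
    intro i
    have := (hds i).const_mul (1 / 2 : ℂ)
    refine this.congr_of_eventuallyEq (Eventually.of_forall fun z => ?_)
    ring
  have t3 : ∀ i, ∑ k, pd i (fun z => connN g A α z y i k) x * (y k : ℂ)
      = 2 * pd i (fun z => spray g A α z y i) x := by
    intro i
    rw [← pd_const_mul (hds' i), pd_congr_of_mem (isOpen_nonnull_base h y) ⟨hx, hy⟩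
      (fun z hz => (sum_connN_euler h hz.1 hz.2 i).symm), pd_sum fun k _ => (hdb i k).mul_const _]
    exact Finset.sum_congr rfl fun k _ => (pd_mul_const (hdb i k) _ i).symm
  -- The Euler relation differentiated in y^l reads 2 Nⁱ_l = Nⁱ_l + yᵏ ∂Nⁱ_k/∂y^l.
  have t4 : ∀ i l, ∑ k, pd l (fun w => connN g A α x w i k) y * (y k : ℂ)
      = connN g A α x y i l := by
    intro i l
    have hsp : DifferentiableAt ℝ (fun w => spray g A α x w i) y := by
      simp only [spray_eq]
      exact ((differentiable_quadForm _ y).ofReal_comp.const_mul _).fun_add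
        (differentiableAt_fieldB hy i)
    have hc : ∀ k, DifferentiableAt ℝ (fun w : Coord => (w k : ℂ)) y := fun k =>
      DifferentiableAt.ofReal_comp (by fun_prop)
    have h1 : pd l (fun w => ∑ k, connN g A α x w i k * (w k : ℂ)) y
        = 2 * connN g A α x y i l := by
      rw [pd_congr_of_mem (isOpen_nonnull g x) hy (fun w hw => sum_connN_euler h hx hw i),
        pd_const_mul hsp]
      rfl
    rw [pd_sum fun k _ => (hdf i k).fun_mul (hc k)] at h1
    have h2 : ∀ k, pd l (fun w => connN g A α x w i k * (w k : ℂ)) y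
        = (if k = l then connN g A α x y i k else 0)
          + pd l (fun w => connN g A α x w i k) y * (y k : ℂ) := by
      intro k
      rw [pd_mul (hdf i k) (hc k), pd_ofReal (by fun_prop), pd_coord]
      split_ifs <;> simp
    simp only [h2, Finset.sum_add_distrib, Finset.sum_ite_eq', Finset.mem_univ, if_true] at h1
    linear_combination h1
  have s1 : ∑ i, ∑ k, pd k (fun z => connN g A α z y i i) x * (y k : ℂ)
      = (quadForm (fun k m => pd k (fun z => ∑ i, christoffel g z i i m) x) y : ℂ) := by
    rw [Finset.sum_comm, quadForm_eq_sum_linForm]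
    push_cast
    refine Finset.sum_congr rfl fun k _ => ?_
    rw [← Finset.sum_mul, t1, mul_comm]
  have s2 : ∑ i, ∑ k, (∑ l, connN g A α x y l k * pd l (fun w => connN g A α x w i i) y) * (y k : ℂ)
      = 2 * (∑ l, spray g A α x y l * ((∑ i, christoffel g x i i l : ℝ) : ℂ)) := by
    have : ∑ i, ∑ k, (∑ l, connN g A α x y l k * pd l (fun w => connN g A α x w i i) y) * (y k : ℂ)
        = ∑ l, (∑ k, connN g A α x y l k * (y k : ℂ))
          * ∑ i, pd l (fun w => connN g A α x w i i) y := by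
      simp only [Finset.sum_mul, Finset.mul_sum]
      simp only [← Fintype.sum_prod_type']
      refine Finset.sum_bij' (fun p _ => (p.2.2, p.1, p.2.1)) (fun p _ => (p.2.1, p.2.2, p.1))
        (by simp) (by simp) (by simp) (by simp) ?_
      rintro ⟨i, k, l⟩ -
      ring
    rw [this, Finset.mul_sum]
    refine Finset.sum_congr rfl fun l _ => ?_
    rw [t2, sum_connN_euler h hx hy]
    ring
  have s4 : ∑ i, ∑ k, (∑ l, connN g A α x y l i * pd l (fun w => connN g A α x w i k) y) * (y k : ℂ)
      = ∑ i, ∑ l, connN g A α x y l i * connN g A α x y i l := by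
    refine Finset.sum_congr rfl fun i _ => ?_
    simp only [Finset.sum_mul]
    rw [Finset.sum_comm]
    refine Finset.sum_congr rfl fun l _ => ?_
    rw [← t4 i l, Finset.mul_sum]
    exact Finset.sum_congr rfl fun k _ => by ring
  unfold tidal curvN deltaD
  rw [← s1, ← s2, ← s4, Finset.mul_sum]
  simp only [← t3]
  simp only [← Finset.sum_sub_distrib, ← Finset.sum_add_distrib]
  exact Finset.sum_congr rfl fun i _ => Finset.sum_congr rfl fun k _ => by ring

end RicciScalar

/-! ### The Ricci scalar of D(α) in closed form. -/

section RicciScalar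

open Filter Topology

variable {U : Set Coord} {g : Coord → Matrix (Fin 4) (Fin 4) ℝ} {A : Coord → Coord} {α : ℝ}
  {x : Coord}

/-- Metric compatibility contracted with two copies of y. Geometrically, ‖y‖ is constant along
Levi-Civita horizontal directions, which is how it is used in `div_fieldB`. -/
theorem sum_linForm_christoffel_mul_lower (h : CoordMetric U g) (hx : x ∈ U) (y : Coord)
    (i : Fin 4) :
    ∑ l, linForm (christoffel g x l i) y * linForm (g x l) y
      = 1 / 2 * quadForm (fun a b => pd i (fun z => g z a b) x) y := by
  simp only [h.pd_eq_christoffel hx, quadForm, linForm, Finset.sum_add_distrib, add_mul]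
  have e1 : ∑ l, (∑ k, christoffel g x l i k * y k) * (∑ j, g x l j * y j)
      = ∑ j, ∑ k, (∑ a, g x j a * christoffel g x a i k) * y j * y k := by
    simp only [Finset.sum_mul, Finset.mul_sum]
    simp only [← Fintype.sum_prod_type']
    refine Finset.sum_bij' (fun p _ => (p.2.1, p.2.2, p.1)) (fun p _ => (p.2.2, p.1, p.2.1))
      (by simp) (by simp) (by simp) (by simp) ?_
    rintro ⟨l, j, k⟩ -
    simp only
    rw [h.symm x hx j l]
    ring
  have e2 : ∑ j, ∑ k, (∑ a, g x k a * christoffel g x a i j) * y j * y k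
      = ∑ j, ∑ k, (∑ a, g x j a * christoffel g x a i k) * y j * y k := by
    rw [Finset.sum_comm]
    exact Finset.sum_congr rfl fun j _ => Finset.sum_congr rfl fun k _ => by ring
  rw [e1, e2]
  ring

/-- The terms on the right are the parts of `sum_tidal_eq` that do not involve B. A quadratic form
does not see the order of the two indices, so the terms of `CoordMetric.ricci_eq` match after
relabelling. -/
theorem quadForm_ricci (h : CoordMetric U g) (hx : x ∈ U) (y : Coord) :
    -quadForm (ricci g x) y
      = quadForm (fun k m => pd k (fun z => ∑ i, christoffel g z i i m) x) y
        - ∑ l, quadForm (christoffel g x l) y * ∑ i, christoffel g x i i l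
        - ∑ i, quadForm (fun j k => pd i (fun z => christoffel g z i j k) x) y
        + ∑ i, ∑ l, linForm (christoffel g x l i) y * linForm (christoffel g x i l) y := by
  have e1 : ∑ i, ∑ l, linForm (christoffel g x l i) y * linForm (christoffel g x i l) y
      = quadForm (fun j l => ∑ i, ∑ m, christoffel g x m i j * christoffel g x i l m) y := by
    simp only [quadForm, linForm, Finset.sum_mul, Finset.mul_sum]
    simp only [← Fintype.sum_prod_type']
    refine Finset.sum_bij' (fun p _ => (p.2.2.2, p.2.2.1, p.1, p.2.1))
      (fun p _ => (p.2.2.1, p.2.2.2, p.2.1, p.1)) (by simp) (by simp) (by simp) (by simp) ?_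
    rintro ⟨i, l, j, k⟩ -
    simp only
    rw [h.christoffel_symm hx i l j]
    ring
  have e2 : ∑ l, quadForm (christoffel g x l) y * ∑ i, christoffel g x i i l
      = quadForm (fun j l => ∑ m, christoffel g x m j l * ∑ i, christoffel g x i i m) y := by
    simp only [quadForm, Finset.sum_mul]
    rw [Finset.sum_comm]
    refine Finset.sum_congr rfl fun a _ => ?_
    rw [Finset.sum_comm]
    exact Finset.sum_congr rfl fun b _ => Finset.sum_congr rfl fun c _ => by ring
  have e3 : ∑ i, quadForm (fun j k => pd i (fun z => christoffel g z i j k) x) y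
      = quadForm (fun j l => ∑ i, pd i (fun z => christoffel g z i j l) x) y := by
    simp only [quadForm, Finset.sum_mul]
    rw [Finset.sum_comm]
    refine Finset.sum_congr rfl fun a _ => ?_
    rw [Finset.sum_comm]
  have e4 : quadForm (fun k m => pd k (fun z => ∑ i, christoffel g z i i m) x) y
      = quadForm (fun j l => pd l (fun z => ∑ i, christoffel g z i i j) x) y := by
    unfold quadForm
    rw [Finset.sum_comm]
    exact Finset.sum_congr rfl fun a _ => Finset.sum_congr rfl fun b _ => by ring
  rw [e1, e2, e3, e4]
  simp only [quadForm, h.ricci_eq hx, ← Finset.sum_neg_distrib, ← Finset.sum_sub_distrib,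
    ← Finset.sum_add_distrib]
  exact Finset.sum_congr rfl fun a _ => Finset.sum_congr rfl fun b _ => by ring

theorem differentiableAt_fieldB_base (h : CoordMetric U g)
    (hA : ∀ i, ContDiffOn ℝ ∞ (fun x => A x i) U) (hx : x ∈ U) {y : Coord}
    (hy : sqNorm g x y ≠ 0) (i : Fin 4) : DifferentiableAt ℝ (fun z => fieldB g A α z y i) x := by
  simp only [fieldB_eq]
  exact ((differentiableAt_norm_base h hx hy).fun_mul (differentiableAt_linForm_base fun a =>
    differentiableAt_faradayMixed h hA hx i a).ofReal_comp).const_mul _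

theorem pd_fieldB_base (h : CoordMetric U g)
    (hA : ∀ i, ContDiffOn ℝ ∞ (fun x => A x i) U) (hx : x ∈ U) {y : Coord}
    (hy : sqNorm g x y ≠ 0) (k i : Fin 4) :
    pd k (fun z => fieldB g A α z y i) x = -((α : ℂ) / 2) *
      ((quadForm (fun a b => pd k (fun z => g z a b) x) y : ℂ) / (2 * norm g x y)
          * (linForm (faradayMixed g A x i) y : ℂ)
        + norm g x y * (linForm (fun a => pd k (fun z => faradayMixed g A z i a) x) y : ℂ)) := by
  have hF := fun a => differentiableAt_faradayMixed h hA hx i a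
  have hl := differentiableAt_linForm_base (y := y) hF
  have hn := differentiableAt_norm_base h hx hy
  have e : pd k (fun z => norm g z y) x
      = (pd k (fun z => sqNorm g z y) x : ℝ) / (2 * norm g x y) :=
    pd_root (differentiableAt_sqNorm_base h hx y) hy k
  simp only [fieldB_eq]
  rw [pd_const_mul (hn.fun_mul hl.ofReal_comp), pd_mul hn hl.ofReal_comp, e, pd_sqNorm_base h hx,
    pd_ofReal hl, pd_linForm_base hF]
  ring

/-- The divergence of `B` is `-(α/2) ‖y‖` times a linear form. -/
theorem div_fieldB (h : CoordMetric U g) (hA : ∀ i, ContDiffOn ℝ ∞ (fun x => A x i) U)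
    (hx : x ∈ U) {y : Coord} (hy : sqNorm g x y ≠ 0) :
    ∑ l, fieldB g A α x y l * ((∑ i, christoffel g x i i l : ℝ) : ℂ)
        + ∑ i, pd i (fun z => fieldB g A α z y i) x
        - ∑ i, ∑ l, (linForm (christoffel g x l i) y : ℂ) * fieldB1 g A α x y i l
      = -((α : ℂ) / 2) * (norm g x y * (linForm (faradayDiv g A x) y : ℂ)) := by
  have hn0 : norm g x y ≠ 0 := norm_ne_zero hy
  have e1 : linForm (faradayDiv g A x) y
      = ∑ i, linForm (fun a => pd i (fun z => faradayMixed g A z i a) x) y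
        + ∑ l, linForm (faradayMixed g A x l) y * ∑ i, christoffel g x i i l
        - ∑ i, ∑ l, linForm (christoffel g x l i) y * faradayMixed g A x i l := by
    simp only [linForm, faradayDiv, add_mul, sub_mul, Finset.sum_add_distrib,
      Finset.sum_sub_distrib]
    congr 1
    · congr 1
      · simp only [Finset.sum_mul]
        exact Finset.sum_comm
      · rw [Finset.sum_congr rfl fun k _ => Finset.sum_mul _ _ (y k), Finset.sum_comm]
        refine Finset.sum_congr rfl fun l _ => ?_
        rw [Finset.sum_mul]
        exact Finset.sum_congr rfl fun k _ => by ring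
    · simp only [Finset.sum_mul]
      rw [Finset.sum_comm]
      refine Finset.sum_congr rfl fun i _ => ?_
      rw [Finset.sum_comm]
      exact Finset.sum_congr rfl fun l _ => Finset.sum_congr rfl fun k _ => by ring
  have e2 : ∑ i, ∑ l, (linForm (christoffel g x l i) y : ℂ) * fieldB1 g A α x y i l
      = -((α : ℂ) / 2) * (∑ i, ((quadForm (fun a b => pd i (fun z => g z a b) x) y : ℂ)
          / (2 * norm g x y) * (linForm (faradayMixed g A x i) y : ℂ))
        + norm g x y * ((∑ i, ∑ l, linForm (christoffel g x l i) y * faradayMixed g A x i l : ℝ) : ℂ)) := by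
    rw [Complex.ofReal_sum, Finset.mul_sum, ← Finset.sum_add_distrib, Finset.mul_sum]
    refine Finset.sum_congr rfl fun i _ => ?_
    -- The part of Bⁱ_l with y_l, contracted with the Christoffel symbols, reproduces the
    -- x-derivative of ‖y‖ in ∂_i Bⁱ; the two cancel, and only the divergence of F survives.
    have k1 : (quadForm (fun a b => pd i (fun z => g z a b) x) y : ℂ)
        = 2 * ((∑ l, linForm (christoffel g x l i) y * linForm (g x l) y : ℝ) : ℂ) := by
      rw [sum_linForm_christoffel_mul_lower h hx]; push_cast; ring
    rw [k1, Complex.ofReal_sum, Complex.ofReal_sum, Finset.mul_sum, Finset.mul_sum, Finset.sum_div,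
      Finset.sum_mul, ← Finset.sum_add_distrib, Finset.mul_sum]
    refine Finset.sum_congr rfl fun l _ => ?_
    rw [fieldB1_eq (h.symm x hx) hy]
    push_cast
    field_simp
  rw [e2, e1]
  simp only [pd_fieldB_base h hA hx hy]
  simp only [fieldB_eq]
  push_cast
  simp only [← Finset.mul_sum, Finset.sum_add_distrib, mul_assoc]
  ring

/-- Insert N = γ·y + Bⁱ_j: the terms without B give the Ricci tensor, those linear in B combine to
-2 times the left side of `div_fieldB`, and the quadratic ones are Bⁱ_h B^h_i. -/
theorem sum_tidal_eq_quadForm (h : CoordMetric U g)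
    (hA : ∀ i, ContDiffOn ℝ ∞ (fun x => A x i) U) (hx : x ∈ U) {y : Coord}
    (hy : sqNorm g x y ≠ 0) :
    ∑ i, tidal g A α x y i i
      = (quadForm (fun a b => -ricci g x a b + traceBBCoeff g A α x a b) y : ℂ)
        + α * (norm g x y * (linForm (faradayDiv g A x) y : ℂ)) := by
  have hdiv := div_fieldB (α := α) h hA hx hy
  have hric := congrArg (fun r : ℝ => (r : ℂ)) (quadForm_ricci h hx y)
  have htr := traceBB_eq (A := A) (α := α) (h.symm x hx) (h.det_ne x hx) hy
  have e1 : ∀ i, pd i (fun z => spray g A α z y i) x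
      = 1 / 2 * (quadForm (fun j k => pd i (fun z => christoffel g z i j k) x) y : ℂ)
        + pd i (fun z => fieldB g A α z y i) x := by
    intro i
    have hc := fun a b => h.differentiableAt_christoffel hx i a b
    have hq := differentiableAt_quadForm_base (y := y) hc
    simp only [spray_eq]
    rw [pd_add (hq.ofReal_comp.const_mul _) (differentiableAt_fieldB_base h hA hx hy i),
      pd_const_mul hq.ofReal_comp, pd_ofReal hq, pd_quadForm_base hc]
  have e2 : ∑ i, ∑ l, connN g A α x y l i * connN g A α x y i l
      = ((∑ i, ∑ l, linForm (christoffel g x l i) y * linForm (christoffel g x i l) y : ℝ) : ℂ)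
        + 2 * (∑ i, ∑ l, (linForm (christoffel g x l i) y : ℂ) * fieldB1 g A α x y i l)
        + traceBB g A α x y := by
    have c1 : ∑ i, ∑ l, fieldB1 g A α x y l i * (linForm (christoffel g x i l) y : ℂ)
        = ∑ i, ∑ l, (linForm (christoffel g x l i) y : ℂ) * fieldB1 g A α x y i l := by
      rw [Finset.sum_comm]
      exact Finset.sum_congr rfl fun i _ => Finset.sum_congr rfl fun l _ => mul_comm _ _
    rw [two_mul]
    nth_rewrite 2 [← c1]
    unfold traceBB
    push_cast
    simp only [connN_eq h hx hy, ← Finset.sum_add_distrib]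
    exact Finset.sum_congr rfl fun i _ => Finset.sum_congr rfl fun l _ => by ring
  have e3 : quadForm (fun a b => -ricci g x a b + traceBBCoeff g A α x a b) y
      = -quadForm (ricci g x) y + quadForm (traceBBCoeff g A α x) y := by
    simp only [quadForm, ← Finset.sum_neg_distrib, ← Finset.sum_add_distrib]
    exact Finset.sum_congr rfl fun i _ => Finset.sum_congr rfl fun l _ => by ring
  rw [sum_tidal_eq h hA hx hy, e2, htr, e3]
  simp only [e1]
  simp only [spray_eq, add_mul, Finset.sum_add_distrib, mul_add]
  push_cast at hric hdiv ⊢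
  rw [hric]
  simp only [mul_assoc, ← Finset.mul_sum] at hdiv ⊢
  linear_combination (-2) * hdiv

/-- The dimension enters through g^jl g_jl = 4: the coefficient is -(α²/4)(2 + 4). Up to sign this
is the coefficient of F² in the reduced action, and it agrees with the one in 𝒢. -/
theorem trace_ricciHessian (hs : ∀ i j, g x i j = g x j i) (hd : (g x).det ≠ 0) :
    ∑ j, ∑ l, (g x)⁻¹ j l * traceBBCoeff g A α x j l = -(3 * α ^ 2 / 2) * faradaySq g A x := by
  have h4 : ∑ j, ∑ l, (g x)⁻¹ j l * g x j l = 4 := by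
    have : ∀ j, ∑ l, (g x)⁻¹ j l * g x j l = 1 := by
      intro j
      have := inv_mul_cancel_apply hd j j
      rw [if_pos rfl] at this
      rw [← this]
      exact Finset.sum_congr rfl fun l _ => by rw [hs j l]
    simp [this]
  have hf : ∑ j, ∑ l, (g x)⁻¹ j l * faradayContract g A x j l = faradaySq g A x := by
    rw [faradaySq_eq]
    simp only [faradayContract_apply]
  have : ∑ j, ∑ l, (g x)⁻¹ j l * traceBBCoeff g A α x j l
      = -(α ^ 2 / 4) * (2 * (∑ j, ∑ l, (g x)⁻¹ j l * faradayContract g A x j l)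
        + faradaySq g A x * ∑ j, ∑ l, (g x)⁻¹ j l * g x j l) := by
    unfold traceBBCoeff
    simp only [Finset.mul_sum, ← Finset.sum_add_distrib]
    exact Finset.sum_congr rfl fun i _ => Finset.sum_congr rfl fun l _ => by ring
  rw [this, h4, hf]
  ring

/-- The Hessian of `‖y‖ c_k yᵏ`. -/
theorem pd_pd_norm_mul_linForm (hs : ∀ i j, g x i j = g x j i) (c : Fin 4 → ℝ) {y : Coord}
    (hy : sqNorm g x y ≠ 0) (j l : Fin 4) :
    pd l (fun w => pd j (fun w' => norm g x w' * (linForm c w' : ℂ)) w) y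
      = ((g x j l : ℂ) * (linForm c y : ℂ)
          + (linForm (g x j) y : ℂ) * c l + (linForm (g x l) y : ℂ) * c j) / norm g x y
        - (linForm (g x j) y : ℂ) * (linForm (g x l) y : ℂ) * (linForm c y : ℂ)
            / norm g x y ^ 3 := by
  have hL : ∀ (c : Fin 4 → ℝ) w, DifferentiableAt ℝ (fun w => (linForm c w : ℂ)) w := fun c w =>
    (differentiable_linForm c w).ofReal_comp
  have e1 : ∀ w ∈ {w | sqNorm g x w ≠ 0},
      pd j (fun w' => norm g x w' * (linForm c w' : ℂ)) w
        = norm g x w * (c j : ℂ) + (linForm (g x j) w : ℂ) * (norm g x w)⁻¹ * (linForm c w : ℂ) := by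
    intro w hw
    rw [pd_mul (differentiableAt_norm hw) (hL c w), pd_norm hs hw,
      pd_ofReal (differentiable_linForm c w), pd_linForm]
    ring
  have hn := differentiableAt_norm hy
  have hn0 : norm g x y ≠ 0 := norm_ne_zero hy
  have hinv : pd l (fun w => (norm g x w)⁻¹) y
      = -((linForm (g x l) y : ℂ) / norm g x y) / norm g x y ^ 2 := by
    have h1 : pd l (fun w => norm g x w * (norm g x w)⁻¹) y = 0 := by
      rw [pd_congr_of_mem (isOpen_nonnull g x) hy (fun w hw => mul_inv_cancel₀ (norm_ne_zero hw)),
        pd_const]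
    rw [pd_mul hn (hn.fun_inv hn0), pd_norm hs hy] at h1
    field_simp at h1 ⊢
    linear_combination h1
  rw [pd_congr_of_mem (isOpen_nonnull g x) hy e1, pd_add (hn.mul_const _)
    (((hL _ y).fun_mul (hn.fun_inv hn0)).fun_mul (hL c y)), pd_mul_const hn, pd_norm hs hy,
    pd_mul ((hL _ y).fun_mul (hn.fun_inv hn0)) (hL c y), pd_mul (hL _ y) (hn.fun_inv hn0), hinv,
    pd_ofReal (differentiable_linForm c y), pd_linForm, pd_ofReal (differentiable_linForm _ y),
    pd_linForm]
  field_simp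
  ring

/-- The Ricci scalar of `D(α)` off the null cone. -/
theorem ricciScalarD_eq (h : CoordMetric U g) (hA : ∀ i, ContDiffOn ℝ ∞ (fun x => A x i) U)
    (hx : x ∈ U) {y : Coord} (hy : sqNorm g x y ≠ 0) :
    ricciScalarD g A α x y = (lagrangian (3 * α ^ 2 / 2) g A x : ℂ)
      - 5 * α / 2 * ((linForm (faradayDiv g A x) y : ℂ) / norm g x y) := by
  have hs := h.symm x hx
  have hd := h.det_ne x hx
  have hn0 : norm g x y ≠ 0 := norm_ne_zero hy
  set C := faradayDiv g A x with hC
  set t : Fin 4 → Fin 4 → ℝ := fun a b => -ricci g x a b + traceBBCoeff g A α x a b with ht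
  have hts : ∀ a b, t a b = t b a := fun a b => by
    simp only [ht]; rw [h.ricci_symm hx, traceBBCoeff_symm hs]
  have hric : ∀ j l, ricciD g A α x y j l = -(t j l : ℂ) - α / 2 *
      pd l (fun w => pd j (fun w' => norm g x w' * (linForm C w' : ℂ)) w) y := by
    intro j l
    unfold ricciD
    have hq : ∀ w, DifferentiableAt ℝ (fun w => (quadForm t w : ℂ)) w := fun w =>
      (differentiable_quadForm t w).ofReal_comp
    have hnl : ∀ w ∈ {w | sqNorm g x w ≠ 0},
        DifferentiableAt ℝ (fun w' => norm g x w' * (linForm C w' : ℂ)) w := fun w hw =>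
      (differentiableAt_norm hw).fun_mul (differentiable_linForm C w).ofReal_comp
    have e1 : ∀ w ∈ {w | sqNorm g x w ≠ 0}, pd j (fun w' => ∑ i, tidal g A α x w' i i) w
        = pd j (fun w' => (quadForm t w' : ℂ)) w
          + α * pd j (fun w' => norm g x w' * (linForm C w' : ℂ)) w := by
      intro w hw
      rw [pd_congr_of_mem (isOpen_nonnull g x) hw (fun w' hw' => sum_tidal_eq_quadForm h hA hx hw'),
        pd_add (hq w) ((hnl w hw).const_mul _), pd_const_mul (hnl w hw)]
    have d1 : DifferentiableAt ℝ (fun w => pd j (fun w' => (quadForm t w' : ℂ)) w) y := by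
      have : (fun w => pd j (fun w' => (quadForm t w' : ℂ)) w)
          = fun w => (linForm (fun a => t j a + t a j) w : ℂ) := by
        funext w
        rw [pd_ofReal (differentiable_quadForm t w), pd_quadForm]
      rw [this]
      exact (differentiable_linForm _ y).ofReal_comp
    have d2 : DifferentiableAt ℝ
        (fun w => pd j (fun w' => norm g x w' * (linForm C w' : ℂ)) w) y := by
      have e : (fun w => pd j (fun w' => norm g x w' * (linForm C w' : ℂ)) w) =ᶠ[𝓝 y]
          fun w => norm g x w * (C j : ℂ)
            + (linForm (g x j) w : ℂ) / norm g x w * (linForm C w : ℂ) := by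
        refine eventually_of_mem ((isOpen_nonnull g x).mem_nhds hy) fun w hw => ?_
        refine (pd_mul (differentiableAt_norm hw) (differentiable_linForm C w).ofReal_comp j).trans ?_
        rw [pd_norm hs hw, pd_ofReal (differentiable_linForm C w), pd_linForm]
      refine DifferentiableAt.congr_of_eventuallyEq ?_ e
      have hn := differentiableAt_norm hy
      exact (hn.mul_const _).fun_add (((differentiable_linForm _ y).ofReal_comp.fun_mul
        (hn.fun_inv hn0)).fun_mul (differentiable_linForm C y).ofReal_comp)
    rw [pd_congr_of_mem (isOpen_nonnull g x) hy e1, pd_add d1 (d2.const_mul _), pd_const_mul d2,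
      pd_pd_ofReal_quadForm, hts l j]
    push_cast
    ring
  unfold ricciScalarD
  simp only [hric, pd_pd_norm_mul_linForm hs C hy]
  -- the contractions
  have k1 : ∑ j, ∑ l, (g x)⁻¹ j l * t j l = -lagrangian (3 * α ^ 2 / 2) g A x := by
    have := trace_ricciHessian (A := A) (α := α) hs hd
    unfold lagrangian ricciScalar
    simp only [ht, mul_add, Finset.sum_add_distrib, mul_neg, Finset.sum_neg_distrib]
    rw [this]
    ring
  have k2 : ∑ j, ∑ l, (g x)⁻¹ j l * g x j l = 4 := by
    have : ∀ j, ∑ l, (g x)⁻¹ j l * g x j l = 1 := by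
      intro j
      have := inv_mul_cancel_apply hd j j
      rw [if_pos rfl] at this
      rw [← this]
      exact Finset.sum_congr rfl fun l _ => by rw [hs j l]
    simp [this]
  have raise : ∀ l, ∑ j, (g x)⁻¹ l j * linForm (g x j) y = y l := by
    intro l
    simp only [linForm, Finset.mul_sum]
    rw [Finset.sum_comm]
    simp only [← mul_assoc, ← Finset.sum_mul, inv_mul_cancel_apply hd]
    simp
  have k3 : ∑ j, ∑ l, (g x)⁻¹ j l * (linForm (g x l) y * C j) = linForm C y := by
    change _ = ∑ j, C j * y j
    refine Finset.sum_congr rfl fun j _ => ?_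
    simp only [← mul_assoc, ← Finset.sum_mul]
    rw [raise j, mul_comm]
  have k4 : ∑ j, ∑ l, (g x)⁻¹ j l * (linForm (g x j) y * C l) = linForm C y := by
    rw [← k3, Finset.sum_comm]
    exact Finset.sum_congr rfl fun j _ => Finset.sum_congr rfl fun l _ => by
      rw [inv_symm_apply hs]
  have k5 : ∑ j, ∑ l, (g x)⁻¹ j l * (linForm (g x j) y * linForm (g x l) y) = sqNorm g x y := by
    rw [sqNorm_eq_sum_linForm]
    refine Finset.sum_congr rfl fun j _ => ?_
    have := raise j
    calc _ = (∑ l, (g x)⁻¹ j l * linForm (g x l) y) * linForm (g x j) y := by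
          rw [Finset.sum_mul]; exact Finset.sum_congr rfl fun l _ => by ring
      _ = _ := by rw [this]
  have e : ∀ j l, ((g x)⁻¹ j l : ℂ) * (-(t j l : ℂ) - α / 2 *
          (((g x j l : ℂ) * (linForm C y : ℂ)
          + (linForm (g x j) y : ℂ) * C l + (linForm (g x l) y : ℂ) * C j) / norm g x y
        - (linForm (g x j) y : ℂ) * (linForm (g x l) y : ℂ) * (linForm C y : ℂ)
            / norm g x y ^ 3))
      = -(((g x)⁻¹ j l * t j l : ℝ) : ℂ)
        - α / 2 * (linForm C y / norm g x y) * (((g x)⁻¹ j l * g x j l : ℝ) : ℂ)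
        - α / 2 * (1 / norm g x y) * (((g x)⁻¹ j l * (linForm (g x j) y * C l) : ℝ) : ℂ)
        - α / 2 * (1 / norm g x y) * (((g x)⁻¹ j l * (linForm (g x l) y * C j) : ℝ) : ℂ)
        + α / 2 * (linForm C y / norm g x y ^ 3)
          * (((g x)⁻¹ j l * (linForm (g x j) y * linForm (g x l) y) : ℝ) : ℂ) := by
    intro j l
    push_cast
    ring
  simp only [e]
  simp only [Finset.sum_add_distrib, Finset.sum_sub_distrib, Finset.sum_neg_distrib,
    ← Finset.mul_sum, ← Complex.ofReal_sum]
  -- The trace of the Hessian of ‖y‖ c_k yᵏ consists of 4 + 1 + 1 - 1 = 5 copies of c_k yᵏ / ‖y‖,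
  -- each with the factor -α/2.
  rw [k1, k2, k3, k4, k5, ← norm_sq]
  push_cast
  field_simp
  ring

end RicciScalar

/-! ### Integrals of inverse square roots along segments. -/

section FibreIntegral

open MeasureTheory Set

/-- A symmetric bilinear form of signature `(+,-,-,-)`. -/
structure IsLorentzian (B : LinearMap.BilinForm ℝ Coord) : Prop where
  symm : ∀ v w, B v w = B w v
  exists_timelike : ∃ t, 0 < B t t ∧ ∀ w, w ≠ 0 → B t w = 0 → B w w < 0

theorem IsLorentzian.exists_unit {B : LinearMap.BilinForm ℝ Coord} (hB : IsLorentzian B) :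
    ∃ t, B t t = 1 ∧ ∀ w, w ≠ 0 → B t w = 0 → B w w < 0 := by
  obtain ⟨t, ht, h⟩ := hB.exists_timelike
  have hs : Real.sqrt (B t t) ≠ 0 := (Real.sqrt_pos.2 ht).ne'
  refine ⟨(Real.sqrt (B t t))⁻¹ • t, ?_, fun w hw hw' => h w hw ?_⟩
  · have := Real.mul_self_sqrt ht.le
    simp only [map_smul, LinearMap.smul_apply, smul_eq_mul]
    field_simp
    nlinarith
  · simpa [hs] using hw'

theorem continuous_bilinForm_self (B : LinearMap.BilinForm ℝ Coord) :
    Continuous fun y => B y y := by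
  have h : (fun y : Coord => B y y) = fun y => ∑ i, y i * B (Pi.single i 1) y := by
    funext y
    have hy : y = ∑ i, y i • (Pi.single i 1 : Coord) := pi_eq_sum_univ' y
    conv_lhs => rw [show B y = B (∑ i, y i • (Pi.single i 1 : Coord)) by rw [← hy]]
    simp
  rw [h]
  exact continuous_finsetSum _ fun i _ => (continuous_apply i).mul
    (LinearMap.continuous_of_finiteDimensional _)

/-- A continuous function which is homogeneous of degree two and positive off the origin dominates
the square of the norm. -/
theorem exists_mul_sq_norm_le {f : Coord → ℝ} (hf : Continuous f)
    (hh : ∀ (r : ℝ) y, f (r • y) = r ^ 2 * f y) (hp : ∀ y, y ≠ 0 → 0 < f y) :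
    ∃ c > 0, ∀ y, c * ‖y‖ ^ 2 ≤ f y := by
  obtain ⟨z, hz, hmin⟩ := (isCompact_sphere (0 : Coord) 1).exists_isMinOn
    (NormedSpace.sphere_nonempty.2 zero_le_one) hf.continuousOn
  have hz0 : z ≠ 0 := by rintro rfl; simp at hz
  refine ⟨f z, hp z hz0, fun y => ?_⟩
  rcases eq_or_ne y 0 with rfl | hy
  · have := hh 0 0; simp at this; simp [this]
  · have hn : ‖y‖ ≠ 0 := norm_ne_zero_iff.2 hy
    have h1 : f z ≤ f (‖y‖⁻¹ • y) := hmin (by simp [norm_smul, hn])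
    rw [hh] at h1
    have h2 : 0 < ‖y‖ ^ 2 := by positivity
    calc f z * ‖y‖ ^ 2 ≤ (‖y‖⁻¹ ^ 2 * f y) * ‖y‖ ^ 2 := by gcongr
      _ = f y := by field_simp

/-- `|z|^{-1/2}`, with the value `∞` at `0`. -/
noncomputable def invSqrt (z : ℝ) : ENNReal := (ENNReal.ofReal (Real.sqrt |z|))⁻¹

theorem measurable_invSqrt : Measurable invSqrt := by
  unfold invSqrt; fun_prop

theorem lintegral_invSqrt_Icc_lt_top : ∫⁻ z in Icc (-1 : ℝ) 1, invSqrt z < ⊤ := by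
  have h1 : IntegrableOn (fun z : ℝ => |z| ^ (-(1 / 2) : ℝ)) (Icc (-1) 1) := by
    have h0 : IntervalIntegrable (fun z : ℝ => |z| ^ (-(1 / 2) : ℝ)) volume 0 1 := by
      refine (intervalIntegral.intervalIntegrable_rpow' (r := -(1 / 2)) (by norm_num)).congr ?_
      intro z hz
      rw [uIoc_of_le zero_le_one] at hz
      simp only [abs_of_pos hz.1]
    have h0' : IntervalIntegrable (fun z : ℝ => |z| ^ (-(1 / 2) : ℝ)) volume (-1) 0 := by
      have := h0.comp_sub_left 0
      simpa using this.symm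
    rw [integrableOn_Icc_iff_integrableOn_Ioc]
    exact (intervalIntegrable_iff_integrableOn_Ioc_of_le (by norm_num)).1 (h0'.trans h0)
  refine lt_of_le_of_lt (le_of_eq ?_) h1.hasFiniteIntegral
  refine lintegral_congr_ae (ae_restrict_of_ae ?_)
  filter_upwards [compl_mem_ae_iff.2 (measure_singleton (0 : ℝ))] with z hz
  have hz' : 0 < |z| := abs_pos.2 hz
  have hp : 0 < Real.sqrt |z| := Real.sqrt_pos.2 hz'
  rw [Real.enorm_eq_ofReal (by positivity), invSqrt, Real.rpow_neg hz'.le,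
    ← Real.sqrt_eq_rpow, ENNReal.ofReal_inv_of_pos hp]

theorem invSqrt_le_of_one_le {z : ℝ} (hz : 1 ≤ |z|) : invSqrt z ≤ 1 := by
  rw [invSqrt, ENNReal.inv_le_one, ENNReal.one_le_ofReal]
  exact Real.one_le_sqrt.2 hz

/-- Cut the function at |z| = 1: the inner part has finite integral over the line, which is
translation invariant, and the outer part is at most 1 on an interval of length 1. The uniformity in
q is what the integration over lines in the fibre requires. -/
theorem exists_lintegral_invSqrt_add_le :
    ∃ C : ENNReal, C ≠ ⊤ ∧ ∀ q : ℝ, ∫⁻ τ in Icc (0 : ℝ) 1, invSqrt (τ + q) ≤ C := by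
  refine ⟨(∫⁻ z in Icc (-1 : ℝ) 1, invSqrt z) + 1,
    ENNReal.add_ne_top.2 ⟨lintegral_invSqrt_Icc_lt_top.ne, ENNReal.one_ne_top⟩, fun q => ?_⟩
  have h : ∀ z, invSqrt z ≤ (Icc (-1 : ℝ) 1).indicator invSqrt z + 1 := by
    intro z
    by_cases hz : z ∈ Icc (-1 : ℝ) 1
    · rw [indicator_of_mem hz]; exact le_self_add
    · rw [indicator_of_notMem hz, zero_add]
      refine invSqrt_le_of_one_le ?_
      by_contra hlt
      exact hz (abs_le.1 (not_le.1 hlt).le)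
  calc ∫⁻ τ in Icc (0 : ℝ) 1, invSqrt (τ + q)
      ≤ ∫⁻ τ in Icc (0 : ℝ) 1, ((Icc (-1 : ℝ) 1).indicator invSqrt (τ + q) + 1) :=
        lintegral_mono fun τ => h _
    _ = (∫⁻ τ in Icc (0 : ℝ) 1, (Icc (-1 : ℝ) 1).indicator invSqrt (τ + q)) + 1 := by
        rw [lintegral_add_right _ measurable_const]; simp
    _ ≤ (∫⁻ τ, (Icc (-1 : ℝ) 1).indicator invSqrt (τ + q)) + 1 := by
        gcongr; exact Measure.restrict_le_self
    _ = (∫⁻ z in Icc (-1 : ℝ) 1, invSqrt z) + 1 := by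
        rw [lintegral_add_right_eq_self (fun z => (Icc (-1 : ℝ) 1).indicator invSqrt z) q,
          lintegral_indicator measurableSet_Icc]

/-- Functions which are integrable, uniformly, along all segments in a given direction are
integrable over bounded sets. -/
theorem setLIntegral_lt_top_of_segments {K : Coord → ENNReal} (hK : Measurable K) (t : Coord)
    {C : ENNReal} (hC : C ≠ ⊤) (h : ∀ y, ∫⁻ τ in Icc (0 : ℝ) 1, K (y + τ • t) ≤ C)
    {S : Set Coord} (hS : MeasurableSet S) (hb : Bornology.IsBounded S) :
    ∫⁻ y in S, K y < ⊤ := by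
  obtain ⟨R, hR⟩ := hb.subset_closedBall 0
  -- The translates of S by -τ t all lie in one fixed ball. Averaging the integral over τ therefore
  -- turns it, by Tonelli, into integrals over segments in the direction t.
  have hsub : ∀ τ ∈ Icc (0 : ℝ) 1, ∫⁻ y in S, K y ≤
      ∫⁻ y in Metric.closedBall (0 : Coord) (R + ‖t‖), K (y + τ • t) := by
    intro τ hτ
    rw [← lintegral_indicator hS, ← lintegral_add_right_eq_self _ (τ • t),
      ← lintegral_indicator Metric.isClosed_closedBall.measurableSet]
    refine lintegral_mono fun y => ?_
    by_cases hy : y + τ • t ∈ S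
    · rw [indicator_of_mem hy, indicator_of_mem]
      have h1 := hR hy
      simp only [mem_closedBall_zero_iff] at h1 ⊢
      have h2 : ‖τ • t‖ ≤ ‖t‖ := by
        rw [norm_smul, Real.norm_eq_abs, abs_of_nonneg hτ.1]
        exact mul_le_of_le_one_left (norm_nonneg _) hτ.2
      calc ‖y‖ = ‖(y + τ • t) - τ • t‖ := by simp
        _ ≤ ‖y + τ • t‖ + ‖τ • t‖ := norm_sub_le _ _
        _ ≤ R + ‖t‖ := add_le_add h1 h2
    · rw [indicator_of_notMem hy]; exact zero_le
  have hm : Measurable fun p : ℝ × Coord => K (p.2 + p.1 • t) := by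
    refine hK.comp ?_
    fun_prop
  calc ∫⁻ y in S, K y = ∫⁻ τ in Icc (0 : ℝ) 1, ∫⁻ y in S, K y := by simp
    _ ≤ ∫⁻ τ in Icc (0 : ℝ) 1, ∫⁻ y in Metric.closedBall (0 : Coord) (R + ‖t‖), K (y + τ • t) :=
        setLIntegral_mono' measurableSet_Icc hsub
    _ = ∫⁻ y in Metric.closedBall (0 : Coord) (R + ‖t‖), ∫⁻ τ in Icc (0 : ℝ) 1, K (y + τ • t) :=
        lintegral_lintegral_swap hm.aemeasurable
    _ ≤ ∫⁻ y in Metric.closedBall (0 : Coord) (R + ‖t‖), C := lintegral_mono fun y => h y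
    _ < ⊤ := by
        rw [setLIntegral_const]
        exact ENNReal.mul_lt_top hC.lt_top Metric.isBounded_closedBall.measure_lt_top

end FibreIntegral

/-! ### Integrability of c_k yᵏ / ‖y‖ across the null cone. -/

section FibreIntegral

open MeasureTheory Set

/-- For a timelike unit vector `t`, the linear functional `s = B(t, ·)` and the norm `b` of the
component orthogonal to `t` satisfy `B(y, y) = s² - b²`, and `s² + b²` is positive definite. -/
theorem exists_splitting {B : LinearMap.BilinForm ℝ Coord} (hB : IsLorentzian B) :
    ∃ (t : Coord) (s b : Coord → ℝ), Continuous s ∧ Continuous b ∧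
      (∀ y, 0 ≤ b y) ∧ (∀ y, B y y = (s y - b y) * (s y + b y)) ∧
      (∀ y (τ : ℝ), s (y + τ • t) = s y + τ ∧ b (y + τ • t) = b y) ∧
      ∃ c > 0, ∀ y, c * ‖y‖ ^ 2 ≤ s y ^ 2 + b y ^ 2 := by
  obtain ⟨t, ht, hneg⟩ := hB.exists_unit
  have hw : ∀ y, B t (y - B t y • t) = 0 := fun y => by simp [ht]
  have hww : ∀ y, B (y - B t y • t) (y - B t y • t) = B y y - B t y ^ 2 := fun y => by
    have := hB.symm y t
    simp [ht, this]; ring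
  have hnn : ∀ y, 0 ≤ B t y ^ 2 - B y y := by
    intro y
    by_cases h0 : y - B t y • t = 0
    · have := hww y; rw [h0] at this; simp at this; linarith
    · have := hneg _ h0 (hw y); rw [hww] at this; linarith
  have hcs : Continuous fun y => B t y := LinearMap.continuous_of_finiteDimensional _
  refine ⟨t, fun y => B t y, fun y => Real.sqrt (B t y ^ 2 - B y y), hcs,
    ((hcs.pow 2).sub (continuous_bilinForm_self B)).sqrt, fun y => Real.sqrt_nonneg _,
    fun y => ?_, fun y τ => ⟨by simp [ht], ?_⟩, ?_⟩
  · have := Real.mul_self_sqrt (hnn y); linarith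
  · refine congrArg Real.sqrt ?_
    have := hB.symm y t
    simp [ht, this]; ring
  · refine exists_mul_sq_norm_le (f := fun y => B t y ^ 2 + Real.sqrt (B t y ^ 2 - B y y) ^ 2)
      ?_ ?_ ?_ 
    · exact (hcs.pow 2).add ((((hcs.pow 2).sub (continuous_bilinForm_self B)).sqrt).pow 2)
    · intro r y
      have h1 := Real.sq_sqrt (hnn y)
      have h2 := Real.sq_sqrt (hnn (r • y))
      simp only [h1, h2]; simp; ring
    · intro y hy
      simp only [Real.sq_sqrt (hnn y)]
      by_cases h0 : y - B t y • t = 0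
      · have h1 : B t y ≠ 0 := by
          intro h1; rw [h1] at h0; simp at h0; exact hy h0
        have := hnn y
        positivity
      · have := hneg _ h0 (hw y); rw [hww] at this
        nlinarith [sq_nonneg (B t y)]

/-- If |r| ≤ |p|, then |r| / √|p| ≤ √|p| ≤ √M, so one of the two singular factors is absorbed by the
numerator and only |q|^(-1/2) remains. This also tames the apex of the cone, where both factors
vanish. -/
theorem enorm_root_inv_le {p q M : ℝ} (hp : |p| ≤ M) (hq : |q| ≤ M) {r : ℝ} 
    (hr : |r| ≤ |p| ∨ |r| ≤ |q|) :
    ENNReal.ofReal |r| * (ENNReal.ofReal (Real.sqrt |p * q|))⁻¹ ≤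
      ENNReal.ofReal (Real.sqrt M) * (invSqrt p + invSqrt q) := by
  have key : ∀ {p q : ℝ}, |p| ≤ M → |r| ≤ |p| →
      ENNReal.ofReal |r| * (ENNReal.ofReal (Real.sqrt |p * q|))⁻¹ ≤
        ENNReal.ofReal (Real.sqrt M) * invSqrt q := by
    intro p q hp hr
    rcases eq_or_ne r 0 with rfl | hr0
    · simp
    have hp0 : 0 < |p| := (abs_pos.2 hr0).trans_le hr
    have hsp : 0 < Real.sqrt |p| := Real.sqrt_pos.2 hp0
    rw [abs_mul, Real.sqrt_mul (abs_nonneg _), ENNReal.ofReal_mul (Real.sqrt_nonneg _),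
      ENNReal.mul_inv (Or.inl (by simpa using hsp)) (Or.inl ENNReal.ofReal_ne_top), ← mul_assoc,
      ← ENNReal.ofReal_inv_of_pos hsp, ← ENNReal.ofReal_mul (abs_nonneg _), invSqrt]
    gcongr
    rw [← div_eq_mul_inv, div_le_iff₀ hsp, ← Real.sqrt_mul ((abs_nonneg _).trans hp)]
    calc |r| ≤ |p| := hr
      _ = Real.sqrt (|p| * |p|) := (Real.sqrt_mul_self (abs_nonneg _)).symm
      _ ≤ Real.sqrt (M * |p|) := by gcongr
  rcases hr with hr | hr
  · refine (key hp hr).trans ?_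
    gcongr; exact le_add_self
  · rw [mul_comm p q]
    refine (key hq hr).trans ?_
    gcongr; exact le_self_add

theorem measurable_root : Measurable root := by
  unfold root; fun_prop

/-- Write B(y, y) = (s - b)(s + b). Along t the function s moves with unit speed while b is
constant, so |s - b|^(-1/2) + |s + b|^(-1/2) has uniformly bounded integrals over segments. Since
this kernel is infinite on the null cone, finiteness of its integral shows that the cone is a null
set; and the kernel is, up to a constant, a majorant of the quotient. -/
theorem exists_kernel {B : LinearMap.BilinForm ℝ Coord} (hB : IsLorentzian B)
    {S : Set Coord} (hS : MeasurableSet S) (hb : Bornology.IsBounded S) :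
    (∀ᵐ y ∂(volume.restrict S), B y y ≠ 0) ∧
    ∀ c : Fin 4 → ℝ, IntegrableOn (fun y => (linForm c y : ℂ) / root (B y y)) S := by
  obtain ⟨t, s, b, hs, hbc, hb0, hQ, htr, κ, hκ, hle⟩ := exists_splitting hB
  obtain ⟨C, hC, hCq⟩ := exists_lintegral_invSqrt_add_le
  set K : Coord → ENNReal := fun y => invSqrt (s y - b y) + invSqrt (s y + b y) with hKdef
  have hK : Measurable K := (measurable_invSqrt.comp (hs.sub hbc).measurable).add
    (measurable_invSqrt.comp (hs.add hbc).measurable)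
  have hKfin : ∫⁻ y in S, K y < ⊤ := by
    refine setLIntegral_lt_top_of_segments hK t (C := C + C) (by simp [hC]) (fun y => ?_) hS hb
    have : ∀ τ : ℝ, K (y + τ • t) = invSqrt (τ + (s y - b y)) + invSqrt (τ + (s y + b y)) := by
      intro τ
      simp only [hKdef, (htr y τ).1, (htr y τ).2]
      congr 2 <;> ring
    simp only [this]
    rw [lintegral_add_left
      (show Measurable fun τ : ℝ => invSqrt (τ + (s y - b y)) from
        measurable_invSqrt.comp (measurable_id.add_const _))]
    exact add_le_add (hCq _) (hCq _)
  refine ⟨?_, fun c => ?_⟩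
  · filter_upwards [ae_lt_top hK hKfin.ne] with y hy h0
    rw [hQ, mul_eq_zero] at h0
    rcases h0 with h0 | h0 <;> simp [hKdef, h0, invSqrt] at hy
  · obtain ⟨R, hR⟩ := hb.subset_closedBall 0
    have hcl : Continuous (linForm c) := (differentiable_linForm c).continuous
    have hbd : Bornology.IsBounded (closure S) := hb.closure
    have hcomp : IsCompact (closure S) := Metric.isCompact_of_isClosed_isBounded isClosed_closure hbd
    obtain ⟨M, hM⟩ := hcomp.exists_bound_of_continuousOn
      (f := fun y => |s y| + b y) ((hs.abs.add hbc).continuousOn)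
    have hlin : ∃ D, 0 ≤ D ∧ ∀ y, |linForm c y| ≤ D * ‖y‖ := by
      refine ⟨∑ a, |c a|, Finset.sum_nonneg fun _ _ => abs_nonneg _, fun y => ?_⟩
      rw [Finset.sum_mul]
      refine (Finset.abs_sum_le_sum_abs _ _).trans (Finset.sum_le_sum fun a _ => ?_)
      rw [abs_mul]
      gcongr
      exact norm_le_pi_norm y a
    obtain ⟨D, hD0, hD⟩ := hlin
    refine ⟨((Complex.measurable_ofReal.comp hcl.measurable).div
      (measurable_root.comp (continuous_bilinForm_self B).measurable)).aestronglyMeasurable, ?_⟩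
    set E : ℝ := D / Real.sqrt κ with hE
    have hE0 : 0 ≤ E := by positivity
    -- Since s² + b² is positive definite, |s| + b dominates ‖y‖ and hence the numerator; as b ≥ 0,
    -- it equals the larger of |s - b| and |s + b|, as `enorm_root_inv_le` requires.
    have hlb : ∀ y, |linForm c y| ≤ E * (|s y| + b y) := by
      intro y
      have h1 : Real.sqrt κ * ‖y‖ ≤ |s y| + b y := by
        rw [← Real.sqrt_sq (norm_nonneg y), ← Real.sqrt_mul hκ.le]
        refine Real.sqrt_le_iff.2 ⟨by have := hb0 y; positivity, (hle y).trans ?_⟩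
        have := mul_nonneg (abs_nonneg (s y)) (hb0 y)
        nlinarith [sq_abs (s y)]
      have hsk : 0 < Real.sqrt κ := Real.sqrt_pos.2 hκ
      calc |linForm c y| ≤ D * ‖y‖ := hD y
        _ = E * (Real.sqrt κ * ‖y‖) := by rw [hE]; field_simp
        _ ≤ _ := by gcongr
    calc ∫⁻ y in S, ‖(linForm c y : ℂ) / root (B y y)‖ₑ
        ≤ ∫⁻ y in S, (ENNReal.ofReal E * ENNReal.ofReal (Real.sqrt M)) * K y := by
          refine setLIntegral_mono' hS fun y hy => ?_
          have hMy : |s y| + b y ≤ M := by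
            have := hM y (subset_closure hy)
            rwa [Real.norm_eq_abs, abs_of_nonneg (by have := hb0 y; positivity)] at this
          have hby := hb0 y
          have h1 : |s y - b y| ≤ |s y| + b y := by
            have := abs_sub (s y) (b y); rwa [abs_of_nonneg hby] at this
          have h2 : |s y + b y| ≤ |s y| + b y := by
            have := abs_add_le (s y) (b y); rwa [abs_of_nonneg hby] at this
          have h3 : |(|s y| + b y)| ≤ |s y - b y| ∨ |(|s y| + b y)| ≤ |s y + b y| := by
            rw [abs_of_nonneg (by positivity : 0 ≤ |s y| + b y)]
            rcases le_total 0 (s y) with h | h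
            · right; rw [abs_of_nonneg h]; exact le_abs_self _
            · left; rw [abs_of_nonpos h, abs_sub_comm]
              have := le_abs_self (b y - s y); linarith
          have h4 := enorm_root_inv_le (h1.trans hMy) (h2.trans hMy) h3
          have h5 : ‖(linForm c y : ℂ) / root (B y y)‖ₑ ≤
              ENNReal.ofReal |linForm c y| * (ENNReal.ofReal (Real.sqrt |B y y|))⁻¹ := by
            rw [div_eq_mul_inv, enorm_mul]
            refine mul_le_mul' (le_of_eq ?_) ?_
            · rw [← ofReal_norm, Complex.norm_real, Real.norm_eq_abs]
            · rw [← norm_root, ofReal_norm]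
              rcases eq_or_ne (root (B y y)) 0 with h | h
              · simp [h]
              · rw [enorm_inv h]
          refine h5.trans ?_
          rw [hQ, mul_assoc]
          calc _ ≤ ENNReal.ofReal (E * |(|s y| + b y)|) *
                (ENNReal.ofReal (Real.sqrt |(s y - b y) * (s y + b y)|))⁻¹ := by
                gcongr
                refine (hlb y).trans ?_
                gcongr; exact le_abs_self _
            _ = ENNReal.ofReal E * (ENNReal.ofReal |(|s y| + b y)| *
                (ENNReal.ofReal (Real.sqrt |(s y - b y) * (s y + b y)|))⁻¹) := by
                rw [ENNReal.ofReal_mul hE0, mul_assoc]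
            _ ≤ _ := by gcongr
      _ = (ENNReal.ofReal E * ENNReal.ofReal (Real.sqrt M)) * ∫⁻ y in S, K y :=
          lintegral_const_mul _ hK
      _ < ⊤ := ENNReal.mul_lt_top (by finiteness) hKfin

end FibreIntegral

/-! ### Integration over the fibre ball. -/

section FibreIntegral

open MeasureTheory Set

theorem continuous_quadForm (t : Fin 4 → Fin 4 → ℝ) : Continuous (quadForm t) :=
  (differentiable_quadForm t).continuous

theorem quadForm_eq_dotProduct (m : Matrix (Fin 4) (Fin 4) ℝ) (y : Coord) :
    quadForm m y = dotProduct y (m.mulVec y) := by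
  simp only [quadForm, dotProduct, Matrix.mulVec, Finset.mul_sum]
  exact Finset.sum_congr rfl fun a _ => Finset.sum_congr rfl fun b _ => by ring

theorem quadForm_neg (t : Matrix (Fin 4) (Fin 4) ℝ) (y : Coord) : quadForm t (-y) = quadForm t y := by
  simp [quadForm]

theorem linForm_neg (c : Fin 4 → ℝ) (y : Coord) : linForm c (-y) = -linForm c y := by
  simp [linForm]

theorem quadForm_smul (t : Fin 4 → Fin 4 → ℝ) (r : ℝ) (y : Coord) :
    quadForm t (r • y) = r ^ 2 * quadForm t y := by
  simp only [quadForm, Finset.mul_sum, Pi.smul_apply, smul_eq_mul]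
  exact Finset.sum_congr rfl fun a _ => Finset.sum_congr rfl fun b _ => by ring

theorem isBounded_quadForm_le {v : Matrix (Fin 4) (Fin 4) ℝ} (hv : ∀ y, y ≠ 0 → 0 < quadForm v y)
    (ρ : ℝ) : Bornology.IsBounded {y | quadForm v y ≤ ρ} := by
  obtain ⟨c, hc, hle⟩ := exists_mul_sq_norm_le (continuous_quadForm v) (quadForm_smul v) hv
  rw [isBounded_iff_forall_norm_le]
  refine ⟨Real.sqrt (ρ / c), fun y hy => ?_⟩
  refine Real.le_sqrt_of_sq_le ?_
  rw [le_div_iff₀ hc, mul_comm]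
  exact (hle y).trans hy

/-- The volume of the Euclidean ball of radius `√(√(2/π²))`. -/
noncomputable def unitBallVolume : ℝ :=
  (volume {y : Coord | quadForm (1 : Matrix (Fin 4) (Fin 4) ℝ) y ≤ Real.sqrt (2 / Real.pi ^ 2)}).toReal

theorem quadForm_one_pos (y : Coord) (hy : y ≠ 0) :
    0 < quadForm (1 : Matrix (Fin 4) (Fin 4) ℝ) y := by
  rw [quadForm_eq_dotProduct, Matrix.one_mulVec]
  refine lt_of_le_of_ne (Finset.sum_nonneg fun i _ => mul_self_nonneg _) (Ne.symm ?_)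
  exact fun h => hy (dotProduct_self_eq_zero.1 h)

/-- Stationarity is unaffected by a constant factor as long as it is not zero; the value 1 of this
volume plays no role. -/
theorem unitBallVolume_pos : 0 < unitBallVolume := by
  refine ENNReal.toReal_pos ?_ (isBounded_quadForm_le quadForm_one_pos _).measure_lt_top.ne
  have hpos : 0 < Real.sqrt (2 / Real.pi ^ 2) := Real.sqrt_pos.2 (by positivity)
  have hopen : IsOpen {y : Coord | quadForm (1 : Matrix (Fin 4) (Fin 4) ℝ) y
      < Real.sqrt (2 / Real.pi ^ 2)} := isOpen_lt (continuous_quadForm _) continuous_const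
  refine ne_of_gt (lt_of_lt_of_le (hopen.measure_pos volume ⟨0, ?_⟩)
    (measure_mono fun y hy => by
      simp only [mem_ofPred_eq] at hy ⊢; exact hy.le))
  simpa [quadForm] using hpos

/-- Factor v = Pᵀ P: the set is the preimage under P of a Euclidean ball, and the Jacobian |det P|⁻¹
cancels √(det v) = |det P|. This makes the action independent of the fibre metric. -/
theorem volume_quadForm_le {v : Matrix (Fin 4) (Fin 4) ℝ} (hs : ∀ i j, v i j = v j i)
    (hv : ∀ y, y ≠ 0 → 0 < quadForm v y) :
    (volume {y | quadForm v y ≤ Real.sqrt (2 / Real.pi ^ 2)}).toReal * Real.sqrt v.det =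
      unitBallVolume := by
  have hpd : v.PosDef := by
    refine Matrix.PosDef.of_dotProduct_mulVec_pos (Matrix.IsHermitian.ext fun i j => ?_) fun y hy => ?_
    · simpa using hs j i
    · simpa [quadForm_eq_dotProduct] using hv y hy
  have hdet : 0 < v.det := hpd.det_pos
  open scoped MatrixOrder in
  obtain ⟨P, hP⟩ := CStarAlgebra.nonneg_iff_eq_star_mul_self.1 (Matrix.nonneg_iff_posSemidef.2 hpd.posSemidef)
  have hP' : v = P.transpose * P := by simpa [Matrix.star_eq_conjTranspose] using hP
  have hdP : v.det = P.det ^ 2 := by rw [hP', Matrix.det_mul, Matrix.det_transpose, sq]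
  have hdP0 : P.det ≠ 0 := by intro h; rw [hdP, h] at hdet; simp at hdet
  have hset : {y | quadForm v y ≤ Real.sqrt (2 / Real.pi ^ 2)} = Matrix.toLin' P ⁻¹'
      {y : Coord | quadForm (1 : Matrix (Fin 4) (Fin 4) ℝ) y ≤ Real.sqrt (2 / Real.pi ^ 2)} := by
    ext y
    have : quadForm v y = quadForm (1 : Matrix (Fin 4) (Fin 4) ℝ) (Matrix.toLin' P y) := by
      rw [quadForm_eq_dotProduct, quadForm_eq_dotProduct, Matrix.one_mulVec, Matrix.toLin'_apply,
        hP', ← Matrix.mulVec_mulVec, Matrix.dotProduct_mulVec, Matrix.vecMul_transpose]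
    simp only [mem_ofPred_eq, mem_preimage, this]
  rw [hset, Measure.addHaar_preimage_linearMap _ (by simpa using hdP0), ENNReal.toReal_mul,
    ENNReal.toReal_ofReal (abs_nonneg _), LinearMap.det_toLin', hdP, Real.sqrt_sq_eq_abs, abs_inv,
    unitBallVolume]
  have : |P.det| ≠ 0 := abs_ne_zero.2 hdP0
  field_simp

theorem setIntegral_odd_eq_zero {S : Set Coord} (hS : ∀ y, -y ∈ S ↔ y ∈ S) (hm : MeasurableSet S)
    {f : Coord → ℂ} (hf : ∀ y, f (-y) = -f y) : ∫ y in S, f y = 0 := by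
  have h : ∫ y, S.indicator f y = -∫ y, S.indicator f y := by
    rw [← integral_neg, ← integral_neg_eq_self]
    refine integral_congr_ae (Filter.Eventually.of_forall fun y => ?_)
    by_cases hy : y ∈ S
    · simp only [indicator_of_mem hy, indicator_of_mem ((hS y).2 hy), hf]
    · simp only [indicator_of_notMem hy, indicator_of_notMem (fun h => hy ((hS y).1 h)), neg_zero]
  rw [← integral_indicator hm]
  exact self_eq_neg.1 h

/-- Integration over a fibre: the constant term is multiplied by a universal constant, and the term
which is odd in `y` does not contribute. -/
theorem setIntegral_fibre {m v : Matrix (Fin 4) (Fin 4) ℝ} {B : LinearMap.BilinForm ℝ Coord}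
    (hB : IsLorentzian B) {σ : ℝ} (hσ : σ = 1 ∨ σ = -1) (hBm : ∀ y, B y y = σ * quadForm m y)
    (hs : ∀ i j, v i j = v j i) (hv : ∀ y, y ≠ 0 → 0 < quadForm v y) {f : Coord → ℂ} {a b : ℂ}
    {c : Fin 4 → ℝ} (hf : ∀ y, quadForm m y ≠ 0 →
      f y = a + b * ((linForm c y : ℂ) / root (quadForm m y))) :
    ∫ y in {y | quadForm v y ≤ Real.sqrt (2 / Real.pi ^ 2)}, f y * (Real.sqrt v.det : ℂ) =
      (unitBallVolume : ℂ) * a := by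
  set S := {y | quadForm v y ≤ Real.sqrt (2 / Real.pi ^ 2)} with hSdef
  have hSm : MeasurableSet S := (isClosed_le (continuous_quadForm v) continuous_const).measurableSet
  have hSb : Bornology.IsBounded S := isBounded_quadForm_le hv _
  have hsym : ∀ y, -y ∈ S ↔ y ∈ S := fun y => by simp only [hSdef, mem_ofPred_eq, quadForm_neg]
  obtain ⟨hnull, hint⟩ := exists_kernel hB hSm hSb
  -- For σ = -1 the roots of m and of σ m differ in phase but not in modulus, which is all that a
  -- bound needs.
  have hint' : IntegrableOn (fun y => (linForm c y : ℂ) / root (quadForm m y)) S := by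
    refine Integrable.mono (hint c) ((Complex.measurable_ofReal.comp
      (differentiable_linForm c).continuous.measurable).div
      (measurable_root.comp (continuous_quadForm _).measurable)).aestronglyMeasurable
      (Filter.Eventually.of_forall fun y => le_of_eq ?_)
    rw [norm_div, norm_div, norm_root, norm_root, hBm, abs_mul]
    rcases hσ with rfl | rfl <;> simp
  have hodd : ∫ y in S, (linForm c y : ℂ) / root (quadForm m y) = 0 :=
    setIntegral_odd_eq_zero hsym hSm fun y => by
      simp only [quadForm_neg, linForm_neg]; push_cast; ring
  have hfin : volume S ≠ ⊤ := hSb.measure_lt_top.ne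
  calc ∫ y in S, f y * (Real.sqrt v.det : ℂ)
      = ∫ y in S, (a + b * ((linForm c y : ℂ) / root (quadForm m y))) * (Real.sqrt v.det : ℂ) := by
        refine integral_congr_ae ?_
        -- The formula for f is known only off the null cone, which has measure zero.
        filter_upwards [hnull] with y hy
        rw [hf y (fun h => hy (by rw [hBm, h, mul_zero]))]
    _ = (∫ y in S, a) * (Real.sqrt v.det : ℂ) := by
        rw [integral_mul_const, integral_add (f := fun _ => a) (integrableOn_const hfin)
          (hint'.const_mul b), integral_const_mul, hodd, mul_zero, add_zero]
    _ = _ := by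
        rw [setIntegral_const, ← volume_quadForm_le hs hv, Measure.real, Complex.real_smul]
        push_cast; ring

/-- A kernel vector is orthogonal to the timelike vector t, hence negative, but it is also
orthogonal to itself. -/
theorem IsLorentzian.det_ne_zero {m : Matrix (Fin 4) (Fin 4) ℝ} {B : LinearMap.BilinForm ℝ Coord}
    (hB : IsLorentzian B) {σ : ℝ} (hBm : ∀ v w, B v w = σ * ∑ i, ∑ j, m i j * v i * w j) : m.det ≠ 0 := by
  intro h0
  obtain ⟨w, hw, hmw⟩ := Matrix.exists_mulVec_eq_zero_iff.2 h0
  have hz : ∀ v, B v w = 0 := by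
    intro v
    have h : ∑ i, ∑ j, m i j * v i * w j = dotProduct v (m.mulVec w) := by
      simp only [dotProduct, Matrix.mulVec, Finset.mul_sum]
      exact Finset.sum_congr rfl fun a _ => Finset.sum_congr rfl fun b _ => by ring
    rw [hBm, h, hmw]; simp
  obtain ⟨t, -, ht⟩ := hB.exists_timelike
  have := ht w hw (hz t)
  rw [hz w] at this
  exact lt_irrefl _ this

end FibreIntegral

/-! ### Smooth charts, their transition maps and the components of tensor fields. -/

section Charts

open Set Filter Topology

variable {M : Type*} [TopologicalSpace M]

/-- The overlap of two charts, in the coordinates of the first one. -/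
def overlap (e e' : OpenPartialHomeomorph M Coord) : Set Coord := e.target ∩ e.symm ⁻¹' e'.source

theorem isOpen_overlap (e e' : OpenPartialHomeomorph M Coord) : IsOpen (overlap e e') :=
  e.symm.isOpen_inter_preimage e'.open_source

variable [ChartedSpace Coord M]

variable (M) in
/-- The smooth charts of `M`. -/
abbrev smoothCharts : Set (OpenPartialHomeomorph M Coord) := IsManifold.maximalAtlas 𝓘(ℝ, Coord) ∞ M

theorem mem_maximalAtlas_one {e : OpenPartialHomeomorph M Coord} (he : e ∈ smoothCharts M) :
    e ∈ IsManifold.maximalAtlas 𝓘(ℝ, Coord) 1 M :=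
  IsManifold.maximalAtlas_subset_of_le (by norm_num) he

theorem mdifferentiable_of_mem_smoothCharts {e : OpenPartialHomeomorph M Coord}
    (he : e ∈ smoothCharts M) : e.MDifferentiable 𝓘(ℝ, Coord) 𝓘(ℝ, Coord) :=
  ⟨fun _ hx => (mdifferentiableAt_of_mem_maximalAtlas
      (mem_maximalAtlas_one he) hx).mdifferentiableWithinAt,
    fun _ hx => (mdifferentiableAt_symm_of_mem_maximalAtlas
      (mem_maximalAtlas_one he) hx).mdifferentiableWithinAt⟩

theorem tangentVec_bijective {e : OpenPartialHomeomorph M Coord} (he : e ∈ smoothCharts M)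
    {u : Coord} (hu : u ∈ e.target) : Function.Bijective (tangentVec e u) :=
  (mdifferentiable_of_mem_smoothCharts he).symm.mfderiv_bijective hu

theorem contDiffOn_transition {e e' : OpenPartialHomeomorph M Coord} (he : e ∈ smoothCharts M)
    (he' : e' ∈ smoothCharts M) : ContDiffOn ℝ ∞ (e' ∘ e.symm) (overlap e e') :=
  contMDiffOn_iff_contDiffOn.1 ((contMDiffOn_of_mem_maximalAtlas he').comp
    ((contMDiffOn_symm_of_mem_maximalAtlas he).mono inter_subset_left) fun _ hx => hx.2)

/-- The chain rule for e⁻¹ = e'⁻¹ ∘ (e' ∘ e⁻¹). Both sides are read in `Coord` because the two base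
points are equal only propositionally. -/
theorem tangentVec_transition {e e' : OpenPartialHomeomorph M Coord} (he : e ∈ smoothCharts M)
    (he' : e' ∈ smoothCharts M) {u : Coord} (hu : u ∈ overlap e e') (y : Coord) :
    (tangentVec e u y : Coord) =
      (tangentVec e' (e' (e.symm u)) ((jac (e' ∘ e.symm) u).mulVec y) : Coord) := by
  have hn : overlap e e' ∈ 𝓝 u := (isOpen_overlap e e').mem_nhds hu
  have hd : DifferentiableAt ℝ (e' ∘ e.symm) u :=
    ((contDiffOn_transition he he').contDiffAt hn).differentiableAt (by simp)
  have hev : e.symm =ᶠ[𝓝 u] e'.symm ∘ (e' ∘ e.symm) :=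
    Filter.mem_of_superset hn fun z hz => (e'.left_inv hz.2).symm
  have hc : mfderiv 𝓘(ℝ, Coord) 𝓘(ℝ, Coord) (e'.symm ∘ (e' ∘ e.symm)) u =
      (mfderiv 𝓘(ℝ, Coord) 𝓘(ℝ, Coord) e'.symm (e' (e.symm u))).comp
        (mfderiv 𝓘(ℝ, Coord) 𝓘(ℝ, Coord) (e' ∘ e.symm) u) :=
    mfderiv_comp u ((mdifferentiable_of_mem_smoothCharts he').mdifferentiableAt_symm
      (e'.map_source hu.2)) hd.mdifferentiableAt
  have hj : (fderiv ℝ (e' ∘ e.symm) u) y = (jac (e' ∘ e.symm) u).mulVec y := by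
    ext a
    rw [fderiv_apply_eq_sum_pd]
    simp only [Matrix.mulVec, dotProduct, jac, Matrix.of_apply, Finset.sum_apply, Pi.smul_apply,
      smul_eq_mul]
    refine Finset.sum_congr rfl fun i _ => ?_
    rw [mul_comm]
    congr 1
    have h2 := (hasFDerivAt_pi'.1 hd.hasFDerivAt a).fderiv
    change _ = fderiv ℝ (fun z => (e' ∘ e.symm) z a) u _
    rw [h2]; rfl
  have h1 : mfderiv 𝓘(ℝ, Coord) 𝓘(ℝ, Coord) e.symm u y =
      mfderiv 𝓘(ℝ, Coord) 𝓘(ℝ, Coord) (e'.symm ∘ (e' ∘ e.symm)) u y := by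
    rw [hev.mfderiv_eq]; rfl
  have h3 : mfderiv 𝓘(ℝ, Coord) 𝓘(ℝ, Coord) (e' ∘ e.symm) u = fderiv ℝ (e' ∘ e.symm) u :=
    mfderiv_eq_fderiv
  change mfderiv 𝓘(ℝ, Coord) 𝓘(ℝ, Coord) e.symm u y = _
  rw [h1, hc, h3, ← hj]
  rfl

theorem coordChange_transition {e e' : OpenPartialHomeomorph M Coord} (he : e ∈ smoothCharts M)
    (he' : e' ∈ smoothCharts M) : CoordChange (overlap e e') e'.target (e' ∘ e.symm) where
  isOpen := isOpen_overlap e e'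
  mapsTo := fun _ hu => e'.map_source hu.2
  smooth := fun a => (contDiff_apply ℝ ℝ a).comp_contDiffOn (contDiffOn_transition he he')
  det_ne := fun u hu h0 => by
    -- A kernel vector of the Jacobian would represent the same tangent vector as 0 in the chart e,
    -- against injectivity.
    obtain ⟨y, hy, hy0⟩ := Matrix.exists_mulVec_eq_zero_iff.2 h0
    refine hy ((tangentVec_bijective he hu.1).1 ?_)
    have h1 := tangentVec_transition he he' hu y
    have h2 := tangentVec_transition he he' hu 0
    rw [hy0] at h1
    rw [Matrix.mulVec_zero] at h2
    exact h1.trans h2.symm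

theorem tangentVec_eq_sum (e : OpenPartialHomeomorph M Coord) (u y : Coord) :
    tangentVec e u y = ∑ i, y i • frame e u i := by
  have hy : y = ∑ i, y i • (Pi.single i 1 : Coord) := pi_eq_sum_univ' y
  conv_lhs => rw [hy]
  simp only [tangentVec, frame]
  exact (map_sum _ _ _).trans (Finset.sum_congr rfl fun i _ => map_smul _ _ _)

theorem apply_tangentVec (T : ∀ x : M, LinearMap.BilinForm ℝ (TangentSpace 𝓘(ℝ, Coord) x))
    (e : OpenPartialHomeomorph M Coord) (u y z : Coord) :
    T (e.symm u) (tangentVec e u y) (tangentVec e u z) =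
      ∑ i, ∑ j, comp T e u i j * y i * z j := by
  rw [tangentVec_eq_sum, tangentVec_eq_sum]
  simp only [map_sum, map_smul, LinearMap.sum_apply, LinearMap.smul_apply, smul_eq_mul, comp,
    Matrix.of_apply, Finset.mul_sum]
  rw [Finset.sum_comm]
  exact Finset.sum_congr rfl fun i _ => Finset.sum_congr rfl fun j _ => by ring

/-- All tangent spaces are definitionally `Coord`, so the vectors can stay fixed while the base
point is rewritten. -/
theorem apply_congr_point (T : ∀ x : M, LinearMap.BilinForm ℝ (TangentSpace 𝓘(ℝ, Coord) x))
    {p q : M} (h : p = q) (v w : Coord) : T p v w = T q v w := by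
  subst h; rfl

theorem comp_transition (T : ∀ x : M, LinearMap.BilinForm ℝ (TangentSpace 𝓘(ℝ, Coord) x))
    {e e' : OpenPartialHomeomorph M Coord} (he : e ∈ smoothCharts M) (he' : e' ∈ smoothCharts M)
    {u : Coord} (hu : u ∈ overlap e e') :
    comp T e u = (jac (e' ∘ e.symm) u).transpose * comp T e' ((e' ∘ e.symm) u) *
      jac (e' ∘ e.symm) u := by
  ext i j
  have h1 : comp T e u i j = T (e.symm u) (tangentVec e u (Pi.single i 1))
      (tangentVec e u (Pi.single j 1)) := rfl
  have h2 := tangentVec_transition he he' hu (Pi.single i 1)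
  have h3 := tangentVec_transition he he' hu (Pi.single j 1)
  have h4 : T (e.symm u) (tangentVec e u (Pi.single i 1)) (tangentVec e u (Pi.single j 1)) =
      T (e.symm u) (tangentVec e' (e' (e.symm u)) ((jac (e' ∘ e.symm) u).mulVec (Pi.single i 1)) : Coord)
      (tangentVec e' (e' (e.symm u)) ((jac (e' ∘ e.symm) u).mulVec (Pi.single j 1)) : Coord) :=
    congrArg₂ (fun a b : Coord => T (e.symm u) a b) h2 h3
  have h5 : e.symm u = e'.symm (e' (e.symm u)) := (e'.left_inv hu.2).symm
  rw [h1, h4]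
  refine (apply_congr_point T h5 _ _).trans ?_
  refine (apply_tangentVec T e' _ _ _).trans ?_
  simp only [Matrix.mul_apply, Matrix.transpose_apply, Finset.sum_mul, Function.comp_apply,
    Matrix.mulVec_single_one, Matrix.col_apply]
  rw [Finset.sum_comm]
  exact Finset.sum_congr rfl fun a _ => Finset.sum_congr rfl fun b _ => by ring

theorem OneForm.comp_transition (A : OneForm M)
    {e e' : OpenPartialHomeomorph M Coord} (he : e ∈ smoothCharts M) (he' : e' ∈ smoothCharts M)
    {u : Coord} (hu : u ∈ overlap e e') (i : Fin 4) :
    A.comp e u i = ∑ a, jac (e' ∘ e.symm) u a i * A.comp e' ((e' ∘ e.symm) u) a := by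
  have h2 := tangentVec_transition he he' hu (Pi.single i 1)
  have h5 : e.symm u = e'.symm (e' (e.symm u)) := (e'.left_inv hu.2).symm
  have hp : ∀ {p q : M}, p = q → ∀ v : Coord, A.val p v = A.val q v := by
    rintro p q rfl v; rfl
  have h1 : A.comp e u i = A.val (e'.symm (e' (e.symm u)))
      (tangentVec e' (e' (e.symm u)) ((jac (e' ∘ e.symm) u).mulVec (Pi.single i 1))) :=
    (congrArg (fun a : Coord => A.val (e.symm u) a) h2).trans (hp h5 _)
  rw [h1, tangentVec_eq_sum, map_sum]
  refine Finset.sum_congr rfl fun a _ => ?_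
  rw [map_smul, Matrix.mulVec_single_one]; rfl

theorem OneForm.contDiffOn_comp (A : OneForm M) {e : OpenPartialHomeomorph M Coord}
    (he : e ∈ smoothCharts M) (i : Fin 4) : ContDiffOn ℝ ∞ (fun u => A.comp e u i) e.target :=
  A.smooth e he i

/-- Multiplication by σ normalizes the signature to (+,-,-,-), so the fibre analysis is needed for
one convention only. -/
theorem LorentzMetric.exists_isLorentzian (g : LorentzMetric M) :
    ∃ σ : ℝ, (σ = 1 ∨ σ = -1) ∧ ∀ e ∈ smoothCharts M, ∀ u ∈ e.target,
      ∃ B : LinearMap.BilinForm ℝ Coord, IsLorentzian B ∧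
        ∀ v w, B v w = σ * ∑ i, ∑ j, EinsteinMaxwell.comp g.val e u i j * v i * w j := by
  obtain ⟨σ, hσ, h⟩ := g.lorentzian
  refine ⟨σ, hσ, fun e he u hu => ?_⟩
  have hB : ∀ v w, (σ • Matrix.toBilin' (EinsteinMaxwell.comp g.val e u)) v w =
      σ * g.val (e.symm u) (tangentVec e u v) (tangentVec e u w) := by
    intro v w
    rw [apply_tangentVec, LinearMap.smul_apply, LinearMap.smul_apply, smul_eq_mul,
      Matrix.toBilin'_apply]
    congr 1
    exact Finset.sum_congr rfl fun i _ => Finset.sum_congr rfl fun j _ => by ring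
  refine ⟨σ • Matrix.toBilin' (EinsteinMaxwell.comp g.val e u), ⟨fun v w => ?_, ?_⟩, fun v w => ?_⟩
  · rw [hB, hB, g.symm]
  · obtain ⟨t, ht, hn⟩ := h (e.symm u)
    obtain ⟨s, rfl⟩ := (tangentVec_bijective he hu).2 t
    refine ⟨s, by rwa [hB], fun w hw h0 => ?_⟩
    rw [hB] at h0 ⊢
    refine hn _ (fun hw0 => hw ((tangentVec_bijective he hu).1 (hw0.trans ?_))) ?_
    · simp only [tangentVec]; exact (map_zero _).symm
    · refine (mul_eq_zero.1 h0).resolve_left ?_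
      rcases hσ with rfl | rfl <;> norm_num
  · rw [hB, apply_tangentVec]

theorem LorentzMetric.comp_symm (g : LorentzMetric M) (e : OpenPartialHomeomorph M Coord)
    (u : Coord) (i j : Fin 4) :
    EinsteinMaxwell.comp g.val e u i j = EinsteinMaxwell.comp g.val e u j i := g.symm _ _ _

theorem LorentzMetric.comp_det_ne_zero (g : LorentzMetric M) {e : OpenPartialHomeomorph M Coord}
    (he : e ∈ smoothCharts M) {u : Coord} (hu : u ∈ e.target) :
    (EinsteinMaxwell.comp g.val e u).det ≠ 0 := by
  obtain ⟨σ, -, h⟩ := g.exists_isLorentzian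
  obtain ⟨B, hB, hBm⟩ := h e he u hu
  exact hB.det_ne_zero hBm

theorem LorentzMetric.coordMetric (g : LorentzMetric M) {e : OpenPartialHomeomorph M Coord}
    (he : e ∈ smoothCharts M) : CoordMetric e.target (EinsteinMaxwell.comp g.val e) where
  isOpen := e.open_target
  smooth := g.smooth e he
  symm := fun u _ => g.comp_symm e u
  det_ne := fun _ hu => g.comp_det_ne_zero he hu

theorem CoordMetric.mono {U W : Set Coord} {g : Coord → Matrix (Fin 4) (Fin 4) ℝ}
    (h : CoordMetric U g) (hW : IsOpen W) (hWU : W ⊆ U) : CoordMetric W g where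
  isOpen := hW
  smooth := fun i j => (h.smooth i j).mono hWU
  symm := fun x hx => h.symm x (hWU hx)
  det_ne := fun x hx => h.det_ne x (hWU hx)

theorem MetricVariation.metricFam {g : LorentzMetric M} {Δ : Set M} (G : MetricVariation g Δ)
    {e : OpenPartialHomeomorph M Coord} (he : e ∈ smoothCharts M) :
    MetricFam (univ ×ˢ e.target) (fun ε => EinsteinMaxwell.comp (G.metric ε).val e) where
  isOpen := isOpen_univ.prod e.open_target
  smooth := G.smooth e he
  symm := fun p _ => (G.metric p.1).comp_symm e p.2
  det_ne := fun p hp => (G.metric p.1).comp_det_ne_zero he hp.2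

end Charts

/-! ### Reduction of the action to ∫ (r + β F_ij F^ij) over the base. -/

section ActionIntegrand

open MeasureTheory Set

variable {M : Type*} [TopologicalSpace M] [ChartedSpace Coord M] [IsManifold 𝓘(ℝ, Coord) ∞ M]

theorem chartAt_mem_smoothCharts (x : M) : chartAt Coord x ∈ smoothCharts M :=
  IsManifold.chart_mem_maximalAtlas x

/-- The Lagrangian `r + β F_ij F^ij`, as a function on `M`. -/
noncomputable def lagrangianAt (β : ℝ) (g : LorentzMetric M) (A : OneForm M) (x : M) : ℝ :=
  lagrangian β (comp g.val (chartAt Coord x)) (A.comp (chartAt Coord x)) (chartAt Coord x x)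

/-- By `ricciScalarD_eq` the integrand is a constant plus an odd term, so `setIntegral_fibre`
applies. The result does not contain v: the choice of fibre metrics along a variation has no
influence, not even on differentiability. -/
theorem fibre_integral_eq (α : ℝ) (A : OneForm M) (g : LorentzMetric M) (v : FibreMetric g) (x : M) :
    ∫ y in fibreBall v x,
        ricciScalarD (comp g.val (chartAt Coord x)) (A.comp (chartAt Coord x)) α
            (chartAt Coord x x) y *
          (Real.sqrt (comp v.val (chartAt Coord x) (chartAt Coord x x)).det : ℂ) =
      (unitBallVolume : ℂ) * (lagrangianAt (3 * α ^ 2 / 2) g A x : ℂ) := by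
  have he := chartAt_mem_smoothCharts x
  have hu := mem_chart_target Coord x
  obtain ⟨σ, hσ, h⟩ := g.exists_isLorentzian
  obtain ⟨B, hB, hBm⟩ := h _ he _ hu
  refine setIntegral_fibre (m := comp g.val (chartAt Coord x) (chartAt Coord x x)) hB hσ
    (fun y => hBm y y) (fun i j => v.symm _ _ _) (fun y hy => ?_)
    (b := -(5 * α / 2)) 
    (c := faradayDiv (comp g.val (chartAt Coord x)) (A.comp (chartAt Coord x)) (chartAt Coord x x))
    (fun y hy => ?_)
  · have h1 := v.pos _ (tangentVec (chartAt Coord x) (chartAt Coord x x) y) (fun h0 => hy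
      ((tangentVec_bijective he hu).1 (h0.trans (by simp only [tangentVec]; exact (map_zero _).symm))))
    rwa [apply_tangentVec] at h1
  · rw [ricciScalarD_eq (g.coordMetric he) (A.contDiffOn_comp he) hu hy, lagrangianAt, sub_eq_add_neg,
      neg_mul]
    rfl

/-- Constants and the coercion to ℂ pass through the integral unconditionally, so nothing is
required of Δ. -/
theorem action_eq [MeasurableSpace M] (c k α : ℝ) (A : OneForm M) (g : LorentzMetric M)
    (v : FibreMetric g) (Δ : Set M) :
    action c k α A g v Δ = ((-(c ^ 3 / (16 * Real.pi * k)) * (unitBallVolume *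
      ∫ x in Δ, lagrangianAt (3 * α ^ 2 / 2) g A x ∂(volumeMeasure g)) : ℝ) : ℂ) := by
  unfold action
  simp only [fibre_integral_eq]
  rw [integral_const_mul, integral_complex_ofReal]
  push_cast; rfl

end ActionIntegrand

/-! ### Densities on M and their quotients by the volume density. -/

section Density

open Set Filter Topology

variable {M : Type*} [TopologicalSpace M] [ChartedSpace Coord M]

theorem continuousOn_volDensity (g : LorentzMetric M) {e : OpenPartialHomeomorph M Coord}
    (he : e ∈ smoothCharts M) : ContinuousOn (volDensity (comp g.val e)) e.target :=
  (g.coordMetric he).contDiffOn_volDensity.continuousOn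

theorem det_fderiv_eq_det_jac {φ : Coord → Coord} {u : Coord} (hφ : DifferentiableAt ℝ φ u) :
    (fderiv ℝ φ u).det = (jac φ u).det := by
  rw [ContinuousLinearMap.det, ← LinearMap.det_toMatrix']
  congr 1
  ext a i
  rw [LinearMap.toMatrix'_apply]
  have h2 := (hasFDerivAt_pi'.1 hφ.hasFDerivAt a).fderiv
  change _ = fderiv ℝ (fun z => φ z a) u _
  rw [h2]
  rfl

/-- A field of densities, given by its component in each chart. -/
def IsDensity (D : OpenPartialHomeomorph M Coord → Coord → ℝ) : Prop :=
  ∀ e ∈ smoothCharts M, ∀ e' ∈ smoothCharts M, ∀ u ∈ overlap e e',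
    D e u = |(jac (e' ∘ e.symm) u).det| * D e' ((e' ∘ e.symm) u)

/-- The quotient of a density by the volume density. -/
noncomputable def densityRatio (g : LorentzMetric M) (D : OpenPartialHomeomorph M Coord → Coord → ℝ)
    (x : M) : ℝ :=
  D (chartAt Coord x) (chartAt Coord x x) /
    volDensity (comp g.val (chartAt Coord x)) (chartAt Coord x x)

theorem isDensity_volDensity (g : LorentzMetric M) :
    IsDensity (M := M) fun e => volDensity (comp g.val e) := fun _ he _ he' _ hu =>
  CoordChange.volDensity_eq (fun _ hz => comp_transition g.val he he' hz) hu

variable [IsManifold 𝓘(ℝ, Coord) ∞ M]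

theorem mem_smoothCharts_of_mem_atlas {e : OpenPartialHomeomorph M Coord} (he : e ∈ atlas Coord M) :
    e ∈ smoothCharts M := IsManifold.subset_maximalAtlas he

/-- Numerator and denominator acquire the same Jacobian factor. Thus the preferred chart, which may
jump from point to point, can be replaced by one fixed chart near any given point; continuity of the
quotient rests on this. -/
theorem densityRatio_eq (g : LorentzMetric M) {D : OpenPartialHomeomorph M Coord → Coord → ℝ}
    (hD : IsDensity D) {e : OpenPartialHomeomorph M Coord} (he : e ∈ smoothCharts M) {x : M}
    (hx : x ∈ e.source) : densityRatio g D x = D e (e x) / volDensity (comp g.val e) (e x) := by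
  have hu : chartAt Coord x x ∈ overlap (chartAt Coord x) e :=
    ⟨mem_chart_target _ _, by
      rw [mem_preimage, (chartAt Coord x).left_inv (mem_chart_source _ _)]; exact hx⟩
  have h1 := hD _ (chartAt_mem_smoothCharts x) e he _ hu
  have h2 := isDensity_volDensity g _ (chartAt_mem_smoothCharts x) e he _ hu
  have hj := (coordChange_transition (chartAt_mem_smoothCharts x) he).det_ne _ hu
  have h3 : (e ∘ (chartAt Coord x).symm) (chartAt Coord x x) = e x := by
    rw [Function.comp_apply, (chartAt Coord x).left_inv (mem_chart_source _ _)]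
  rw [h3] at h1 h2
  simp only at h2
  rw [densityRatio, h1, h2, mul_div_mul_left _ _ (abs_ne_zero.2 hj)]

theorem volDensity_mul_densityRatio (g : LorentzMetric M)
    {D : OpenPartialHomeomorph M Coord → Coord → ℝ} (hD : IsDensity D)
    {e : OpenPartialHomeomorph M Coord} (he : e ∈ smoothCharts M) {u : Coord} (hu : u ∈ e.target) :
    volDensity (comp g.val e) u * densityRatio g D (e.symm u) = D e u := by
  rw [densityRatio_eq g hD he (e.map_target hu), e.right_inv hu,
    mul_div_cancel₀ _ (volDensity_pos (g.comp_det_ne_zero he hu)).ne']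

theorem continuousOn_densityRatio (g : LorentzMetric M)
    {D : ℝ → OpenPartialHomeomorph M Coord → Coord → ℝ} (hD : ∀ ε, IsDensity (D ε))
    (hc : ∀ e ∈ smoothCharts M, ContinuousOn (fun p : ℝ × Coord => D p.1 e p.2) (univ ×ˢ e.target)) :
    Continuous fun p : ℝ × M => densityRatio g (D p.1) p.2 := by
  rw [continuous_iff_continuousAt]
  rintro ⟨ε, x⟩
  have he := chartAt_mem_smoothCharts x
  set e := chartAt Coord x
  have hx : x ∈ e.source := mem_chart_source _ _
  have ho : (univ : Set ℝ) ×ˢ e.source ∈ 𝓝 (ε, x) :=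
    (isOpen_univ.prod e.open_source).mem_nhds ⟨mem_univ _, hx⟩
  have h1 : ContinuousOn (fun p : ℝ × M => D p.1 e (e p.2) / volDensity (comp g.val e) (e p.2))
      (univ ×ˢ e.source) := by
    have hp : ContinuousOn (fun p : ℝ × M => (p.1, e p.2)) (univ ×ˢ e.source) :=
      continuousOn_fst.prodMk (e.continuousOn.comp continuousOn_snd fun p hp => hp.2)
    refine ((hc e he).comp hp fun p hp => ⟨mem_univ _, e.map_source hp.2⟩).div
      ((continuousOn_volDensity g he).comp (e.continuousOn.comp continuousOn_snd fun p hp => hp.2)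
        fun p hp => e.map_source hp.2) fun p hp =>
        (volDensity_pos (g.comp_det_ne_zero he (e.map_source hp.2))).ne'
  refine (h1.continuousAt ho).congr ?_
  filter_upwards [ho] with p hp
  exact (densityRatio_eq g (hD _) he hp.2).symm

theorem continuous_densityRatio (g : LorentzMetric M)
    {D : OpenPartialHomeomorph M Coord → Coord → ℝ} (hD : IsDensity D)
    (hc : ∀ e ∈ smoothCharts M, ContinuousOn (D e) e.target) :
    Continuous (densityRatio g D) :=
  (continuousOn_densityRatio g (fun _ : ℝ => hD) fun e he =>
    (hc e he).comp continuousOn_snd fun _ hp => hp.2).comp (Continuous.prodMk_right (0 : ℝ))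

end Density

/-! ### The volume measure in charts, and its dependence on the metric. -/

section Volume

open MeasureTheory Set Filter Topology

variable {M : Type*} [TopologicalSpace M] [MeasurableSpace M] [BorelSpace M]

theorem aemeasurable_chart_symm (e : OpenPartialHomeomorph M Coord) :
    AEMeasurable e.symm (volume.restrict e.target) :=
  e.continuousOn_symm.aemeasurable e.open_target.measurableSet

theorem measurableSet_symm_preimage (e : OpenPartialHomeomorph M Coord) {s : Set M}
    (hs : MeasurableSet s) : MeasurableSet (e.symm ⁻¹' s ∩ e.target) := by
  have h := (continuousOn_iff_continuous_domRestrict.1 e.continuousOn_symm).measurable hs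
  have := e.open_target.measurableSet.subtype_image h
  convert this using 1
  ext u
  simp only [mem_inter_iff, mem_preimage, mem_image, Subtype.exists, exists_and_right, exists_eq_right,
    Set.domRestrict_apply]
  exact ⟨fun h => ⟨h.2, h.1⟩, fun ⟨h1, h2⟩ => ⟨h2, h1⟩⟩

variable [ChartedSpace Coord M]

theorem localVolume_apply (g : LorentzMetric M) (e : OpenPartialHomeomorph M Coord)
    {s : Set M} (hs : MeasurableSet s) :
    localVolume g e s =
      ∫⁻ u in e.symm ⁻¹' s ∩ e.target, ENNReal.ofReal (volDensity (comp g.val e) u) := by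
  rw [localVolume, Measure.map_apply_of_aemeasurable
    ((aemeasurable_chart_symm e).mono_ac (withDensity_absolutelyContinuous _ _)) hs,
    withDensity_apply', Measure.restrict_restrict' e.open_target.measurableSet]
  rfl

/-- The change of variables formula for the transition map, whose Jacobian determinant is the ratio
of the two volume densities. -/
theorem localVolume_eq_of_subset (g : LorentzMetric M) {e e' : OpenPartialHomeomorph M Coord}
    (he : e ∈ smoothCharts M) (he' : e' ∈ smoothCharts M) {s : Set M} (hs : MeasurableSet s)
    (hse : s ⊆ e.source) (hse' : s ⊆ e'.source) : localVolume g e s = localVolume g e' s := by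
  have hsub : e.symm ⁻¹' s ∩ e.target ⊆ overlap e e' := fun u hu => ⟨hu.2, hse' hu.1⟩
  have hc := coordChange_transition he he'
  have himage : (e' ∘ e.symm) '' (e.symm ⁻¹' s ∩ e.target) = e'.symm ⁻¹' s ∩ e'.target := by
    ext w
    constructor
    · rintro ⟨u, ⟨hu, hu'⟩, rfl⟩
      refine ⟨?_, e'.map_source (hse' hu)⟩
      simpa only [mem_preimage, Function.comp_apply, e'.left_inv (hse' hu)] using hu
    · rintro ⟨hw, hw'⟩
      refine ⟨e (e'.symm w), ⟨?_, e.map_source (hse hw)⟩, ?_⟩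
      · simpa only [mem_preimage, e.left_inv (hse hw)] using hw
      · simp only [Function.comp_apply, e.left_inv (hse hw), e'.right_inv hw']
  have hinj : InjOn (e' ∘ e.symm) (e.symm ⁻¹' s ∩ e.target) := by
    intro u hu w hw h
    exact e.symm.injOn hu.2 hw.2 (e'.injOn (hse' hu.1) (hse' hw.1) h)
  have hd : ∀ u ∈ overlap e e', DifferentiableAt ℝ (e' ∘ e.symm) u := fun u hu =>
    ((contDiffOn_transition he he').contDiffAt ((isOpen_overlap e e').mem_nhds hu)).differentiableAt
      (by simp)
  rw [localVolume_apply g e hs, localVolume_apply g e' hs, ← himage,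
    lintegral_image_eq_lintegral_abs_det_fderiv_mul volume (measurableSet_symm_preimage e hs)
      (fun u hu => (hd u (hsub hu)).hasFDerivAt.hasFDerivWithinAt) hinj]
  refine setLIntegral_congr_fun (measurableSet_symm_preimage e hs) fun u hu => ?_
  rw [det_fderiv_eq_det_jac (hd u (hsub hu)), ← ENNReal.ofReal_mul (abs_nonneg _),
    ← CoordChange.volDensity_eq (W := overlap e e') (φ := e' ∘ e.symm)
      (fun z hz => comp_transition g.val he he' hz) (hsub hu)]

theorem localVolume_compl_source (g : LorentzMetric M) (e : OpenPartialHomeomorph M Coord) :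
    localVolume g e e.sourceᶜ = 0 := by
  rw [localVolume_apply g e e.open_source.measurableSet.compl]
  have : e.symm ⁻¹' e.sourceᶜ ∩ e.target = ∅ := by
    ext u
    simp only [mem_inter_iff, mem_preimage, mem_compl_iff, mem_empty_iff_false, iff_false, not_and]
    exact fun h1 h2 => h1 (e.map_target h2)
  rw [this]; simp

variable [IsManifold 𝓘(ℝ, Coord) ∞ M]

/-- The volume measure is given by `√|det g| d⁴x` on each chart domain. -/
theorem volumeMeasure_restrict_source (g : LorentzMetric M) {e : OpenPartialHomeomorph M Coord}
    (he : e ∈ atlas Coord M) : (volumeMeasure g).restrict e.source = localVolume g e := by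
  have hm := e.open_source.measurableSet
  refine le_antisymm ?_ ?_
  · have h : volumeMeasure g ≤ localVolume g e + (⊤ : Measure M).restrict e.sourceᶜ := by
      refine iSup₂_le fun e' he' => Measure.le_iff.2 fun s hs => ?_
      have h1 : localVolume g e' (s ∩ e.source) ≤ localVolume g e s := by
        have h2 : localVolume g e' (s ∩ e.source) = localVolume g e' (s ∩ e.source ∩ e'.source) := by
          refine le_antisymm ?_ (measure_mono inter_subset_left)
          calc localVolume g e' (s ∩ e.source)
              ≤ localVolume g e' (s ∩ e.source ∩ e'.source ∪ e'.sourceᶜ) := by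
                refine measure_mono fun x hx => ?_
                by_cases hx' : x ∈ e'.source
                · exact Or.inl ⟨hx, hx'⟩
                · exact Or.inr hx'
            _ ≤ _ := (measure_union_le _ _).trans (by rw [localVolume_compl_source, add_zero])
        rw [h2, localVolume_eq_of_subset g (mem_smoothCharts_of_mem_atlas he')
          (mem_smoothCharts_of_mem_atlas he) ((hs.inter hm).inter e'.open_source.measurableSet)
          inter_subset_right (inter_subset_left.trans inter_subset_right)]
        exact measure_mono (inter_subset_left.trans inter_subset_left)
      have h3 : localVolume g e' (s ∩ e.sourceᶜ) ≤ (⊤ : Measure M).restrict e.sourceᶜ s := by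
        rw [Measure.restrict_apply hs]
        exact (le_top : localVolume g e' ≤ ⊤) _
      rw [← measure_inter_add_sdiff s hm, Measure.add_apply]
      exact add_le_add h1 h3
    refine (Measure.restrict_mono_measure h _).trans ?_
    rw [Measure.restrict_add, Measure.restrict_restrict hm]
    simp only [inter_compl_self, Measure.restrict_empty, add_zero]
    exact Measure.restrict_le_self
  · have h : localVolume g e ≤ volumeMeasure g :=
      le_iSup₂ (f := fun e (_ : e ∈ atlas Coord M) => localVolume g e) e he
    have h2 : (localVolume g e).restrict e.source = localVolume g e :=
      Measure.restrict_eq_self_of_ae_mem (by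
        rw [ae_iff]; exact localVolume_compl_source g e)
    rw [← h2]
    exact Measure.restrict_mono_measure h _

theorem volumeMeasure_apply (g : LorentzMetric M) {e : OpenPartialHomeomorph M Coord}
    (he : e ∈ atlas Coord M) {s : Set M} (hs : MeasurableSet s) (hse : s ⊆ e.source) :
    volumeMeasure g s =
      ∫⁻ u in e.symm ⁻¹' s ∩ e.target, ENNReal.ofReal (volDensity (comp g.val e) u) := by
  rw [← localVolume_apply g e hs, ← volumeMeasure_restrict_source g he, Measure.restrict_apply hs,
    inter_eq_left.2 hse]

theorem isLocallyFiniteMeasure_volumeMeasure (g : LorentzMetric M) :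
    IsLocallyFiniteMeasure (volumeMeasure g) := by
  refine ⟨fun x => ?_⟩
  set e := chartAt Coord x with he
  have hea : e ∈ atlas Coord M := chart_mem_atlas _ _
  have hx : x ∈ e.source := mem_chart_source _ _
  obtain ⟨C, hC, hxC, hCt⟩ := exists_compact_subset e.open_target (e.map_source hx)
  have hopen : IsOpen (e.source ∩ e ⁻¹' interior C) := e.isOpen_inter_preimage isOpen_interior
  refine ⟨_, hopen.mem_nhds ⟨hx, hxC⟩, ?_⟩
  rw [volumeMeasure_apply g hea hopen.measurableSet inter_subset_left]
  obtain ⟨K, hK⟩ := hC.exists_bound_of_continuousOn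
    ((continuousOn_volDensity g (mem_smoothCharts_of_mem_atlas hea)).mono hCt)
  have hsub : e.symm ⁻¹' (e.source ∩ e ⁻¹' interior C) ∩ e.target ⊆ C := by
    rintro u ⟨⟨h1, h2⟩, h3⟩
    rw [mem_preimage, e.right_inv h3] at h2
    exact interior_subset h2
  calc ∫⁻ u in e.symm ⁻¹' (e.source ∩ e ⁻¹' interior C) ∩ e.target,
        ENNReal.ofReal (volDensity (comp g.val e) u)
      ≤ ∫⁻ u in C, ENNReal.ofReal (volDensity (comp g.val e) u) := lintegral_mono_set hsub
    _ ≤ ∫⁻ u in C, ENNReal.ofReal K := by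
        refine setLIntegral_mono' hC.measurableSet fun u hu => ?_
        exact ENNReal.ofReal_le_ofReal ((le_abs_self _).trans (hK u hu))
    _ < ⊤ := by
        rw [setLIntegral_const]
        exact ENNReal.mul_lt_top ENNReal.ofReal_lt_top hC.measure_lt_top

theorem setIntegral_source_eq (g : LorentzMetric M) {e : OpenPartialHomeomorph M Coord}
    (he : e ∈ atlas Coord M) {f : M → ℝ} (hf : ContinuousOn f e.source) :
    ∫ x in e.source, f x ∂(volumeMeasure g) =
      ∫ u in e.target, volDensity (comp g.val e) u * f (e.symm u) := by
  have hfm : AEStronglyMeasurable f (localVolume g e) := by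
    rw [← volumeMeasure_restrict_source g he]
    exact hf.aestronglyMeasurable e.open_source.measurableSet
  rw [volumeMeasure_restrict_source g he]
  unfold localVolume at hfm ⊢
  rw [integral_map ((aemeasurable_chart_symm e).mono_ac (withDensity_absolutelyContinuous _ _)) hfm,
    integral_withDensity_eq_integral_toReal_smul₀]
  · refine integral_congr_ae (Eventually.of_forall fun u => ?_)
    change (ENNReal.ofReal (Real.sqrt |(comp g.val e u).det|)).toReal • _ = _
    rw [ENNReal.toReal_ofReal (Real.sqrt_nonneg _), smul_eq_mul]; rfl
  · exact ((continuousOn_volDensity g (mem_smoothCharts_of_mem_atlas he)).aemeasurable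
      e.open_target.measurableSet).ennreal_ofReal
  · exact Eventually.of_forall fun _ => ENNReal.ofReal_lt_top

/-- On each chart domain of a countable cover this is the quotient of two explicit densities. All
members of a variation can thus be integrated against the measure of the unvaried metric, so that
the parameter occurs in the integrand alone. -/
theorem volumeMeasure_eq_withDensity [SecondCountableTopology M] (g g' : LorentzMetric M) :
    volumeMeasure g' = (volumeMeasure g).withDensity fun x =>
      ENNReal.ofReal (densityRatio g (fun e => volDensity (comp g'.val e)) x) := by
  obtain ⟨s, hsc, hs⟩ := TopologicalSpace.countable_cover_nhds
    fun x : M => chart_source_mem_nhds Coord x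
  refine (Measure.ext_iff_of_biUnion_eq_univ hsc hs).2 fun x _ => ?_
  have hcont : Continuous (densityRatio g fun e => volDensity (comp g'.val e)) :=
    continuous_densityRatio g (isDensity_volDensity g') fun e he => continuousOn_volDensity g' he
  have hea : chartAt Coord x ∈ atlas Coord M := chart_mem_atlas _ _
  have he := chartAt_mem_smoothCharts x
  set e := chartAt Coord x
  rw [volumeMeasure_restrict_source g' hea, restrict_withDensity e.open_source.measurableSet,
    volumeMeasure_restrict_source g hea]
  ext t ht
  rw [localVolume_apply g' e ht, withDensity_apply _ ht, localVolume,
    ← lintegral_indicator ht, lintegral_map' (by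
      exact (hcont.measurable.ennreal_ofReal.indicator ht).aemeasurable)
      ((aemeasurable_chart_symm e).mono_ac (withDensity_absolutelyContinuous _ _)),
    lintegral_withDensity_eq_lintegral_mul₀]
  rotate_left
  · exact ((continuousOn_volDensity g he).aemeasurable e.open_target.measurableSet).ennreal_ofReal
  · exact (hcont.measurable.ennreal_ofReal.indicator ht).comp_aemeasurable (aemeasurable_chart_symm e)
  rw [inter_comm, ← Measure.restrict_restrict_of_subset (inter_subset_left : e.target ∩ e.symm ⁻¹' t ⊆ e.target), 
    ← lintegral_indicator (by rw [inter_comm]; exact measurableSet_symm_preimage e ht)]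
  refine setLIntegral_congr_fun e.open_target.measurableSet fun u hu => ?_
  simp only [Pi.mul_apply]
  by_cases hut : e.symm u ∈ t
  · rw [indicator_of_mem (show u ∈ e.target ∩ e.symm ⁻¹' t from ⟨hu, hut⟩), indicator_of_mem hut,
      ← ENNReal.ofReal_mul (Real.sqrt_nonneg _)]
    congr 1
    exact (volDensity_mul_densityRatio g (isDensity_volDensity g') he hu).symm
  · rw [indicator_of_notMem (fun h => hut h.2), indicator_of_notMem hut, mul_zero]

theorem setIntegral_volumeMeasure_eq [SecondCountableTopology M] (g g' : LorentzMetric M)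
    {s : Set M} (hs : MeasurableSet s) (f : M → ℝ) :
    ∫ x in s, f x ∂(volumeMeasure g') =
      ∫ x in s, densityRatio g (fun e => volDensity (comp g'.val e)) x * f x ∂(volumeMeasure g) := by
  have hcont : Continuous (densityRatio g fun e => volDensity (comp g'.val e)) :=
    continuous_densityRatio g (isDensity_volDensity g') fun e he => continuousOn_volDensity g' he
  rw [volumeMeasure_eq_withDensity g g', restrict_withDensity hs,
    integral_withDensity_eq_integral_toReal_smul hcont.measurable.ennreal_ofReal
      (Eventually.of_forall fun _ => ENNReal.ofReal_lt_top)]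
  refine integral_congr_ae (Eventually.of_forall fun x => ?_)
  change (ENNReal.ofReal _).toReal • f x = _
  have h0 : 0 ≤ densityRatio g (fun e => volDensity (comp g'.val e)) x :=
    div_nonneg (Real.sqrt_nonneg _) (Real.sqrt_nonneg _)
  rw [ENNReal.toReal_ofReal h0, smul_eq_mul]

end Volume

/-! ### Differentiation of the reduced action under the integral. -/

section FirstVariation

open MeasureTheory Set Filter Topology

variable {M : Type*} [TopologicalSpace M] [ChartedSpace Coord M]

/-- A smooth family of fields of symmetric non-degenerate bilinear forms on the tangent spaces. -/
def IsMetricFamily (T : ℝ → ∀ x : M, LinearMap.BilinForm ℝ (TangentSpace 𝓘(ℝ, Coord) x)) : Prop :=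
  ∀ e ∈ smoothCharts M, MetricFam (univ ×ˢ e.target) (fun ε => comp (T ε) e)

variable {T : ℝ → ∀ x : M, LinearMap.BilinForm ℝ (TangentSpace 𝓘(ℝ, Coord) x)}

theorem MetricVariation.isMetricFamily {g : LorentzMetric M} {Δ : Set M} (G : MetricVariation g Δ) :
    IsMetricFamily fun ε => (G.metric ε).val := fun _ he => G.metricFam he

theorem IsMetricFamily.coordMetric (hT : IsMetricFamily T) {e : OpenPartialHomeomorph M Coord}
    (he : e ∈ smoothCharts M) (ε : ℝ) : CoordMetric e.target (comp (T ε) e) := by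
  simpa using (hT e he).slice ε

theorem IsMetricFamily.smoothFam_lagDensity (hT : IsMetricFamily T) (A : OneForm M) (β : ℝ)
    {e : OpenPartialHomeomorph M Coord} (he : e ∈ smoothCharts M) :
    SmoothFam (univ ×ˢ e.target) fun ε u => lagDensity β (comp (T ε) e) (A.comp e) u :=
  (hT e he).lagDensity e.open_target (fun _ hp => hp.2) (A.contDiffOn_comp he) β

theorem IsMetricFamily.isDensity_lagDensity (hT : IsMetricFamily T) (A : OneForm M) (β ε : ℝ) :
    IsDensity fun e => lagDensity β (comp (T ε) e) (A.comp e) := fun _ he _ he' _ hu =>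
  (coordChange_transition he he').lagDensity_eq (hT.coordMetric he' ε)
    ((hT.coordMetric he ε).mono (isOpen_overlap _ _) inter_subset_left)
    (fun _ hz => comp_transition (T ε) he he' hz) (A.contDiffOn_comp he')
    (fun _ hz i => A.comp_transition he he' hz i) β hu

theorem IsMetricFamily.hasDerivAt_lagDensity (hT : IsMetricFamily T) (A : OneForm M) (β ε : ℝ)
    {e : OpenPartialHomeomorph M Coord} (he : e ∈ smoothCharts M) {u : Coord} (hu : u ∈ e.target) :
    HasDerivAt (fun s => lagDensity β (comp (T s) e) (A.comp e) u)
      (linDensity β (comp (T ε) e) (A.comp e) (famDeriv (fun s => comp (T s) e) ε) u) ε :=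
  (hT e he).hasDerivAt_lagDensity (by exact ⟨mem_univ _, hu⟩) β

/-- The Jacobian factor does not involve the parameter and passes through the derivative. Covariance
of the linearized density therefore never has to be derived from its explicit formula. -/
theorem IsMetricFamily.isDensity_deriv (hT : IsMetricFamily T) (A : OneForm M) (β ε : ℝ) :
    IsDensity fun e u => deriv (fun s => lagDensity β (comp (T s) e) (A.comp e) u) ε := by
  intro e he e' he' u hu
  simp only
  rw [← deriv_const_mul_field]
  congr 1
  funext s
  exact hT.isDensity_lagDensity A β s e he e' he' u hu

theorem IsDensity.congr_target {D D' : OpenPartialHomeomorph M Coord → Coord → ℝ}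
    (h : IsDensity D) (hD : ∀ e ∈ smoothCharts M, ∀ u ∈ e.target, D' e u = D e u) :
    IsDensity D' := by
  intro e he e' he' u hu
  rw [hD e he u hu.1, hD e' he' ((e' ∘ e.symm) u) (e'.map_source hu.2)]
  exact h e he e' he' u hu

theorem densityRatio_mul_lagrangianAt (g g' : LorentzMetric M) (A : OneForm M) (β : ℝ) (x : M) :
    densityRatio g (fun e => volDensity (comp g'.val e)) x * lagrangianAt β g' A x =
      densityRatio g (fun e => lagDensity β (comp g'.val e) (A.comp e)) x := by
  simp only [densityRatio, lagrangianAt, lagDensity]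
  ring

variable [IsManifold 𝓘(ℝ, Coord) ∞ M]

theorem densityRatio_congr (g : LorentzMetric M) {D D' : OpenPartialHomeomorph M Coord → Coord → ℝ}
    (hD : ∀ e ∈ smoothCharts M, ∀ u ∈ e.target, D' e u = D e u) (x : M) :
    densityRatio g D' x = densityRatio g D x := by
  rw [densityRatio, densityRatio, hD _ (chartAt_mem_smoothCharts x) _ (mem_chart_target _ _)]

/-- Referred to the fixed volume measure, the integrand and its parameter derivative are jointly
continuous in (ε, x). A bound of the derivative on the compact set [-1, 1] × Δ is a constant
majorant. -/
theorem hasDerivAt_integral_lagrangianAt [MeasurableSpace M] [BorelSpace M] [T2Space M]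
    [SecondCountableTopology M] {g : LorentzMetric M} {Δ : Set M} (hΔ : IsCompact Δ)
    (G : MetricVariation g Δ) (A : OneForm M) (β : ℝ) :
    HasDerivAt (fun ε => ∫ x in Δ, lagrangianAt β (G.metric ε) A x ∂(volumeMeasure (G.metric ε)))
      (∫ x in Δ, densityRatio g (fun e u => linDensity β (comp g.val e) (A.comp e)
        (famDeriv (fun s => comp (G.metric s).val e) 0) u) x ∂(volumeMeasure g)) 0 := by
  have := isLocallyFiniteMeasure_volumeMeasure g
  have hT := G.isMetricFamily
  set F : ℝ → M → ℝ := fun ε => densityRatio g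
    (fun e => lagDensity β (comp (G.metric ε).val e) (A.comp e)) with hF
  set F' : ℝ → M → ℝ := fun ε => densityRatio g
    (fun e u => deriv (fun s => lagDensity β (comp (G.metric s).val e) (A.comp e) u) ε) with hF'
  have hFc : Continuous fun p : ℝ × M => F p.1 p.2 :=
    continuousOn_densityRatio g (fun ε => hT.isDensity_lagDensity A β ε)
      fun e he => (hT.smoothFam_lagDensity A β he).continuousOn
  have hF'c : Continuous fun p : ℝ × M => F' p.1 p.2 :=
    continuousOn_densityRatio g (fun ε => hT.isDensity_deriv A β ε)
      fun e he => ((hT.smoothFam_lagDensity A β he).deriv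
        (isOpen_univ.prod e.open_target)).continuousOn
  have hslice : ∀ {f : ℝ → M → ℝ}, (Continuous fun p : ℝ × M => f p.1 p.2) →
      ∀ ε, Continuous (f ε) := fun hf ε => hf.comp (Continuous.prodMk_right ε)
  have hd : ∀ x ε, HasDerivAt (fun s => F s x) (F' ε x) ε := by
    intro x ε
    simp only [hF, hF', densityRatio]
    refine HasDerivAt.div_const ?_ _
    have := hT.hasDerivAt_lagDensity A β ε (chartAt_mem_smoothCharts x) (mem_chart_target Coord x)
    rwa [this.deriv]
  obtain ⟨C, hC⟩ := ((isCompact_Icc (a := (-1 : ℝ)) (b := 1)).prod hΔ).exists_bound_of_continuousOn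
    hF'c.continuousOn
  have hmain := (hasDerivAt_integral_of_dominated_loc_of_deriv_le
    (μ := (volumeMeasure g).restrict Δ) (F := F) (F' := F') (x₀ := 0) (s := Icc (-1) 1)
    (bound := fun _ => C) (Icc_mem_nhds (by norm_num) (by norm_num))
    (Eventually.of_forall fun ε => (hslice hFc ε).aestronglyMeasurable)
    ((hslice hFc 0).continuousOn.integrableOn_compact hΔ)
    (hslice hF'c 0).aestronglyMeasurable
    ((ae_restrict_iff' hΔ.measurableSet).2 (Eventually.of_forall fun x hx ε hε => hC (ε, x) ⟨hε, hx⟩))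
    (integrableOn_const hΔ.measure_lt_top.ne)
    (Eventually.of_forall fun x ε _ => hd x ε)).2
  have h1 : (fun ε => ∫ x in Δ, lagrangianAt β (G.metric ε) A x ∂(volumeMeasure (G.metric ε))) =
      fun ε => ∫ x in Δ, F ε x ∂(volumeMeasure g) := by
    funext ε
    rw [setIntegral_volumeMeasure_eq g (G.metric ε) hΔ.measurableSet]
    simp only [densityRatio_mul_lagrangianAt, hF]
  have h2 : ∀ x, densityRatio g (fun e u => linDensity β (comp g.val e) (A.comp e)
      (famDeriv (fun s => comp (G.metric s).val e) 0) u) x = F' 0 x := by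
    refine densityRatio_congr g fun e he u hu => ?_
    have := hT.hasDerivAt_lagDensity A β 0 he hu
    rw [this.deriv, G.metric_zero]
  simp only [h1, h2]
  exact hmain

end FirstVariation

/-! ### Divergences with compact support, and linearity of the linearized density. -/

section Divergence

open MeasureTheory Set Filter Topology

variable {U C : Set Coord} {g k : Coord → Matrix (Fin 4) (Fin 4) ℝ} {A : Coord → Coord} {β : ℝ}

theorem IntegrableOn.of_compact {f : Coord → ℝ} (hU : IsOpen U) (hC : IsCompact C) (hCU : C ⊆ U)
    (hf : ContinuousOn f U) (h0 : ∀ x ∈ U \ C, f x = 0) : IntegrableOn f U :=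
  ((hf.mono hCU).integrableOn_compact hC).of_forall_sdiff_eq_zero hU.measurableSet h0

theorem integral_pd_eq_zero {F : Coord → ℝ} (hF : ContDiff ℝ 1 F) (hc : HasCompactSupport F)
    (i : Fin 4) : ∫ x, pd i F x = 0 := by
  have hc' : HasCompactSupport fun x => pd i F x := hc.fderiv_apply ℝ _
  have hcont : Continuous fun x => pd i F x :=
    (hF.continuous_fderiv one_ne_zero).clm_apply continuous_const
  have h := integral_mul_fderiv_eq_neg_fderiv_mul_of_integrable (μ := (volume : Measure Coord))
    (f := fun _ : Coord => (1 : ℝ)) (g := F) (v := Pi.single i 1) (by simp)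
    (by simpa [pd] using hcont.integrable_of_hasCompactSupport hc')
    (by simpa using hF.continuous.integrable_of_hasCompactSupport hc)
    (fun _ _ => differentiableAt_const _) (fun x _ => hF.differentiable one_ne_zero x)
  simpa [pd] using h

/-- The integral of a divergence with compact support vanishes. -/
theorem setIntegral_pd_eq_zero {f : Coord → ℝ} (hU : IsOpen U) (hC : IsCompact C) (hCU : C ⊆ U)
    (hf : ContDiffOn ℝ ∞ f U) (h0 : ∀ x ∈ U \ C, f x = 0) (i : Fin 4) :
    ∫ x in U, pd i f x = 0 := by
  -- Extension of f by zero. It is C¹ since it agrees with f on U and vanishes on the open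
  -- complement of C, and these two sets cover the space.
  set F : Coord → ℝ := C.indicator f with hF
  have hFU : ∀ z ∈ U, F z = f z := by
    intro z hz
    by_cases hzC : z ∈ C
    · exact indicator_of_mem hzC _
    · rw [hF, indicator_of_notMem hzC, h0 z ⟨hz, hzC⟩]
  have hFC : ∀ z ∈ Cᶜ, F z = 0 := fun z hz => indicator_of_notMem hz _
  have hsm : ContDiff ℝ 1 F := by
    rw [contDiff_iff_contDiffAt]
    intro x
    by_cases hx : x ∈ U
    · exact ((hf.contDiffAt (hU.mem_nhds hx)).of_le (by norm_cast)).congr_of_eventuallyEq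
        (eventuallyEq_of_mem (hU.mem_nhds hx) hFU)
    · exact contDiffAt_const.congr_of_eventuallyEq
        (eventuallyEq_of_mem (hC.isClosed.isOpen_compl.mem_nhds fun h => hx (hCU h)) hFC)
  have hcs : HasCompactSupport F := HasCompactSupport.intro hC fun x hx => hFC x hx
  rw [← integral_pd_eq_zero hsm hcs i, ← integral_indicator hU.measurableSet]
  refine integral_congr_ae (Eventually.of_forall fun x => ?_)
  by_cases hx : x ∈ U
  · simp only [indicator_of_mem hx]
    exact (pd_congr_of_mem hU hx hFU i).symm
  · simp only [indicator_of_notMem hx]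
    rw [pd_congr_of_mem hC.isClosed.isOpen_compl (fun h => hx (hCU h)) hFC, pd_const]

theorem contDiffOn_christoffelVar (h : CoordMetric U g)
    (hk : ∀ a b, ContDiffOn ℝ ∞ (fun z => k z a b) U) (i j l : Fin 4) :
    ContDiffOn ℝ ∞ (fun x => christoffelVar g k x i j l) U := by
  unfold christoffelVar
  refine ContDiffOn.add (ContDiffOn.neg (ContDiffOn.sum fun a _ => ContDiffOn.sum fun b _ =>
    ((h.contDiffOn_inv i a).mul (hk a b)).mul (h.contDiffOn_christoffel b j l)))
    (contDiffOn_const.mul (ContDiffOn.sum fun a _ => (h.contDiffOn_inv i a).mul ?_))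
  exact ((contDiffOn_pd h.isOpen (hk a l) j).add (contDiffOn_pd h.isOpen (hk a j) l)).sub
    (contDiffOn_pd h.isOpen (hk j l) a)

theorem contDiffOn_ricciFlux (h : CoordMetric U g)
    (hk : ∀ a b, ContDiffOn ℝ ∞ (fun z => k z a b) U) (i : Fin 4) :
    ContDiffOn ℝ ∞ (fun x => ricciFlux g k x i) U := by
  unfold ricciFlux
  exact h.contDiffOn_volDensity.mul ((ContDiffOn.sum fun j _ => ContDiffOn.sum fun l _ =>
    (h.contDiffOn_inv j l).mul (contDiffOn_christoffelVar h hk i j l)).sub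
    (ContDiffOn.sum fun j _ => (h.contDiffOn_inv i j).mul
      (ContDiffOn.sum fun l _ => contDiffOn_christoffelVar h hk l l j)))

theorem contDiffOn_einsteinMaxwell (h : CoordMetric U g)
    (hA : ∀ i, ContDiffOn ℝ ∞ (fun x => A x i) U) (i j : Fin 4) :
    ContDiffOn ℝ ∞ (fun x => einsteinMaxwell β g A x i j) U := by
  have hF : ∀ i j, ContDiffOn ℝ ∞ (fun x => faraday A x i j) U := fun i j =>
    (contDiffOn_pd h.isOpen (hA j) i).sub (contDiffOn_pd h.isOpen (hA i) j)
  unfold einsteinMaxwell einsteinTensor faradaySq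
  refine ((h.contDiffOn_ricci i j).sub ((contDiffOn_const.mul h.contDiffOn_ricciScalar).mul
    (h.smooth i j))).add (contDiffOn_const.mul (ContDiffOn.sub (contDiffOn_const.mul
      (ContDiffOn.sum fun l _ => ContDiffOn.sum fun m _ =>
        ((hF i l).mul (h.contDiffOn_inv l m)).mul (hF j m)))
    ((contDiffOn_const.mul (h.smooth i j)).mul (ContDiffOn.sum fun i _ => ContDiffOn.sum fun j _ =>
      ContDiffOn.sum fun k _ => ContDiffOn.sum fun l _ => ((((h.contDiffOn_inv i k).mul
        (h.contDiffOn_inv j l)).mul (hF i j)).mul (hF k l))))))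

theorem contDiffOn_eulerLagrange (h : CoordMetric U g)
    (hA : ∀ i, ContDiffOn ℝ ∞ (fun x => A x i) U) (a b : Fin 4) :
    ContDiffOn ℝ ∞ (fun x => eulerLagrange β g A x a b) U := by
  unfold eulerLagrange
  exact (h.contDiffOn_volDensity.mul (ContDiffOn.sum fun i _ => ContDiffOn.sum fun j _ =>
    ((h.contDiffOn_inv a i).mul (contDiffOn_einsteinMaxwell h hA i j)).mul
      (h.contDiffOn_inv j b))).neg

theorem contDiffOn_linDensity (h : CoordMetric U g) (hA : ∀ i, ContDiffOn ℝ ∞ (fun x => A x i) U)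
    (hk : ∀ a b, ContDiffOn ℝ ∞ (fun z => k z a b) U) :
    ContDiffOn ℝ ∞ (linDensity β g A k) U := by
  unfold linDensity
  exact (ContDiffOn.sum fun a _ => ContDiffOn.sum fun b _ =>
    (contDiffOn_eulerLagrange h hA a b).mul (hk a b)).add
    (ContDiffOn.sum fun i _ => contDiffOn_pd h.isOpen (contDiffOn_ricciFlux h hk i) i)

theorem ricciFlux_eq_zero (hU : IsOpen U) (hk : ∀ z ∈ U, k z = 0) {x : Coord} (hx : x ∈ U)
    (i : Fin 4) : ricciFlux g k x i = 0 := by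
  have h1 : ∀ i a b, pd i (fun z => k z a b) x = 0 := fun i a b => by
    rw [pd_congr_of_mem hU hx (g := fun _ => (0 : ℝ)) fun z hz => by rw [hk z hz]; rfl]
    exact pd_const _ _ _
  simp [ricciFlux, christoffelVar, h1, hk x hx]

theorem linDensity_eq_zero (hU : IsOpen U) (hk : ∀ z ∈ U, k z = 0) {x : Coord} (hx : x ∈ U) :
    linDensity β g A k x = 0 := by
  have h1 : ∀ i, pd i (fun z => ricciFlux g k z i) x = 0 := fun i => by
    rw [pd_congr_of_mem hU hx (g := fun _ => (0 : ℝ)) fun z hz => ricciFlux_eq_zero hU hk hz i]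
    exact pd_const _ _ _
  simp [linDensity, h1, hk x hx]

/-- After integration only the Euler–Lagrange expression remains of the linearized Lagrange
density. -/
theorem setIntegral_linDensity (h : CoordMetric U g) (hA : ∀ i, ContDiffOn ℝ ∞ (fun x => A x i) U)
    (hk : ∀ a b, ContDiffOn ℝ ∞ (fun z => k z a b) U) (hC : IsCompact C) (hCU : C ⊆ U)
    (h0 : ∀ z ∈ U \ C, k z = 0) :
    ∫ x in U, linDensity β g A k x = ∫ x in U, ∑ a, ∑ b, eulerLagrange β g A x a b * k x a b := by
  have hUC : IsOpen (U \ C) := h.isOpen.sdiff hC.isClosed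
  have hflux0 : ∀ i, ∀ x ∈ U \ C, ricciFlux g k x i = 0 := fun i x hx =>
    ricciFlux_eq_zero hUC h0 hx i
  have h1 : IntegrableOn (fun x => ∑ a, ∑ b, eulerLagrange β g A x a b * k x a b) U := by
    refine IntegrableOn.of_compact h.isOpen hC hCU (ContDiffOn.continuousOn (𝕜 := ℝ) (n := ∞)
      (ContDiffOn.sum fun a _ => ContDiffOn.sum fun b _ =>
        (contDiffOn_eulerLagrange h hA a b).mul (hk a b))) fun x hx => by simp [h0 x hx]
  have h2 : ∀ i, IntegrableOn (fun x => pd i (fun z => ricciFlux g k z i) x) U := fun i => by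
    refine IntegrableOn.of_compact h.isOpen hC hCU (contDiffOn_pd h.isOpen
      (contDiffOn_ricciFlux h hk i) i).continuousOn fun x hx => ?_
    rw [pd_congr_of_mem hUC hx (g := fun _ => (0 : ℝ)) (hflux0 i)]
    exact pd_const _ _ _
  have h3 : ∀ i, ∫ x in U, pd i (fun z => ricciFlux g k z i) x = 0 := fun i =>
    setIntegral_pd_eq_zero h.isOpen hC hCU (contDiffOn_ricciFlux h hk i) (hflux0 i) i
  unfold linDensity
  rw [integral_add h1 (integrable_finsetSum _ fun i _ => h2 i),
    integral_finsetSum _ fun i _ => h2 i]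
  simp [h3]

variable {k' : Coord → Matrix (Fin 4) (Fin 4) ℝ}

theorem ricciFlux_add {x : Coord} (hk : ∀ a b, DifferentiableAt ℝ (fun z => k z a b) x)
    (hk' : ∀ a b, DifferentiableAt ℝ (fun z => k' z a b) x) (i : Fin 4) :
    ricciFlux g (fun z => k z + k' z) x i = ricciFlux g k x i + ricciFlux g k' x i := by
  have h1 : ∀ i j l, christoffelVar g (fun z => k z + k' z) x i j l =
      christoffelVar g k x i j l + christoffelVar g k' x i j l := by
    intro i j l
    have hp : ∀ i a b, pd i (fun z => k z a b + k' z a b) x =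
        pd i (fun z => k z a b) x + pd i (fun z => k' z a b) x :=
      fun i a b => pd_add (hk a b) (hk' a b) i
    simp only [christoffelVar, hp, Matrix.add_apply, mul_add, add_mul, mul_sub,
      Finset.sum_add_distrib, Finset.sum_sub_distrib]
    ring
  simp only [ricciFlux, h1, mul_add, mul_sub, Finset.sum_add_distrib]
  ring

theorem linDensity_add (h : CoordMetric U g) (hk : ∀ a b, ContDiffOn ℝ ∞ (fun z => k z a b) U)
    (hk' : ∀ a b, ContDiffOn ℝ ∞ (fun z => k' z a b) U) {x : Coord} (hx : x ∈ U) :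
    linDensity β g A (fun z => k z + k' z) x = linDensity β g A k x + linDensity β g A k' x := by
  have hd : ∀ {f : Coord → ℝ}, ContDiffOn ℝ ∞ f U → ∀ z ∈ U, DifferentiableAt ℝ f z :=
    fun hf z hz => (hf.contDiffAt (h.isOpen.mem_nhds hz)).differentiableAt (by simp)
  have h1 : ∀ i, pd i (fun z => ricciFlux g (fun z => k z + k' z) z i) x =
      pd i (fun z => ricciFlux g k z i) x + pd i (fun z => ricciFlux g k' z i) x := by
    intro i
    rw [pd_congr_of_mem h.isOpen hx fun z hz => ricciFlux_add (fun a b => hd (hk a b) z hz)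
      (fun a b => hd (hk' a b) z hz) i]
    exact pd_add (hd (contDiffOn_ricciFlux h hk i) x hx) (hd (contDiffOn_ricciFlux h hk' i) x hx) i
  simp only [linDensity, h1, Matrix.add_apply, mul_add, Finset.sum_add_distrib]
  ring

/-- Needed to split a direction of variation by a partition of unity. -/
theorem linDensity_sum {ι : Type*} (h : CoordMetric U g) (s : Finset ι)
    {k : ι → Coord → Matrix (Fin 4) (Fin 4) ℝ}
    (hk : ∀ c a b, ContDiffOn ℝ ∞ (fun z => k c z a b) U) {x : Coord} (hx : x ∈ U) :
    linDensity β g A (fun z => ∑ c ∈ s, k c z) x = ∑ c ∈ s, linDensity β g A (k c) x := by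
  classical
  induction s using Finset.induction_on with
  | empty => simpa using linDensity_eq_zero isOpen_univ (fun _ _ => rfl) (mem_univ x)
  | insert c s hc ih =>
    simp only [Finset.sum_insert hc]
    rw [linDensity_add h (hk c) (fun a b => ?_) hx, ih]
    simp only [Matrix.sum_apply]
    exact ContDiffOn.sum fun d _ => hk d a b

end Divergence

/-! ### Vanishing of the first variation when the field equations hold. -/

section Stationary

open MeasureTheory Set Filter Topology

variable {M : Type*} [TopologicalSpace M] [ChartedSpace Coord M]
  {T : ℝ → ∀ x : M, LinearMap.BilinForm ℝ (TangentSpace 𝓘(ℝ, Coord) x)}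

/-- The derivative at the parameter `0` of the components of a family of bilinear forms. -/
noncomputable abbrev compDeriv (T : ℝ → ∀ x : M, LinearMap.BilinForm ℝ (TangentSpace 𝓘(ℝ, Coord) x))
    (e : OpenPartialHomeomorph M Coord) : Coord → Matrix (Fin 4) (Fin 4) ℝ :=
  famDeriv (fun s => comp (T s) e) 0

theorem IsMetricFamily.contDiffOn_compDeriv (hT : IsMetricFamily T)
    {e : OpenPartialHomeomorph M Coord} (he : e ∈ smoothCharts M) (a b : Fin 4) :
    ContDiffOn ℝ ∞ (fun u => compDeriv T e u a b) e.target :=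
  (((hT e he).smooth a b).deriv (hT e he).isOpen).contDiffOn_zero 0

theorem compDeriv_eq_zero {g : ∀ x : M, LinearMap.BilinForm ℝ (TangentSpace 𝓘(ℝ, Coord) x)}
    {C : Set M} (hC : ∀ ε, ∀ x ∉ C, T ε x = g x) (e : OpenPartialHomeomorph M Coord) {u : Coord}
    (hu : e.symm u ∉ C) : compDeriv T e u = 0 := by
  ext a b
  have : (fun s => comp (T s) e u a b) = fun _ => g (e.symm u) (frame e u a) (frame e u b) := by
    funext s
    simp only [comp, Matrix.of_apply, hC s _ hu]
  simp only [compDeriv, famDeriv, Matrix.of_apply, this, deriv_const, Matrix.zero_apply]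

theorem linDensity_compDeriv_eq_zero [T2Space M]
    {g : ∀ x : M, LinearMap.BilinForm ℝ (TangentSpace 𝓘(ℝ, Coord) x)}
    {C : Set M} (hCc : IsCompact C) (hC : ∀ ε, ∀ x ∉ C, T ε x = g x)
    (e : OpenPartialHomeomorph M Coord) {u : Coord} (hu : u ∈ e.target) (huC : e.symm u ∉ C)
    (A : Coord → Coord) (β : ℝ) (m : Coord → Matrix (Fin 4) (Fin 4) ℝ) :
    linDensity β m A (compDeriv T e) u = 0 :=
  linDensity_eq_zero (e.symm.isOpen_inter_preimage hCc.isClosed.isOpen_compl)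
    (fun _ hz => compDeriv_eq_zero hC e hz.2) ⟨hu, huC⟩

theorem SmoothFam.reparam {O W : Set (ℝ × Coord)} {f : ℝ → Coord → ℝ} (h : SmoothFam O f)
    {r : ℝ → Coord → ℝ} (hr : SmoothFam W r) (hW : ∀ p ∈ W, (r p.1 p.2, p.2) ∈ O) :
    SmoothFam W fun ε u => f (r ε u) u :=
  ContDiffOn.comp (g := fun p : ℝ × Coord => f p.1 p.2) (f := fun p : ℝ × Coord => (r p.1 p.2, p.2))
    h (ContDiffOn.prodMk hr contDiffOn_snd) hW

theorem contDiffOn_comp_symm {f : M → ℝ} (hf : ContMDiff 𝓘(ℝ, Coord) 𝓘(ℝ) ∞ f)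
    {e : OpenPartialHomeomorph M Coord} (he : e ∈ smoothCharts M) :
    ContDiffOn ℝ ∞ (fun u => f (e.symm u)) e.target :=
  contMDiffOn_iff_contDiffOn.1 (hf.comp_contMDiffOn (contMDiffOn_symm_of_mem_maximalAtlas he))

/-- Rescaling of the parameter by a smooth function on `M`. -/
theorem IsMetricFamily.rescale (hT : IsMetricFamily T) {f : M → ℝ}
    (hf : ContMDiff 𝓘(ℝ, Coord) 𝓘(ℝ) ∞ f) : IsMetricFamily fun ε x => T (f x * ε) x := by
  intro e he
  have hr : SmoothFam (univ ×ˢ e.target) fun ε u => f (e.symm u) * ε :=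
    ContDiffOn.mul ((contDiffOn_comp_symm hf he).comp contDiffOn_snd fun _ hp => hp.2) contDiffOn_fst
  refine ⟨(hT e he).isOpen, fun i j => ?_, fun p hp => ?_, fun p hp => ?_⟩
  · exact ((hT e he).smooth i j).reparam hr fun p hp => ⟨mem_univ _, hp.2⟩
  · exact (hT e he).symm (f (e.symm p.2) * p.1, p.2) ⟨mem_univ _, hp.2⟩
  · exact (hT e he).det_ne (f (e.symm p.2) * p.1, p.2) ⟨mem_univ _, hp.2⟩

/-- Slowing the parameter down by f(x) multiplies the direction by f at parameter 0. This cuts a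
variation off without leaving the given non-degenerate forms, which adding a cut-off multiple of the
direction would not guarantee. -/
theorem compDeriv_rescale (f : M → ℝ) (e : OpenPartialHomeomorph M Coord) (u : Coord) :
    compDeriv (fun ε x => T (f x * ε) x) e u = f (e.symm u) • compDeriv T e u := by
  ext a b
  have := deriv_comp_mul_left (f (e.symm u)) (fun s => comp (T s) e u a b) 0
  rw [mul_zero] at this
  exact this

variable {g : LorentzMetric M}

theorem IsMetricFamily.isDensity_linDensity (hT : IsMetricFamily T) (h0 : T 0 = g.val)
    (A : OneForm M) (β : ℝ) :
    IsDensity fun e => linDensity β (comp g.val e) (A.comp e) (compDeriv T e) :=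
  (hT.isDensity_deriv A β 0).congr_target fun _ he u hu => by
    rw [(hT.hasDerivAt_lagDensity A β 0 he hu).deriv, h0]

theorem IsMetricFamily.contDiffOn_linDensity (hT : IsMetricFamily T)
    (A : OneForm M) (β : ℝ) {e : OpenPartialHomeomorph M Coord} (he : e ∈ smoothCharts M) :
    ContDiffOn ℝ ∞ (linDensity β (comp g.val e) (A.comp e) (compDeriv T e)) e.target :=
  EinsteinMaxwell.contDiffOn_linDensity (g.coordMetric he) (A.contDiffOn_comp he)
    (hT.contDiffOn_compDeriv he)

variable [IsManifold 𝓘(ℝ, Coord) ∞ M] 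

theorem IsMetricFamily.continuous_densityRatio (hT : IsMetricFamily T) (h0 : T 0 = g.val)
    (A : OneForm M) (β : ℝ) :
    Continuous (densityRatio g fun e => linDensity β (comp g.val e) (A.comp e) (compDeriv T e)) :=
  EinsteinMaxwell.continuous_densityRatio g (hT.isDensity_linDensity h0 A β)
    fun _ he => (hT.contDiffOn_linDensity A β he).continuousOn

variable [MeasurableSpace M] [BorelSpace M] [T2Space M]

/-- The first variation in a direction which is supported in a chart domain. -/
theorem IsMetricFamily.setIntegral_linDensity (hT : IsMetricFamily T) (h0 : T 0 = g.val)
    (A : OneForm M) (β : ℝ) {e : OpenPartialHomeomorph M Coord} (he : e ∈ atlas Coord M)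
    {C Δ : Set M} (hCc : IsCompact C) (hCe : C ⊆ e.source) (hCΔ : C ⊆ Δ) (hΔ : MeasurableSet Δ)
    (hC : ∀ ε, ∀ x ∉ C, T ε x = g.val x) :
    ∫ x in Δ, densityRatio g (fun e => linDensity β (comp g.val e) (A.comp e) (compDeriv T e)) x
        ∂(volumeMeasure g) =
      ∫ u in e.target, ∑ a, ∑ b,
        eulerLagrange β (comp g.val e) (A.comp e) u a b * compDeriv T e u a b := by
  have hes := mem_smoothCharts_of_mem_atlas he
  set D : OpenPartialHomeomorph M Coord → Coord → ℝ :=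
    fun e => linDensity β (comp g.val e) (A.comp e) (compDeriv T e) with hD
  have hzero : ∀ x ∉ C, densityRatio g D x = 0 := by
    intro x hx
    have : D (chartAt Coord x) (chartAt Coord x x) = 0 :=
      linDensity_compDeriv_eq_zero hCc hC _ (mem_chart_target _ _)
        (by rwa [(chartAt Coord x).left_inv (mem_chart_source _ _)]) _ _ _
    rw [densityRatio, this, zero_div]
  have hdens := hT.isDensity_linDensity h0 A β
  -- The integrand vanishes off C, so the domain is shrunk from Δ to C and then enlarged to the
  -- chart domain, where the divergence can be integrated away.
  rw [setIntegral_eq_of_subset_of_forall_sdiff_eq_zero hΔ hCΔ fun x hx => hzero x hx.2,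
    ← setIntegral_eq_of_subset_of_forall_sdiff_eq_zero e.open_source.measurableSet hCe
      fun x hx => hzero x hx.2,
    setIntegral_source_eq g he (hT.continuous_densityRatio h0 A β).continuousOn,
    ← EinsteinMaxwell.setIntegral_linDensity (C := e '' C) (g.coordMetric hes)
      (A.contDiffOn_comp hes) (hT.contDiffOn_compDeriv hes)
      (hCc.image_of_continuousOn (e.continuousOn.mono hCe))
      (by rintro _ ⟨x, hx, rfl⟩; exact e.map_source (hCe hx))
      (fun u hu => compDeriv_eq_zero hC e fun h => hu.2 ⟨_, h, e.right_inv hu.1⟩)]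
  exact setIntegral_congr_fun e.open_target.measurableSet fun u hu =>
    volDensity_mul_densityRatio g hdens hes hu

variable [SecondCountableTopology M]

theorem setIntegral_linDensity_eq_zero {Δ : Set M} (hΔ : IsCompact Δ)
    (G : MetricVariation g Δ) (A : OneForm M) (β : ℝ)
    (hEL : ∀ e ∈ smoothCharts M, ∀ u ∈ e.target, e.symm u ∈ interior Δ → ∀ a b,
      eulerLagrange β (comp g.val e) (A.comp e) u a b = 0) :
    ∫ x in Δ, densityRatio g (fun e => linDensity β (comp g.val e) (A.comp e)
      (compDeriv (fun ε => (G.metric ε).val) e)) x ∂(volumeMeasure g) = 0 := by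
  have := isLocallyFiniteMeasure_volumeMeasure g
  have : LocallyCompactSpace M := ChartedSpace.locallyCompactSpace Coord M
  obtain ⟨K, hK, hKΔ, hGK⟩ := G.support
  obtain ⟨ρ, hρ⟩ := SmoothPartitionOfUnity.exists_isSubordinate_chartAt_source 𝓘(ℝ, Coord) M
  set T : ℝ → ∀ x : M, LinearMap.BilinForm ℝ (TangentSpace 𝓘(ℝ, Coord) x) :=
    fun ε => (G.metric ε).val with hTdef
  have hT : IsMetricFamily T := G.isMetricFamily
  have hT0 : T 0 = g.val := by rw [hTdef]; simp only [G.metric_zero]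
  -- The c-th piece of the variation, supported in K and in the support of ρ c, hence in the domain
  -- of the chart at c.
  set S : M → ℝ → ∀ x : M, LinearMap.BilinForm ℝ (TangentSpace 𝓘(ℝ, Coord) x) :=
    fun c ε x => T (ρ c x * ε) x with hSdef
  have hS : ∀ c, IsMetricFamily (S c) := fun c => hT.rescale (ρ c).contMDiff
  have hS0 : ∀ c, S c 0 = g.val := fun c => by
    funext x; simp only [hSdef, mul_zero, hT0]
  have hfin : {c | (Function.support (ρ c) ∩ K).Nonempty}.Finite :=
    -- Only the finitely many functions that meet K matter, as the direction vanishes off K.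
    ρ.locallyFinite.finite_nonempty_inter_compact hK
  set F := hfin.toFinset with hF
  have hsum : ∀ x ∈ K, ∑ c ∈ F, ρ c x = 1 := by
    intro x hx
    rw [← ρ.sum_eq_one (mem_univ x)]
    refine (finsum_eq_sum_of_support_subset _ fun c hc => ?_).symm
    simp only [hF, Finite.coe_toFinset, mem_ofPred_eq]
    exact ⟨x, hc, hx⟩
  have hderiv : ∀ e u, compDeriv T e u = ∑ c ∈ F, compDeriv (S c) e u := by
    intro e u
    simp only [hSdef, compDeriv_rescale]
    rw [← Finset.sum_smul]
    by_cases hu : e.symm u ∈ K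
    · rw [hsum _ hu, one_smul]
    · rw [compDeriv_eq_zero hGK e hu, smul_zero]
  have hlin : ∀ x, densityRatio g (fun e => linDensity β (comp g.val e) (A.comp e) (compDeriv T e)) x
      = ∑ c ∈ F, densityRatio g
        (fun e => linDensity β (comp g.val e) (A.comp e) (compDeriv (S c) e)) x := by
    intro x
    have he := chartAt_mem_smoothCharts x
    have h1 : compDeriv T (chartAt Coord x) = fun u => ∑ c ∈ F, compDeriv (S c) (chartAt Coord x) u :=
      funext fun u => hderiv _ u
    simp only [densityRatio]
    rw [h1, linDensity_sum (g.coordMetric he) F (fun c => (hS c).contDiffOn_compDeriv he)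
      (mem_chart_target Coord x), Finset.sum_div]
  simp only [hlin]
  rw [integral_finsetSum _ fun c _ => ((hS c).continuous_densityRatio (hS0 c) A
    β).continuousOn.integrableOn_compact hΔ]
  refine Finset.sum_eq_zero fun c _ => ?_
  have hSC : ∀ ε, ∀ x ∉ K ∩ tsupport (ρ c), S c ε x = g.val x := by
    intro ε x hx
    by_cases hxK : x ∈ K
    · have : ρ c x = 0 := image_eq_zero_of_notMem_tsupport fun h => hx ⟨hxK, h⟩
      simp only [hSdef, this, zero_mul, hT0]
    · exact hGK _ x hxK
  rw [(hS c).setIntegral_linDensity (hS0 c) A β (chart_mem_atlas Coord c)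
    (hK.inter_right (isClosed_tsupport _)) (inter_subset_right.trans (hρ c))
    ((inter_subset_left.trans hKΔ).trans interior_subset) hΔ.measurableSet hSC]
  refine (setIntegral_congr_fun (g := fun _ => (0 : ℝ)) (chartAt Coord c).open_target.measurableSet
    fun u hu => ?_).trans (by simp)
  refine Finset.sum_eq_zero fun a _ => Finset.sum_eq_zero fun b _ => ?_
  by_cases huK : (chartAt Coord c).symm u ∈ K ∩ tsupport (ρ c)
  · rw [hEL _ (chartAt_mem_smoothCharts c) u hu (hKΔ huK.1), zero_mul]
  · rw [compDeriv_eq_zero hSC _ huK, Matrix.zero_apply, mul_zero]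

end Stationary

/-! ### Openness of the Lorentz signature. -/

section LorentzOpen

open Set Filter Topology

/-- The bilinear form `m_ij vⁱ wʲ`. -/
def bilin (m : Matrix (Fin 4) (Fin 4) ℝ) (v w : Coord) : ℝ := ∑ i, ∑ j, m i j * v i * w j

/-- `σ m` has signature `(+,-,-,-)`. -/
def HasLorentzSignature (σ : ℝ) (m : Matrix (Fin 4) (Fin 4) ℝ) : Prop :=
  ∃ t, 0 < σ * bilin m t t ∧ ∀ w, w ≠ 0 → bilin m t w = 0 → σ * bilin m w w < 0

theorem bilin_smul (m : Matrix (Fin 4) (Fin 4) ℝ) (r s : ℝ) (v w : Coord) :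
    bilin m (r • v) (s • w) = r * s * bilin m v w := by
  simp only [bilin, Finset.mul_sum, Pi.smul_apply, smul_eq_mul]
  exact Finset.sum_congr rfl fun a _ => Finset.sum_congr rfl fun b _ => by ring

theorem continuous_bilin {X : Type*} [TopologicalSpace X] {m : X → Matrix (Fin 4) (Fin 4) ℝ}
    {v w : X → Coord} (hm : Continuous m) (hv : Continuous v) (hw : Continuous w) :
    Continuous fun x => bilin (m x) (v x) (w x) := by
  unfold bilin
  exact continuous_finsetSum _ fun i _ => continuous_finsetSum _ fun j _ =>
    ((hm.matrix_elem i j).mul (continuous_pi_iff.1 hv i)).mul (continuous_pi_iff.1 hw j)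

theorem bilin_symm {m : Matrix (Fin 4) (Fin 4) ℝ} (hm : ∀ i j, m i j = m j i) (v w : Coord) :
    bilin m v w = bilin m w v := by
  rw [bilin, bilin, Finset.sum_comm]
  exact Finset.sum_congr rfl fun a _ => Finset.sum_congr rfl fun b _ => by rw [hm b a]; ring

theorem toBilin'_eq_bilin (m : Matrix (Fin 4) (Fin 4) ℝ) (v w : Coord) :
    Matrix.toBilin' m v w = bilin m v w := by
  rw [Matrix.toBilin'_apply]
  exact Finset.sum_congr rfl fun a _ => Finset.sum_congr rfl fun b _ => by ring

/-- The same timelike vector t works for all nearby matrices. By homogeneity the second condition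
concerns only unit vectors w, where "not orthogonal to t, or negative" is open in (m, w);
compactness of the sphere gives one neighbourhood for all w. -/
theorem isOpen_hasLorentzSignature (σ : ℝ) : IsOpen {m | HasLorentzSignature σ m} := by
  rw [isOpen_iff_mem_nhds]
  rintro m₀ ⟨t, ht, hn⟩
  have h1 : ∀ᶠ m in 𝓝 m₀, 0 < σ * bilin m t t := by
    have : Continuous fun m => σ * bilin m t t :=
      continuous_const.mul (continuous_bilin continuous_id continuous_const continuous_const)
    exact this.continuousAt.eventually (lt_mem_nhds ht)
  have h2 : ∀ᶠ m in 𝓝 m₀, ∀ w ∈ Metric.sphere (0 : Coord) 1,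
      bilin m t w ≠ 0 ∨ σ * bilin m w w < 0 := by
    refine (isCompact_sphere (0 : Coord) 1).eventually_forall_of_forall_eventually fun w hw => ?_
    have hw0 : w ≠ 0 := by rintro rfl; simp at hw
    have hc1 : Continuous fun p : Matrix (Fin 4) (Fin 4) ℝ × Coord => bilin p.1 t p.2 :=
      continuous_bilin continuous_fst continuous_const continuous_snd
    have hc2 : Continuous fun p : Matrix (Fin 4) (Fin 4) ℝ × Coord => σ * bilin p.1 p.2 p.2 :=
      continuous_const.mul (continuous_bilin continuous_fst continuous_snd continuous_snd)
    by_cases h : bilin m₀ t w = 0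
    · filter_upwards [(isOpen_lt hc2 continuous_const).mem_nhds
        (show ((m₀, w) : Matrix (Fin 4) (Fin 4) ℝ × Coord) ∈ _ from hn w hw0 h)] with p hp
      exact Or.inr hp
    · filter_upwards [(isOpen_ne_fun hc1 continuous_const).mem_nhds
        (show ((m₀, w) : Matrix (Fin 4) (Fin 4) ℝ × Coord) ∈ _ from h)] with p hp
      exact Or.inl hp
  filter_upwards [h1, h2] with m hm1 hm2
  refine ⟨t, hm1, fun w hw h0 => ?_⟩
  have hn0 : ‖w‖ ≠ 0 := norm_ne_zero_iff.2 hw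
  have h3 := hm2 (‖w‖⁻¹ • w) (by simp [norm_smul, hn0])
  have h4 : bilin m t (‖w‖⁻¹ • w) = 0 := by
    have := bilin_smul m 1 ‖w‖⁻¹ t w
    rw [one_smul, h0, mul_zero] at this; exact this
  have h5 := h3.resolve_left (not_not.2 h4)
  rw [bilin_smul] at h5
  have h6 : 0 < ‖w‖⁻¹ * ‖w‖⁻¹ := by positivity
  have h7 : (‖w‖⁻¹ * ‖w‖⁻¹) * (σ * bilin m w w) < 0 := by linarith
  exact (pos_iff_neg_of_mul_neg h7).1 h6

end LorentzOpen

/-! ### Bilinear forms prescribed by their components in a chart. -/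

section ChartForm

open Set Filter Topology

variable {M : Type*} [TopologicalSpace M] [ChartedSpace Coord M]

theorem hasLorentzSignature_comp_iff
    (T : ∀ x : M, LinearMap.BilinForm ℝ (TangentSpace 𝓘(ℝ, Coord) x)) (σ : ℝ)
    {e : OpenPartialHomeomorph M Coord} (he : e ∈ smoothCharts M) {u : Coord} (hu : u ∈ e.target) :
    HasLorentzSignature σ (comp T e u) ↔ ∃ t, 0 < σ * T (e.symm u) t t ∧
      ∀ w, w ≠ 0 → T (e.symm u) t w = 0 → σ * T (e.symm u) w w < 0 := by
  have hb := tangentVec_bijective he hu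
  have h0 : tangentVec e u 0 = 0 := by simp only [tangentVec]; exact map_zero _
  have hT : ∀ v w, T (e.symm u) (tangentVec e u v) (tangentVec e u w) = bilin (comp T e u) v w :=
    apply_tangentVec T e u
  constructor
  · rintro ⟨t, ht, hn⟩
    refine ⟨tangentVec e u t, by rwa [hT], fun w hw h => ?_⟩
    obtain ⟨w, rfl⟩ := hb.2 w
    rw [hT] at h ⊢
    exact hn w (fun h => hw (by rw [h, h0])) h
  · rintro ⟨t, ht, hn⟩
    obtain ⟨t, rfl⟩ := hb.2 t
    refine ⟨t, by rwa [hT] at ht, fun w hw h => ?_⟩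
    rw [← hT] at h ⊢
    exact hn _ (fun h => hw (hb.1 (h.trans h0.symm))) h

/-- The bilinear form on `T_x M` with components `m` in the chart `e`. -/
noncomputable def chartForm (e : OpenPartialHomeomorph M Coord) (m : Matrix (Fin 4) (Fin 4) ℝ)
    (x : M) : LinearMap.BilinForm ℝ (TangentSpace 𝓘(ℝ, Coord) x) :=
  let d : TangentSpace 𝓘(ℝ, Coord) x →ₗ[ℝ] Coord :=
    (mfderiv 𝓘(ℝ, Coord) 𝓘(ℝ, Coord) e x).toLinearMap
  (Matrix.toBilin' m).compl₁₂ d d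

theorem chartForm_apply (e : OpenPartialHomeomorph M Coord) (m : Matrix (Fin 4) (Fin 4) ℝ)
    (x : M) (v w : TangentSpace 𝓘(ℝ, Coord) x) :
    chartForm e m x v w = bilin m (mfderiv 𝓘(ℝ, Coord) 𝓘(ℝ, Coord) e x v)
      (mfderiv 𝓘(ℝ, Coord) 𝓘(ℝ, Coord) e x w) :=
  toBilin'_eq_bilin m _ _

theorem chartForm_symm (e : OpenPartialHomeomorph M Coord) {m : Matrix (Fin 4) (Fin 4) ℝ}
    (hm : ∀ i j, m i j = m j i) (x : M) (v w : TangentSpace 𝓘(ℝ, Coord) x) :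
    chartForm e m x v w = chartForm e m x w v :=
  (chartForm_apply e m x v w).trans ((bilin_symm hm _ _).trans (chartForm_apply e m x w v).symm)

theorem bilin_single (m : Matrix (Fin 4) (Fin 4) ℝ) (i j : Fin 4) :
    bilin m (Pi.single i 1) (Pi.single j 1) = m i j := by
  simp [bilin, Pi.single_apply]

theorem comp_chartForm {e : OpenPartialHomeomorph M Coord} (he : e ∈ smoothCharts M)
    (m : M → Matrix (Fin 4) (Fin 4) ℝ) {u : Coord} (hu : u ∈ e.target) :
    comp (fun x => chartForm e (m x) x) e u = m (e.symm u) := by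
  ext i j
  have h : ∀ y : Coord, (mfderiv 𝓘(ℝ, Coord) 𝓘(ℝ, Coord) e (e.symm u) (tangentVec e u y) : Coord)
      = y := fun y => by
    have := (mdifferentiable_of_mem_smoothCharts he).comp_symm_deriv hu
    exact DFunLike.congr_fun this y
  refine (chartForm_apply e _ _ _ _).trans ?_
  refine (congrArg₂ (bilin (m (e.symm u))) (h _) (h _)).trans ?_
  exact bilin_single _ _ _

theorem comp_chartForm_overlap {e e₀ : OpenPartialHomeomorph M Coord} (he : e ∈ smoothCharts M)
    (he₀ : e₀ ∈ smoothCharts M) (m : M → Matrix (Fin 4) (Fin 4) ℝ) {u : Coord}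
    (hu : u ∈ overlap e e₀) :
    comp (fun x => chartForm e₀ (m x) x) e u =
      (jac (e₀ ∘ e.symm) u).transpose * m (e.symm u) * jac (e₀ ∘ e.symm) u := by
  rw [comp_transition _ he he₀ hu, Function.comp_apply, comp_chartForm he₀ m (e₀.map_source hu.2),
    e₀.left_inv hu.2]

theorem contDiffOn_jac {e e₀ : OpenPartialHomeomorph M Coord} (he : e ∈ smoothCharts M)
    (he₀ : e₀ ∈ smoothCharts M) (a i : Fin 4) :
    ContDiffOn ℝ ∞ (fun u => jac (e₀ ∘ e.symm) u a i) (overlap e e₀) :=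
  contDiffOn_pd (isOpen_overlap e e₀) ((coordChange_transition he he₀).smooth a) i

/-- A smooth function with support in a chart domain times a form with constant components in this
chart has smooth components in all charts. -/
theorem contDiffOn_mul_comp_chartForm {e e₀ : OpenPartialHomeomorph M Coord}
    (he : e ∈ smoothCharts M) (he₀ : e₀ ∈ smoothCharts M) {f : M → ℝ}
    (hf : ContMDiff 𝓘(ℝ, Coord) 𝓘(ℝ) ∞ f) (hsupp : tsupport f ⊆ e₀.source)
    (m : Matrix (Fin 4) (Fin 4) ℝ) (i j : Fin 4) :
    ContDiffOn ℝ ∞ (fun u => f (e.symm u) * comp (fun x => chartForm e₀ m x) e u i j) e.target := by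
  intro u hu
  by_cases h : e.symm u ∈ e₀.source
  · have ho : overlap e e₀ ∈ 𝓝 u := (isOpen_overlap e e₀).mem_nhds ⟨hu, h⟩
    have h1 : ContDiffOn ℝ ∞ (fun u => ∑ b, (∑ a, jac (e₀ ∘ e.symm) u a i * m a b) *
        jac (e₀ ∘ e.symm) u b j) (overlap e e₀) :=
      ContDiffOn.sum fun b _ => (ContDiffOn.sum fun a _ =>
        (contDiffOn_jac he he₀ a i).mul contDiffOn_const).mul (contDiffOn_jac he he₀ b j)
    refine (((((contDiffOn_comp_symm hf he).mono inter_subset_left).mul h1).contDiffAt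
      ho).congr_of_eventuallyEq ?_).contDiffWithinAt
    filter_upwards [ho] with z hz
    rw [comp_chartForm_overlap he he₀ (fun _ => m) hz]
    simp only [Matrix.mul_apply, Matrix.transpose_apply]
  · have ho : e.target ∩ e.symm ⁻¹' (tsupport f)ᶜ ∈ 𝓝 u :=
      (e.symm.isOpen_inter_preimage (isClosed_tsupport f).isOpen_compl).mem_nhds
        ⟨hu, fun h' => h (hsupp h')⟩
    refine (contDiffAt_const (c := (0 : ℝ)).congr_of_eventuallyEq ?_).contDiffWithinAt
    filter_upwards [ho] with z hz
    rw [image_eq_zero_of_notMem_tsupport hz.2, zero_mul]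

end ChartForm

/-! ### Construction of variations supported in a chart. -/

section BumpVariation

open Set Filter Topology

variable {M : Type*} [TopologicalSpace M] [ChartedSpace Coord M] 

theorem comp_add_smul (S P : ∀ x : M, LinearMap.BilinForm ℝ (TangentSpace 𝓘(ℝ, Coord) x))
    (r : M → ℝ) (e : OpenPartialHomeomorph M Coord) (u : Coord) :
    comp (fun x => S x + r x • P x) e u = comp S e u + r (e.symm u) • comp P e u := by
  ext i j; rfl

/-- A compactly supported variation of the metric, in a direction with constant components in the
given chart. -/
theorem exists_variation (g : LorentzMetric M) {e₀ : OpenPartialHomeomorph M Coord}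
    (he₀ : e₀ ∈ smoothCharts M) {f : M → ℝ} (hf : ContMDiff 𝓘(ℝ, Coord) 𝓘(ℝ) ∞ f)
    (hf01 : ∀ x, |f x| ≤ 1) {Δ : Set M} (hfc : IsCompact (tsupport f)) (hfe : tsupport f ⊆ e₀.source)
    (hfΔ : tsupport f ⊆ interior Δ) {m : Matrix (Fin 4) (Fin 4) ℝ} (hm : ∀ i j, m i j = m j i) :
    ∃ (G : MetricVariation g Δ) (δ : ℝ), 0 < δ ∧
      (∀ ε, ∀ x ∉ tsupport f, (G.metric ε).val x = g.val x) ∧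
      ∀ u ∈ e₀.target, compDeriv (fun ε => (G.metric ε).val) e₀ u = (δ * f (e₀.symm u)) • m := by
  obtain ⟨σ, hσ, hg⟩ := g.lorentzian
  set C : Set Coord := e₀ '' tsupport f with hC
  have hCc : IsCompact C := hfc.image_of_continuousOn (e₀.continuousOn.mono hfe)
  have hCt : C ⊆ e₀.target := by rintro _ ⟨x, hx, rfl⟩; exact e₀.map_source (hfe hx)
  -- Compactness of the support gives one bound on the amplitude for all points at once.
  have hev : ∀ᶠ r : ℝ in 𝓝 0, ∀ u ∈ C, HasLorentzSignature σ (comp g.val e₀ u + r • m) := by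
    refine hCc.eventually_forall_of_forall_eventually fun u hu => ?_
    have hcont : ContinuousAt (fun p : ℝ × Coord => comp g.val e₀ p.2 + p.1 • m) (0, u) := by
      refine ContinuousAt.add ?_ (continuous_fst.smul continuous_const).continuousAt
      refine continuousAt_pi.2 fun i => continuousAt_pi.2 fun j => ?_
      exact ContinuousAt.comp (f := fun p : ℝ × Coord => p.2) (x := ((0 : ℝ), u))
        (g := fun z => comp g.val e₀ z i j) ((g.smooth e₀ he₀ i j).continuousOn.continuousAt
          (e₀.open_target.mem_nhds (hCt hu))) continuousAt_snd
    refine hcont.eventually ((isOpen_hasLorentzSignature σ).mem_nhds ?_)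
    simp only [zero_smul, add_zero, mem_ofPred_eq]
    exact (hasLorentzSignature_comp_iff g.val σ he₀ (hCt hu)).2 (hg _)
  obtain ⟨η, hη, hηr⟩ := Metric.eventually_nhds_iff.1 hev
  set δ := η / 2 with hδ
  have hδ0 : 0 < δ := by positivity
  set P : ∀ x : M, LinearMap.BilinForm ℝ (TangentSpace 𝓘(ℝ, Coord) x) := fun x => chartForm e₀ m x
  -- A variation must be Lorentzian for every real ε. The sine keeps the amplitude below η
  -- throughout and has derivative 1 at ε = 0, so the direction is δ f m.
  set r : ℝ → M → ℝ := fun ε x => δ * Real.sin ε * f x with hr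
  have hrη : ∀ ε x, dist (r ε x) 0 < η := by
    intro ε x
    rw [Real.dist_0_eq_abs, hr]
    simp only [abs_mul, abs_of_pos hδ0]
    calc δ * |Real.sin ε| * |f x| ≤ δ * 1 * 1 := by
          gcongr
          · exact Real.abs_sin_le_one ε
          · exact hf01 x
      _ < η := by rw [hδ]; linarith
  have hr0 : ∀ ε, ∀ x ∉ tsupport f, r ε x = 0 := fun ε x hx => by
    simp only [hr, image_eq_zero_of_notMem_tsupport hx, mul_zero]
  have hsm : ∀ e ∈ smoothCharts M, ∀ i j, ContDiffOn ℝ ∞ (fun p : ℝ × Coord =>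
      comp (fun x => g.val x + r p.1 x • P x) e p.2 i j) (univ ×ˢ e.target) := by
    intro e he i j
    have h1 : ContDiffOn ℝ ∞ (fun p : ℝ × Coord => comp g.val e p.2 i j + δ * Real.sin p.1 *
        (f (e.symm p.2) * comp P e p.2 i j)) (univ ×ˢ e.target) :=
      ((g.smooth e he i j).comp contDiffOn_snd fun _ hp => hp.2).add
        ((contDiffOn_const.mul (Real.contDiff_sin.comp_contDiffOn contDiffOn_fst)).mul
          ((contDiffOn_mul_comp_chartForm he he₀ hf hfe m i j).comp contDiffOn_snd fun _ hp => hp.2))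
    refine h1.congr fun p _ => ?_
    rw [comp_add_smul, Matrix.add_apply, Matrix.smul_apply, smul_eq_mul, hr]
    ring
  let metric : ℝ → LorentzMetric M := fun ε =>
    { val := fun x => g.val x + r ε x • P x
      symm := fun x v w => by
        simp only [LinearMap.add_apply, LinearMap.smul_apply, g.symm x v w,
          chartForm_symm e₀ hm x v w, P]
      lorentzian := by
        refine ⟨σ, hσ, fun x => ?_⟩
        by_cases hx : x ∈ tsupport f
        · have hu : e₀ x ∈ e₀.target := e₀.map_source (hfe hx)
          have h1 := (hasLorentzSignature_comp_iff (fun x => g.val x + r ε x • P x) σ he₀ hu).1 (by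
            rw [comp_add_smul, comp_chartForm he₀ (fun _ => m) hu]
            exact hηr (hrη ε _) _ ⟨x, hx, rfl⟩)
          rwa [e₀.left_inv (hfe hx)] at h1
        · rw [hr0 ε x hx, zero_smul, add_zero]
          exact hg x
      smooth := fun e he i j =>
        (hsm e he i j).comp (contDiffOn_const.prodMk contDiffOn_id) (fun _ hu => ⟨mem_univ ε, hu⟩) }
  have hval : ∀ ε, (metric ε).val = fun x => g.val x + r ε x • P x := fun _ => rfl
  have hoff : ∀ ε, ∀ x ∉ tsupport f, (metric ε).val x = g.val x := fun ε x hx => by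
    simp only [hval, hr0 ε x hx, zero_smul, add_zero]
  have hzero : metric 0 = g := by
    have : (metric 0).val = g.val := by
      rw [hval]; funext x; simp [hr]
    cases g; simp only [metric] at this ⊢; congr
  refine ⟨⟨metric, hzero, ⟨tsupport f, hfc, hfΔ, hoff⟩, hsm⟩, δ, hδ0, hoff, fun u hu => ?_⟩
  ext i j
  have h1 : (fun s => comp (metric s).val e₀ u i j) = fun s =>
      comp g.val e₀ u i j + Real.sin s * (δ * f (e₀.symm u) * m i j) := by
    funext s
    rw [hval, comp_add_smul, comp_chartForm he₀ (fun _ => m) hu, Matrix.add_apply, Matrix.smul_apply,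
      smul_eq_mul, hr]
    ring
  have h2 : HasDerivAt (fun s => comp (metric s).val e₀ u i j)
      (Real.cos 0 * (δ * f (e₀.symm u) * m i j)) 0 := by
    rw [h1]; exact ((Real.hasDerivAt_sin 0).mul_const _).const_add _
  rw [Real.cos_zero, one_mul] at h2
  exact h2.deriv

end BumpVariation

/-! ### The Euler–Lagrange expression and the field equations. -/

section EulerLagrange

variable {U : Set Coord} {g : Coord → Matrix (Fin 4) (Fin 4) ℝ} {A : Coord → Coord} {β : ℝ}
  {x : Coord}

theorem eulerLagrange_eq (a b : Fin 4) : eulerLagrange β g A x a b =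
    -(volDensity g x * ((g x)⁻¹ * Matrix.of (einsteinMaxwell β g A x) * (g x)⁻¹) a b) := by
  simp only [eulerLagrange, Matrix.mul_apply, Finset.sum_mul, Matrix.of_apply]
  rw [Finset.sum_comm]

theorem eulerLagrange_symm (h : CoordMetric U g) (hx : x ∈ U) (a b : Fin 4) :
    eulerLagrange β g A x a b = eulerLagrange β g A x b a := by
  have hinv := inv_symm_apply (h.symm x hx)
  simp only [eulerLagrange]
  rw [Finset.sum_comm]
  congr 2
  refine Finset.sum_congr rfl fun i _ => Finset.sum_congr rfl fun j _ => ?_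
  rw [einsteinMaxwell_symm h hx, hinv a, hinv i]
  ring

/-- Raising both indices and multiplying by a positive density are invertible operations. -/
theorem eulerLagrange_eq_zero_iff (hd : (g x).det ≠ 0) :
    (∀ a b, eulerLagrange β g A x a b = 0) ↔ ∀ i j, einsteinMaxwell β g A x i j = 0 := by
  constructor
  · intro h
    have h1 : (g x)⁻¹ * Matrix.of (einsteinMaxwell β g A x) * (g x)⁻¹ = 0 := by
      ext a b
      have h2 := h a b
      rw [eulerLagrange_eq, neg_eq_zero] at h2
      exact (mul_eq_zero.1 h2).resolve_left (volDensity_pos hd).ne'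
    have hu : IsUnit (g x).det := isUnit_iff_ne_zero.2 hd
    have h3 : Matrix.of (einsteinMaxwell β g A x) =
        g x * ((g x)⁻¹ * Matrix.of (einsteinMaxwell β g A x) * (g x)⁻¹) * g x := by
      rw [← Matrix.mul_assoc, ← Matrix.mul_assoc, Matrix.mul_nonsing_inv _ hu, Matrix.one_mul,
        Matrix.mul_assoc, Matrix.nonsing_inv_mul _ hu, Matrix.mul_one]
    rw [h1, Matrix.mul_zero, Matrix.zero_mul] at h3
    exact fun i j => congrFun (congrFun h3 i) j
  · intro h a b
    simp [eulerLagrange, h]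

end EulerLagrange

/-! ### The horizontal tensor, and stationarity of the action. -/

section Main

open MeasureTheory Set Filter Topology

variable {M : Type*} [TopologicalSpace M] [ChartedSpace Coord M]

theorem LorentzMetric.exists_sqNorm_ne_zero (g : LorentzMetric M)
    {e : OpenPartialHomeomorph M Coord} (he : e ∈ smoothCharts M) {u : Coord} (hu : u ∈ e.target) :
    ∃ y, sqNorm (EinsteinMaxwell.comp g.val e) u y ≠ 0 := by
  obtain ⟨σ, -, h⟩ := g.lorentzian
  obtain ⟨t, ht, -⟩ := (hasLorentzSignature_comp_iff g.val σ he hu).2 (h _)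
  exact ⟨t, fun h0 => ht.ne' (by rw [show bilin _ t t = 0 from h0, mul_zero])⟩

/-- By `calG_eq` the components do not depend on y. The forward direction needs some non-null y at
each point, which a timelike vector provides; otherwise the condition could be vacuous. -/
theorem calGVanishesOn_iff (g : LorentzMetric M) (A : OneForm M) (α : ℝ) (U : Set M) :
    CalGVanishesOn g A α U ↔ ∀ e ∈ smoothCharts M, ∀ u ∈ e.target, e.symm u ∈ U → ∀ i j,
      einsteinMaxwell (3 * α ^ 2 / 2) (comp g.val e) (A.comp e) u i j = 0 := by
  constructor
  · intro h e he u hu huU i j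
    obtain ⟨y, hy⟩ := g.exists_sqNorm_ne_zero he hu
    have := h e he u hu huU y hy i j
    rw [calG_eq (g.comp_symm e u) (g.comp_det_ne_zero he hu) hy] at this
    exact_mod_cast this
  · intro h e he u hu huU y hy i j
    rw [calG_eq (g.comp_symm e u) (g.comp_det_ne_zero he hu) hy, h e he u hu huU, Complex.ofReal_zero]

theorem einsteinMaxwell_transition (g : LorentzMetric M) (A : OneForm M) (β : ℝ)
    {e e' : OpenPartialHomeomorph M Coord} (he : e ∈ smoothCharts M) (he' : e' ∈ smoothCharts M)
    {u : Coord} (hu : u ∈ overlap e e') (i j : Fin 4) :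
    einsteinMaxwell β (comp g.val e) (A.comp e) u i j =
      ∑ a, ∑ b, jac (e' ∘ e.symm) u a i * jac (e' ∘ e.symm) u b j *
        einsteinMaxwell β (comp g.val e') (A.comp e') (e' (e.symm u)) a b :=
  (coordChange_transition he he').einsteinMaxwell_eq (g.coordMetric he')
    ((g.coordMetric he).mono (isOpen_overlap _ _) inter_subset_left)
    (fun _ hz => comp_transition g.val he he' hz) (A.contDiffOn_comp he')
    (fun _ hz i => A.comp_transition he he' hz i) β hu i j

theorem mem_overlap_chartAt {e : OpenPartialHomeomorph M Coord} {u : Coord} (hu : u ∈ e.target) :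
    u ∈ overlap e (chartAt Coord (e.symm u)) := ⟨hu, mem_chart_source Coord (e.symm u)⟩

variable [IsManifold 𝓘(ℝ, Coord) ∞ M]

theorem comp_chartForm_chartAt {e : OpenPartialHomeomorph M Coord} (he : e ∈ smoothCharts M)
    (m : M → Matrix (Fin 4) (Fin 4) ℝ) {u : Coord} (hu : u ∈ e.target) :
    comp (fun x => chartForm (chartAt Coord x) (m x) x) e u =
      (jac (chartAt Coord (e.symm u) ∘ e.symm) u).transpose * m (e.symm u) *
        jac (chartAt Coord (e.symm u) ∘ e.symm) u := by
  rw [← comp_chartForm_overlap he (chartAt_mem_smoothCharts (e.symm u)) (fun _ => m (e.symm u))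
    (mem_overlap_chartAt hu)]
  rfl

/-- The tensor field on `M` with components `einsteinMaxwell`. -/
noncomputable def einsteinMaxwellForm (g : LorentzMetric M) (A : OneForm M) (β : ℝ) (x : M) :
    LinearMap.BilinForm ℝ (TangentSpace 𝓘(ℝ, Coord) x) :=
  chartForm (chartAt Coord x) (Matrix.of (einsteinMaxwell β (comp g.val (chartAt Coord x))
    (A.comp (chartAt Coord x)) (chartAt Coord x x))) x

/-- The form was defined pointwise through the preferred chart, so this consistency in all charts
carries its smoothness; it is the tensor law of `einsteinMaxwell_transition`. -/
theorem comp_einsteinMaxwellForm (g : LorentzMetric M) (A : OneForm M) (β : ℝ)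
    {e : OpenPartialHomeomorph M Coord} (he : e ∈ smoothCharts M) {u : Coord} (hu : u ∈ e.target)
    (i j : Fin 4) : comp (einsteinMaxwellForm g A β) e u i j =
      einsteinMaxwell β (comp g.val e) (A.comp e) u i j := by
  have he' := chartAt_mem_smoothCharts (e.symm u)
  have h1 := comp_chartForm_chartAt he (fun x => Matrix.of (einsteinMaxwell β
    (comp g.val (chartAt Coord x)) (A.comp (chartAt Coord x)) (chartAt Coord x x))) hu
  refine (congrFun (congrFun h1 i) j).trans ?_
  rw [einsteinMaxwell_transition g A β he he' (mem_overlap_chartAt hu)]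
  simp only [Matrix.mul_apply, Matrix.transpose_apply, Finset.sum_mul, Matrix.of_apply]
  rw [Finset.sum_comm]
  exact Finset.sum_congr rfl fun a _ => Finset.sum_congr rfl fun b _ => by ring

/-- The witness is the pullback to TM of a tensor on M: it ignores the fibre argument. -/
theorem exists_horizontalTensor (g : LorentzMetric M) (A : OneForm M) (α : ℝ) :
    ∃ T : HorizontalTensor g, T.IsSymmetric ∧ T.HasComponentsCalG A α := by
  refine ⟨⟨fun x _ => einsteinMaxwellForm g A (3 * α ^ 2 / 2) x, fun e he i j => ?_⟩,
    fun x _ _ v w => ?_, fun e he u hu y hy i j => ?_⟩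
  · refine ((contDiffOn_einsteinMaxwell (β := 3 * α ^ 2 / 2) (g.coordMetric he)
      (A.contDiffOn_comp he) i j).comp
      contDiffOn_fst fun p hp => hp.1).congr fun p hp => ?_
    exact comp_einsteinMaxwellForm g A _ he hp.1 i j
  · exact chartForm_symm _ (fun i j => einsteinMaxwell_symm
      (g.coordMetric (chartAt_mem_smoothCharts x)) (mem_chart_target Coord x) _ i j) x v w
  · rw [calG_eq (g.comp_symm e u) (g.comp_det_ne_zero he hu) hy,
      ← comp_einsteinMaxwellForm g A _ he hu]
    rfl

variable [MeasurableSpace M] [BorelSpace M] [T2Space M]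

/-- The fundamental lemma of the calculus of variations: the direction is a bump function times the
value of the Euler–Lagrange expression at the point. -/
theorem eulerLagrange_eq_zero_of_stationary (A : OneForm M) (g : LorentzMetric M) (β : ℝ)
    {Δ : Set M} (hΔ : IsCompact Δ)
    (h : ∀ G : MetricVariation g Δ,
      ∫ x in Δ, densityRatio g (fun e => linDensity β (comp g.val e) (A.comp e)
        (compDeriv (fun ε => (G.metric ε).val) e)) x ∂(volumeMeasure g) = 0)
    {x₀ : M} (hx₀ : x₀ ∈ interior Δ) (a b : Fin 4) :
    eulerLagrange β (comp g.val (chartAt Coord x₀)) (A.comp (chartAt Coord x₀))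
      (chartAt Coord x₀ x₀) a b = 0 := by
  by_contra hne
  have he := chartAt_mem_smoothCharts x₀
  have hea : chartAt Coord x₀ ∈ atlas Coord M := chart_mem_atlas _ _
  have hxe : x₀ ∈ (chartAt Coord x₀).source := mem_chart_source _ _
  have hu₀ : chartAt Coord x₀ x₀ ∈ (chartAt Coord x₀).target := mem_chart_target _ _
  have hs₀ : (chartAt Coord x₀).symm (chartAt Coord x₀ x₀) = x₀ := (chartAt Coord x₀).left_inv hxe
  obtain ⟨e, hee⟩ : ∃ e, e = chartAt Coord x₀ := ⟨_, rfl⟩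
  rw [← hee] at hne he hea hxe hu₀ hs₀
  set L : Coord → Fin 4 → Fin 4 → ℝ := eulerLagrange β (comp g.val e) (A.comp e) with hL
  have hLc : ∀ a b, ContinuousOn (fun u => L u a b) e.target := fun a b =>
    (contDiffOn_eulerLagrange (g.coordMetric he) (A.contDiffOn_comp he) a b).continuousOn
  -- This constant matrix is a legitimate direction because the Euler–Lagrange expression is
  -- symmetric. Contracted with the expression it gives at the point a sum of squares, which is
  -- positive, and by continuity it remains positive nearby.
  set m : Matrix (Fin 4) (Fin 4) ℝ := Matrix.of (L (e x₀)) with hm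
  have hms : ∀ i j, m i j = m j i := fun i j => eulerLagrange_symm (g.coordMetric he) hu₀ i j
  set ψ : Coord → ℝ := fun u => ∑ a, ∑ b, L u a b * m a b with hψ
  have hψc : ContinuousOn ψ e.target := continuousOn_finsetSum _ fun a _ =>
    continuousOn_finsetSum _ fun b _ => (hLc a b).mul continuousOn_const
  have hψ₀ : 0 < ψ (e x₀) := by
    have hnn : ∀ i j, 0 ≤ L (e x₀) i j * m i j := fun i j => mul_self_nonneg (L (e x₀) i j)
    have h1 : 0 < L (e x₀) a b * m a b := by
      change 0 < L (e x₀) a b * L (e x₀) a b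
      exact mul_self_pos.2 hne
    calc 0 < L (e x₀) a b * m a b := h1
      _ ≤ ∑ b, L (e x₀) a b * m a b :=
          Finset.single_le_sum (f := fun b => L (e x₀) a b * m a b) (fun j _ => hnn a j)
            (Finset.mem_univ b)
      _ ≤ _ := Finset.single_le_sum (f := fun a => ∑ b, L (e x₀) a b * m a b)
            (fun i _ => Finset.sum_nonneg fun j _ => hnn i j) (Finset.mem_univ a)
  have hnhds : (e.source ∩ e ⁻¹' (e.target ∩ ψ ⁻¹' Ioi 0)) ∩ interior Δ ∈ 𝓝 x₀ := by
    refine inter_mem (IsOpen.mem_nhds (e.isOpen_inter_preimage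
      (hψc.isOpen_inter_preimage e.open_target isOpen_Ioi)) ⟨hxe, hu₀, hψ₀⟩)
      (isOpen_interior.mem_nhds hx₀)
  obtain ⟨f, hfs⟩ : ∃ f : SmoothBumpFunction 𝓘(ℝ, Coord) x₀,
      tsupport f ⊆ (e.source ∩ e ⁻¹' (e.target ∩ ψ ⁻¹' Ioi 0)) ∩ interior Δ := by
    obtain ⟨f, -, hf⟩ := (SmoothBumpFunction.nhds_basis_tsupport (I := 𝓘(ℝ, Coord)) x₀).mem_iff.1
      hnhds
    exact ⟨f, hf⟩
  have hfe : tsupport f ⊆ e.source := fun x hx => (hfs hx).1.1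
  have hfΔ : tsupport f ⊆ interior Δ := fun x hx => (hfs hx).2
  obtain ⟨G, δ, hδ, hoff, hG⟩ := exists_variation g he f.contMDiff
    (fun x => abs_le.2 ⟨by linarith [f.nonneg (x := x)], f.le_one⟩) f.hasCompactSupport hfe hfΔ hms
  have hint := h G
  have hG0 : (G.metric 0).val = g.val := by rw [G.metric_zero]
  rw [G.isMetricFamily.setIntegral_linDensity hG0 A β hea f.hasCompactSupport
    hfe (hfΔ.trans interior_subset) hΔ.measurableSet hoff] at hint
  have hint' : ∫ u in e.target, δ * f (e.symm u) * ψ u = 0 := by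
    rw [← hint]
    refine setIntegral_congr_fun e.open_target.measurableSet fun u hu => ?_
    simp only [hψ, Finset.mul_sum, hG u hu, Matrix.smul_apply, smul_eq_mul]
    exact Finset.sum_congr rfl fun a _ => Finset.sum_congr rfl fun b _ => by ring
  have hcont : ContinuousOn (fun u => δ * f (e.symm u) * ψ u) e.target :=
    (continuousOn_const.mul (f.continuous.comp_continuousOn e.continuousOn_symm)).mul hψc
  have hnonneg : ∀ u ∈ e.target, 0 ≤ δ * f (e.symm u) * ψ u := by
    intro u hu
    by_cases hfu : e.symm u ∈ tsupport f
    · have h1 : 0 < ψ u := by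
        have := (hfs hfu).1.2.2
        rwa [mem_preimage, e.right_inv hu] at this
      have h2 : 0 ≤ f (e.symm u) := f.nonneg
      positivity
    · rw [image_eq_zero_of_notMem_tsupport hfu]; simp
  have hintg : IntegrableOn (fun u => δ * f (e.symm u) * ψ u) e.target := by
    refine IntegrableOn.of_compact (C := e '' tsupport f) e.open_target
      (f.hasCompactSupport.isCompact.image_of_continuousOn (e.continuousOn.mono hfe))
      (by rintro _ ⟨x, hx, rfl⟩; exact e.map_source (hfe hx)) hcont fun u hu => ?_
    have : e.symm u ∉ tsupport f := fun h => hu.2 ⟨_, h, e.right_inv hu.1⟩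
    rw [image_eq_zero_of_notMem_tsupport this]; simp
  -- A continuous non-negative function with zero integral vanishes identically; but at x₀, where
  -- the bump function is 1, its value is δ ψ > 0.
  have hae := (setIntegral_eq_zero_iff_of_nonneg_ae ((ae_restrict_iff'
    e.open_target.measurableSet).2 (Eventually.of_forall hnonneg)) hintg).1 hint'
  have heq := Measure.eqOn_open_of_ae_eq hae e.open_target hcont continuousOn_const hu₀
  simp only [hs₀, f.eq_one, mul_one, Pi.zero_apply] at heq
  exact (mul_pos hδ hψ₀).ne' heq

variable [SecondCountableTopology M]

/-- The derivative of the action exists for every variation and is a nonzero constant times the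
integral, so by uniqueness of derivatives one vanishes exactly when the other does. -/
theorem isStationary_iff {c k : ℝ} (hc : 0 < c) (hk : 0 < k) (α : ℝ) (A : OneForm M)
    (V : ∀ g : LorentzMetric M, FibreMetric g) (g : LorentzMetric M) {Δ : Set M}
    (hΔ : IsCompact Δ) :
    IsStationary c k α A V g Δ ↔ ∀ G : MetricVariation g Δ,
      ∫ x in Δ, densityRatio g (fun e => linDensity (3 * α ^ 2 / 2) (comp g.val e) (A.comp e)
        (compDeriv (fun ε => (G.metric ε).val) e)) x ∂(volumeMeasure g) = 0 := by
  refine forall_congr' fun G => ?_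
  have h1 := (((hasDerivAt_integral_lagrangianAt hΔ G A (3 * α ^ 2 / 2)).const_mul
    unitBallVolume).const_mul (-(c ^ 3 / (16 * Real.pi * k)))).ofReal_comp
  simp only [action_eq]
  have hne : -(c ^ 3 / (16 * Real.pi * k)) ≠ 0 := by
    have := Real.pi_pos
    exact neg_ne_zero.2 (by positivity)
  constructor
  · intro h
    have h2 := h1.unique h
    rw [Complex.ofReal_eq_zero, mul_eq_zero, mul_eq_zero] at h2
    exact (h2.resolve_left hne).resolve_left unitBallVolume_pos.ne'
  · intro h
    refine h1.congr_deriv ?_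
    have h' : ∫ x in Δ, densityRatio g (fun e u => linDensity (3 * α ^ 2 / 2) (comp g.val e)
      (A.comp e) (famDeriv (fun s => comp (G.metric s).val e) 0) u) x ∂(volumeMeasure g) = 0 := h
    rw [h', mul_zero, mul_zero, Complex.ofReal_zero]

theorem isStationary_iff_calGVanishesOn {c k : ℝ} (hc : 0 < c) (hk : 0 < k) (α : ℝ) (A : OneForm M)
    (V : ∀ g : LorentzMetric M, FibreMetric g) (g : LorentzMetric M) {Δ : Set M}
    (hΔ : IsCompact Δ) :
    IsStationary c k α A V g Δ ↔ CalGVanishesOn g A α (interior Δ) := by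
  rw [isStationary_iff hc hk α A V g hΔ, calGVanishesOn_iff]
  constructor
  · intro h e he u hu huΔ i j
    -- The Euler–Lagrange equations were obtained in the preferred chart only; the tensor law
    -- carries them to the given one.
    rw [einsteinMaxwell_transition g A _ he (chartAt_mem_smoothCharts (e.symm u))
      (mem_overlap_chartAt hu)]
    have h1 := (eulerLagrange_eq_zero_iff (g.comp_det_ne_zero (chartAt_mem_smoothCharts (e.symm u))
      (mem_chart_target Coord (e.symm u)))).1
      (eulerLagrange_eq_zero_of_stationary A g (3 * α ^ 2 / 2) hΔ h huΔ)
    simp [h1]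
  · intro h G
    exact setIntegral_linDensity_eq_zero hΔ G A _ fun e he u hu huΔ =>
      (eulerLagrange_eq_zero_iff (g.comp_det_ne_zero he hu)).2 (h e he u hu huΔ)

end Main

end EinsteinMaxwell

theorem mainTheorem2 {M : Type*} [TopologicalSpace M] [ChartedSpace EinsteinMaxwell.Coord M]
    [IsManifold 𝓘(ℝ, EinsteinMaxwell.Coord) ∞ M] [T2Space M] [SecondCountableTopology M]
    [MeasurableSpace M] [BorelSpace M]
    (c k α : ℝ) (hc : 0 < c) (hk : 0 < k) (hα : 3 * α ^ 2 / 2 = k / c ^ 4)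
    (g : EinsteinMaxwell.LorentzMetric M) (A : EinsteinMaxwell.OneForm M)
    (V : ∀ g' : EinsteinMaxwell.LorentzMetric M, EinsteinMaxwell.FibreMetric g') :
    -- the `𝒢_ij` are the components of a symmetric horizontal tensor field on `TM`
    (∃ T : EinsteinMaxwell.HorizontalTensor g,
      T.IsSymmetric ∧ T.HasComponentsCalG A α) ∧
    -- it contains the electromagnetic stress-energy: `𝒢_ij = G_ij - (8πk/c⁴) T_ij`
    (∀ e ∈ IsManifold.maximalAtlas 𝓘(ℝ, EinsteinMaxwell.Coord) ∞ M, ∀ u ∈ e.target, ∀ y,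
      EinsteinMaxwell.sqNorm (EinsteinMaxwell.comp g.val e) u y ≠ 0 → ∀ i j,
        EinsteinMaxwell.calG (EinsteinMaxwell.comp g.val e) (A.comp e) α u y i j =
          ((EinsteinMaxwell.einsteinTensor (EinsteinMaxwell.comp g.val e) u i j
            - 8 * Real.pi * k / c ^ 4 *
              EinsteinMaxwell.emStressEnergy (EinsteinMaxwell.comp g.val e) (A.comp e) u i j
            : ℝ) : ℂ)) ∧
    -- the action over a compact domain is stationary iff `𝒢_ij = 0` over its interior
    (∀ Δ : Set M, IsCompact Δ →
      (EinsteinMaxwell.IsStationary c k α A V g Δ ↔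
        EinsteinMaxwell.CalGVanishesOn g A α (interior Δ))) ∧
    -- it is stationary over all compact domains iff `𝒢_ij = 0` everywhere
    ((∀ Δ : Set M, IsCompact Δ → EinsteinMaxwell.IsStationary c k α A V g Δ) ↔
      EinsteinMaxwell.CalGVanishesOn g A α Set.univ) := by
  have key := fun (Δ : Set M) (hΔ : IsCompact Δ) =>
    EinsteinMaxwell.isStationary_iff_calGVanishesOn hc hk α A V g hΔ
  refine ⟨EinsteinMaxwell.exists_horizontalTensor g A α, fun e he u hu y hy i j => ?_, key,
    fun h e he u hu _ => ?_, fun h Δ hΔ => (key Δ hΔ).2 fun e he u hu _ => h e he u hu trivial⟩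
  · rw [EinsteinMaxwell.calG_eq (g.comp_symm e u) (g.comp_det_ne_zero he hu) hy,
      EinsteinMaxwell.einsteinMaxwell_eq_stressEnergy hα]
  -- Every point lies in the interior of some compact Δ, so the local equivalences cover all of M.
  · have : LocallyCompactSpace M := ChartedSpace.locallyCompactSpace EinsteinMaxwell.Coord M
    obtain ⟨Δ, hΔ, hx, -⟩ := exists_compact_subset isOpen_univ (Set.mem_univ (e.symm u))
    exact (key Δ hΔ).1 (h Δ hΔ) e he u hu hx
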